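/- Let $D>1$ be a squarefree integer, $K=\mathbb{Q}(\sqrt D)\subset\mathbb{R}$ with Galois conjugation $a\mapsto\overline a$, ring of integers $\mathcal{O}_K$ with $\mathbb{Z}$-basis $\{1,\alpha_K\}$, where $\alpha_K=\frac{1+\sqrt D}{2}$ if $D\equiv1\pmod 4$ and $\alpha_K=\sqrt D$ otherwise, and fundamental unit $\varepsilon>1$. Identify $V_K=K\otimes_{\mathbb Q}\mathbb{R}$ with $\mathbb{R}^2$ by $a\otimes1\mapsto(\overline a,a)$, with coordinates $(s,u)$; put $\mathbf N(s,u)=|su|$ and $\mathbb{T}_K=V_K/\mathcal{O}_K$, and let $\phi$ be the automorphism of $\mathbb{T}_K$ induced by multiplication by $\varepsilon$. For $P\in\mathbb{T}_K$ let $M(P)=\inf_{Q\in\mathcal{O}_K}\mathbf N(P-Q)$ (computed with any representative of $P$ in $V_K$), for $t>0$ let $X_t=\{P\in\mathbb{T}_K : M(P)\ge t\}$, and let $M_1(K)=\sup_{P\in K}M(P)$. Let $R_0$, $R_1$ be the images in $\mathbb{T}_K$ of the planar open rectangles $(0,-\overline{\alpha_K})\times(0,1)$ and $(-1,0)\times(0,\alpha_K)$,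 whose union in the plane is called the footprint. Let $\mathscr{P}_0=\{R_0,R_1\}$ if $D=5$, and otherwise let $\mathscr{P}_0$ be the set of connected components of the sets $A_0\cap\phi^{-1}(A_1)$ with $A_0,A_1\in\{R_0,R_1\}$. For $n\ge0$ let $\mathscr{P}_n$ be the set of nonempty intersections $A=\bigcap_{i=-n}^{n}\phi^{-i}(A_i)$ with all $A_i\in\mathscr{P}_0$; the word $A_{-n}\cdots A_n$ is the coordinate word of $A$. Let $\Sigma\subseteq\mathscr{P}_0^{\mathbb Z}$ be the set of strings $(s_k)_{k\in\mathbb{Z}}$ with $s_k\cap\phi^{-1}(s_{k+1})\ne\emptyset$ for all $k$, with the shift $\sigma(s)_k=s_{k+1}$, and for $\mathscr{C}\subseteq\mathscr{P}_n$ let $\Sigma\langle\mathscr{C}\rangle$ be the subshift of all $s\in\Sigma$ in which no coordinate word of an element of $\mathscr{C}$ occurs. For finite $I\subseteq\mathcal{O}_K$ let $\mathscr{T}_n(t,I)$ be the set of $A\in\mathscr{P}_n$ such that the closure in $V_K$ of the representative of $A$ in the footprint is contained in $\bigcup_{Q\in I}\{P\in V_K : \mathbf N(P-Q)<t\}$.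 Finally let $I_K$ be the set of all $q\in\mathcal{O}_K$ such that, for some $R\in\mathscr{P}_0$ with planar representative $\widetilde R$ in the footprint, $\widetilde R-q$ meets the rectangle $|s|,|u|<\sqrt{\varepsilon(M_1(K)+1)}$. Then $I_K$ is finite, and for every $t>0$ and every finite $I\subseteq\mathcal{O}_K$ with $I_K\subseteq I$, $$h(\phi|X_t)=\lim_{n\to\infty}h\bigl(\sigma|\Sigma\langle\mathscr{T}_n(t,I)\rangle\bigr),$$ where $h$ denotes topological entropy (with the convention that the entropy of the empty system is $-\infty$). -/

import Mathlib

open Set Filter Topology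

noncomputable section

namespace RealQuad

/-! ### The real quadratic field `K = ℚ(√D)`, as a subfield of `ℝ` -/

/-- The field `ℚ(√D)`, embedded in `ℝ`. -/
abbrev K (D : ℕ) : IntermediateField ℚ ℝ := IntermediateField.adjoin ℚ {√(D : ℝ)}

/-- `√D` as an element of `K`. -/
def sqrtD (D : ℕ) : K D := ⟨√(D : ℝ), IntermediateField.mem_adjoin_simple_self ℚ _⟩

lemma exists_conj (D : ℕ) (hD : 1 < D) (hsq : Squarefree D) :
    ∃ τ : K D ≃ₐ[ℚ] K D, τ (sqrtD D) = -sqrtD D := by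
  have hirr : Irrational √(D : ℝ) := by
    rw [irrational_sqrt_natCast_iff]
    rintro ⟨r, hr⟩
    have h1 : IsUnit r := hsq r ⟨1, by simp [hr]⟩
    rw [Nat.isUnit_iff] at h1
    subst h1
    omega
  have hs : √(D : ℝ) ^ 2 = D := Real.sq_sqrt (by positivity)
  have hs' : sqrtD D ^ 2 = (D : K D) := Subtype.ext (by simpa [sqrtD] using hs)
  have hmonic : (Polynomial.X ^ 2 - Polynomial.C (D : ℚ)).Monic :=
    Polynomial.monic_X_pow_sub_C _ two_ne_zero
  have hint : IsIntegral ℚ √(D : ℝ) :=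
    ⟨Polynomial.X ^ 2 - Polynomial.C (D : ℚ), hmonic, by simp [hs]⟩
  have hmin : Polynomial.X ^ 2 - Polynomial.C (D : ℚ) = minpoly ℚ √(D : ℝ) := by
    refine minpoly.eq_of_irreducible_of_monic ?_ (by simp [hs]) hmonic
    have hdeg : (Polynomial.X ^ 2 - Polynomial.C (D : ℚ)).natDegree = 2 :=
      Polynomial.natDegree_X_pow_sub_C
    rw [Polynomial.irreducible_iff_roots_eq_zero_of_degree_le_three (by rw [hdeg])
      (by rw [hdeg]; norm_num), Multiset.eq_zero_iff_forall_notMem]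
    intro q hq
    have hq2 : q ^ 2 = (D : ℚ) := by
      have := (Polynomial.mem_roots'.1 hq).2
      simpa [Polynomial.IsRoot, sub_eq_zero] using this
    apply hirr
    refine ⟨|q|, ?_⟩
    have h2 : ((q : ℝ)) ^ 2 = (D : ℝ) := by exact_mod_cast hq2
    rw [← h2, Real.sqrt_sq_eq_abs]
    push_cast
    rfl
  have hroot : -sqrtD D ∈ (minpoly ℚ √(D : ℝ)).aroots (K D) := by
    rw [← hmin, Polynomial.mem_aroots]
    exact ⟨hmonic.ne_zero, by simp [hs']⟩
  let f : K D →ₐ[ℚ] K D :=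
    (IntermediateField.algHomAdjoinIntegralEquiv ℚ hint).symm ⟨_, hroot⟩
  have hf : f (sqrtD D) = -sqrtD D :=
    IntermediateField.algHomAdjoinIntegralEquiv_symm_apply_gen ℚ hint ⟨_, hroot⟩
  have : FiniteDimensional ℚ (K D) := IntermediateField.adjoin.finiteDimensional hint
  exact ⟨AlgEquiv.ofBijective f (Algebra.IsAlgebraic.algHom_bijective f), hf⟩

open Classical in
/-- Galois conjugation `a ↦ ā`: the automorphism of `K` with `√D ↦ -√D`
(it exists whenever `D > 1` is squarefree). -/
def conj (D : ℕ) : K D ≃ₐ[ℚ] K D :=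
  if h : ∃ τ : K D ≃ₐ[ℚ] K D, τ (sqrtD D) = -sqrtD D then h.choose else 1

lemma conj_sqrtD (D : ℕ) (hD : 1 < D) (hsq : Squarefree D) :
    conj D (sqrtD D) = -sqrtD D := by
  have h := exists_conj D hD hsq
  rw [conj, dif_pos h]
  exact h.choose_spec

/-- The ring of integers of `K`. -/
abbrev OK (D : ℕ) : Type := NumberField.RingOfIntegers (K D)

/-- The generator `α_K` of `𝓞 K = ℤ ⊕ ℤ α_K`. -/
def alpha (D : ℕ) : K D := if D % 4 = 1 then (1 + sqrtD D) / 2 else sqrtD D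

/-! ### The plane `V_K = K ⊗ ℝ`, in stable and unstable coordinates `(s, u)`, and the torus -/

/-- `V_K`, identified with `ℝ × ℝ` through `a ⊗ 1 ↦ (ā, a)`. -/
abbrev V : Type := ℝ × ℝ

/-- The embedding `a ↦ (ā, a)` of `K` into `V_K`. -/
def emb (D : ℕ) : K D →+* V :=
  RingHom.prod ((algebraMap (K D) ℝ).comp (conj D : K D →+* K D)) (algebraMap (K D) ℝ)

/-- The embedding of `𝓞 K` into `V_K`. -/
def embO (D : ℕ) : OK D →+* V := (emb D).comp (algebraMap (OK D) (K D))

/-- `𝓞 K` as a lattice in `V_K`. -/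
def lattice (D : ℕ) : AddSubgroup V := (embO D).toAddMonoidHom.range

/-- The torus `𝕋_K = V_K / 𝓞 K`, with its quotient topology and uniformity. -/
abbrev Torus (D : ℕ) : Type := V ⧸ lattice D

/-- The projection of the plane onto the torus. -/
def proj (D : ℕ) : V → Torus D := fun v => (v : V ⧸ lattice D)

/-- Multiplication by the unit `ε` on `V_K`; in coordinates, `(s, u) ↦ (ε̄ s, ε u)`. -/
def phiV (D : ℕ) (ε : (OK D)ˣ) : V ≃+ V where
  toFun v := embO D (ε : OK D) * v
  invFun v := embO D ((ε⁻¹ : (OK D)ˣ) : OK D) * v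
  left_inv v := by
    simp only
    rw [← mul_assoc, ← map_mul, Units.inv_mul, map_one, one_mul]
  right_inv v := by
    simp only
    rw [← mul_assoc, ← map_mul, Units.mul_inv, map_one, one_mul]
  map_add' v w := mul_add _ v w

lemma phiV_map_lattice (D : ℕ) (ε : (OK D)ˣ) :
    (lattice D).map ((phiV D ε : V ≃+ V) : V →+ V) = lattice D := by
  ext v
  constructor
  · rintro ⟨_, ⟨a, rfl⟩, rfl⟩
    exact ⟨(ε : OK D) * a, map_mul (embO D) _ _⟩
  · rintro ⟨a, rfl⟩
    refine ⟨embO D (((ε⁻¹ : (OK D)ˣ) : OK D) * a), ⟨_, rfl⟩, ?_⟩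
    change embO D (ε : OK D) * embO D (((ε⁻¹ : (OK D)ˣ) : OK D) * a) = embO D a
    rw [← map_mul, Units.mul_inv_cancel_left]

/-- The automorphism `φ` of the torus induced by multiplication by `ε`. -/
def phi (D : ℕ) (ε : (OK D)ˣ) : Equiv.Perm (Torus D) :=
  (QuotientAddGroup.congr (lattice D) (lattice D) (phiV D ε) (phiV_map_lattice D ε)).toEquiv

/-! ### The norm form, the function `M`, and the sets `X_t` -/

/-- The absolute norm, extended to the plane: `N(s, u) = |s u|`. -/
def absNorm (v : V) : ℝ := |v.1 * v.2|

/-- `M(P) = inf_{Q ∈ 𝓞 K} N(P - Q)` on the plane. -/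
def MV (D : ℕ) (v : V) : ℝ := ⨅ q : lattice D, absNorm (v - q)

lemma MV_congr (D : ℕ) (v w : V) (h : v - w ∈ lattice D) : MV D v = MV D w := by
  refine Equiv.iInf_congr (Equiv.subRight (⟨v - w, h⟩ : lattice D)) fun q => ?_
  simp only [Equiv.subRight_apply, AddSubgroup.coe_sub]
  congr 1
  abel

/-- The function `M` on the torus. -/
def M (D : ℕ) : Torus D → ℝ :=
  Quotient.lift (MV D) fun v w h => by
    have h' := (lattice D).neg_mem (QuotientAddGroup.leftRel_apply.1 h)
    exact MV_congr D v w (by simpa [sub_eq_add_neg, add_comm] using h')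

/-- The Euclidean minimum `M₁(K) = sup_{P ∈ K} M(P)`. -/
def M1 (D : ℕ) : ℝ := ⨆ a : K D, M D (proj D (emb D a))

/-- `X_t = {P ∈ 𝕋_K | M(P) ≥ t}`. -/
def X (D : ℕ) (t : ℝ) : Set (Torus D) := {P | t ≤ M D P}

/-! ### The Markov partitions `P_n` -/

/-- The rectangles of the original two-rectangle partition, in the plane: `R₀` is
`(0, -ᾱ_K) × (0, 1)` and `R₁` is `(-1, 0) × (0, α_K)`, in coordinates `(s, u)`. -/
def planeR (D : ℕ) : Fin 2 → Set V :=
  ![Ioo 0 (-(emb D (alpha D)).1) ×ˢ Ioo 0 1, Ioo (-1) 0 ×ˢ Ioo 0 (emb D (alpha D)).2]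

/-- The footprint `R₀ ∪ R₁` in the plane; it maps injectively to the torus. -/
def footprint (D : ℕ) : Set V := planeR D 0 ∪ planeR D 1

/-- The rectangles `R₀` and `R₁` on the torus. -/
def torusR (D : ℕ) (i : Fin 2) : Set (Torus D) := proj D '' planeR D i

/-- The initial Markov generator: `{R₀, R₁}` for `ℚ(√5)`, and for every other `K` the set of
connected components of the intersections `A₀ ∩ φ⁻¹(A₁)`, `A₀, A₁ ∈ {R₀, R₁}`. -/
def P0 (D : ℕ) (ε : (OK D)ˣ) : Set (Set (Torus D)) :=
  if D = 5 then range (torusR D)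
  else {C | ∃ i j : Fin 2, ∃ P ∈ torusR D i ∩ phi D ε ⁻¹' torusR D j,
    C = connectedComponentIn (torusR D i ∩ phi D ε ⁻¹' torusR D j) P}

/-- Words `A_{-n} ⋯ A_0 ⋯ A_n` in the alphabet `P_0`. -/
abbrev Word (D : ℕ) (ε : (OK D)ˣ) (n : ℕ) : Type := Icc (-(n : ℤ)) n → P0 D ε

/-- The set `φⁿ(A_{-n}) ∩ ⋯ ∩ A_0 ∩ ⋯ ∩ φ⁻ⁿ(A_n)`. -/
def rect (D : ℕ) (ε : (OK D)ˣ) (n : ℕ) (w : Word D ε n) : Set (Torus D) :=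
  ⋂ i : Icc (-(n : ℤ)) n, (phi D ε ^ (i : ℤ)) ⁻¹' (w i : Set (Torus D))

/-- The `n`-th refinement `P_n`: all nonempty intersections as above. -/
def P (D : ℕ) (ε : (OK D)ˣ) (n : ℕ) : Set (Set (Torus D)) :=
  {A | A.Nonempty ∧ ∃ w : Word D ε n, A = rect D ε n w}

/-- The planar representative of a subset of the torus inside the footprint `R₀ ∪ R₁`. -/
def rep (D : ℕ) (A : Set (Torus D)) : Set V := footprint D ∩ proj D ⁻¹' A

/-! ### Symbolic dynamics -/

/-- The shift `σ(s)_i = s_{i+1}`. -/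
def shift {A : Type*} (s : ℤ → A) : ℤ → A := fun i => s (i + 1)

/-- The topological entropy of the shift on a shift-invariant set `S` of bi-infinite strings over
the discrete alphabet `A`. -/
def shiftEntropy {A : Type*} (S : Set (ℤ → A)) : EReal :=
  letI : UniformSpace A := ⊥
  Dynamics.coverEntropy (shift : (ℤ → A) → ℤ → A) S

/-- The set `Σ` of admissible bi-infinite strings in the alphabet `P_0`. -/
def Sig (D : ℕ) (ε : (OK D)ˣ) : Set (ℤ → P0 D ε) :=
  {s | ∀ k : ℤ, ((s k : Set (Torus D)) ∩ phi D ε ⁻¹' (s (k + 1) : Set (Torus D))).Nonempty}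

/-- For a collection `C ⊆ P_n`, the subshift `Σ⟨C⟩` of `Σ` avoiding the coordinate words of the
elements of `C`. -/
def SigAvoid (D : ℕ) (ε : (OK D)ˣ) (n : ℕ) (C : Set (Set (Torus D))) : Set (ℤ → P0 D ε) :=
  {s ∈ Sig D ε | ∀ w : Word D ε n, rect D ε n w ∈ C →
    ¬ ∃ k : ℤ, ∀ i : Icc (-(n : ℤ)) n, s (k + i) = w i}

/-! ### Trapping rectangles -/

/-- `U(t, I) = ⋃_{Q ∈ I} {P ∈ V_K | N(P - Q) < t}`. -/
def U (D : ℕ) (t : ℝ) (I : Set (OK D)) : Set V := ⋃ q ∈ I, {v | absNorm (v - embO D q) < t}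

/-- `T_n(t, I)`: the rectangles of `P_n` whose (planar) closures lie in `U(t, I)`. -/
def T (D : ℕ) (ε : (OK D)ˣ) (n : ℕ) (t : ℝ) (I : Set (OK D)) : Set (Set (Torus D)) :=
  {A ∈ P D ε n | closure (rep D A) ⊆ U D t I}

/-- The rectangle `|s|, |u| < √(ε (M₁(K) + 1))`. -/
def Rbig (D : ℕ) (ε : (OK D)ˣ) : Set V :=
  {v | |v.1| < √((embO D (ε : OK D)).2 * (M1 D + 1)) ∧
    |v.2| < √((embO D (ε : OK D)).2 * (M1 D + 1))}

/-- `I_K`: the lattice points `q` such that `R - q` meets the rectangle above for some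
`R ∈ P_0`. -/
def IK (D : ℕ) (ε : (OK D)ˣ) : Set (OK D) :=
  {q | ∃ R ∈ P0 D ε, ∃ v ∈ rep D R, v - embO D q ∈ Rbig D ε}

/-- `ε` is the fundamental unit with `ε > 1` in the fixed embedding `K ⊆ ℝ`. -/
def IsFundamentalUnit (D : ℕ) (ε : (OK D)ˣ) : Prop :=
  1 < (((ε : OK D) : K D) : ℝ) ∧ ∀ u : (OK D)ˣ, ∃ n : ℤ, u = ε ^ n ∨ u = -ε ^ n

end RealQuad

end

/-! The boundary of the tiling by translates of R₀ and R₁ consists of stable segments, which φ maps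
into the boundary, and unstable segments, which φ⁻¹ maps into the boundary. Hence `P0` is a Markov
partition (`planeR_markov`, `isMarkov`): a string s ∈ Σ determines a point `code s` of the plane,
and s ↦ proj (code s) is a semiconjugacy from the shift onto φ (`semiconj_code`,
`exists_proj_code_eq`). It need not be injective, but a small dynamical ball is coded by a number of
words that is bounded independently of their length (`exists_ncard_words_bound`), so no entropy is
lost.

Let S be the set `codesX` of strings that code points of X_t. It is contained in every Σ⟨T_n(t, I)⟩,
because the point coded by a string lies in the closure of each of its rectangles. Conversely, a
string of Σ outside S codes a point with M < t. Some lattice translate of this point has norm below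
both t and M₁(K) + 1, and multiplication by a power of ε, which preserves the norm, balances the two
coordinates inside the box defining I_K. So some shift of the string codes a point of the open set
U(t, I) (`exists_codeAt_mem_U`). Rectangles around that point shrink like ε⁻ⁿ, hence are trapping
for large n, for this string and for all strings near it (`eventually_not_agree`). That the
inhomogeneous minimum stays below M₁(K) + 1 comes from a closing lemma: almost periodic orbits are
followed by periodic ones, and periodic points lie in K (`MV_lt_M1_add_one`).

By compactness the words of length m of Σ⟨T_n(t, I)⟩ are words of S once n is large.
Submultiplicativity bounds the entropy of a subshift by its word count at a single length m, and the
word counts of S are at most a constant times the dynamical covering numbers of X_t. Letting n and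
then m tend to infinity gives the upper bound. The lower bound holds because X_t is a factor of S
(`tendsto_shiftEntropy`). -/

open Set Filter Topology

noncomputable section

namespace RealQuad

/-! ### Word counts and the entropy of subshifts -/

section Symbolic

open Dynamics ExpGrowth Uniformity

/-- The words of length `m` occurring in the strings of `S` at the positions `0, …, m - 1`. -/
def words {A : Type*} (S : Set (ℤ → A)) (m : ℕ) : Set (Fin m → A) :=
  (fun s (i : Fin m) => s (i : ℤ)) '' S

lemma coverMincard_le_ncard_of_code {X β : Type*} (T : X → X) (S : Set X) (U : SetRel X X) (m : ℕ)
    (f : X → β) (B : Set β) (hB : B.Finite) (hf : ∀ x ∈ S, f x ∈ B)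
    (h : ∀ x ∈ S, ∀ y ∈ S, f x = f y → (x, y) ∈ dynEntourage T U m) :
    coverMincard T S U m ≤ (B.ncard : ℕ∞) := by
  classical
  rcases S.eq_empty_or_nonempty with rfl | ⟨x0, -⟩
  · simp
  have : Nonempty X := ⟨x0⟩
  have hfin : (f '' S).Finite := hB.subset (by rintro _ ⟨x, hx, rfl⟩; exact hf x hx)
  choose! g hg using fun b (hb : b ∈ f '' S) => hb
  have hcov : IsDynCoverOf T S U m (hfin.toFinset.image g : Finset X) := by
    intro x hx
    have hb := hg (f x) ⟨x, hx, rfl⟩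
    refine ⟨g (f x), ?_, h x hx _ hb.1 hb.2.symm⟩
    simp only [Finset.coe_image, Finite.coe_toFinset]
    exact ⟨f x, ⟨x, hx, rfl⟩, rfl⟩
  refine hcov.coverMincard_le_card.trans ?_
  norm_cast
  refine Finset.card_image_le.trans ?_
  rw [← ncard_eq_toFinset_card _ hfin]
  exact ncard_le_ncard (by rintro _ ⟨x, hx, rfl⟩; exact hf x hx) hB

/-- Each ball of a minimal dynamical cover accounts for at most `C` values of `f`. The condition `C
≠ 0` serves the case of an infinite covering number, where the right side must be `⊤`. -/
lemma ncard_image_le_mul_coverMincard {X ι β : Type*} [Finite β] (T : X → X) (F : Set X)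
    (V : SetRel X X) (m C : ℕ) (hC : C ≠ 0) (S : Set ι) (g : ι → X) (hg : ∀ s ∈ S, g s ∈ F) (f : ι → β)
    (h : ∀ x, (f '' {s ∈ S | (g s, x) ∈ dynEntourage T V m}).ncard ≤ C) :
    ((f '' S).ncard : ℕ∞) ≤ C * coverMincard T F V m := by
  classical
  by_cases htop : coverMincard T F V m = ⊤
  · rw [htop, ENat.mul_top (by exact_mod_cast hC)]
    exact le_top
  obtain ⟨t, ht, htc⟩ := (coverMincard_finite_iff T F V m).1 (lt_top_iff_ne_top.2 htop)
  rw [← htc]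
  norm_cast
  have hsub : f '' S ⊆ ⋃ x ∈ t, f '' {s ∈ S | (g s, x) ∈ dynEntourage T V m} := by
    rintro _ ⟨s, hs, rfl⟩
    obtain ⟨x, hx, hsx⟩ := ht (hg s hs)
    exact mem_biUnion hx ⟨s, ⟨hs, hsx⟩, rfl⟩
  refine (ncard_le_ncard hsub (toFinite _)).trans ?_
  refine (Finset.set_ncard_biUnion_le t _).trans ?_
  rw [mul_comm, ← smul_eq_mul]
  exact Finset.sum_le_card_nsmul _ _ _ fun x _ => h x

/-- Two strings agree at the positions `-j, …, j`. -/
def Agree {A : Type*} (j : ℕ) (s s' : ℤ → A) : Prop := ∀ i : ℤ, -(j : ℤ) ≤ i → i ≤ j → s i = s' i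

/-- The entourage of pairs of strings that agree at the positions `-j, …, j`. -/
def agreeRel (A : Type*) (j : ℕ) : SetRel (ℤ → A) (ℤ → A) := {p | Agree j p.1 p.2}

lemma Agree.symm {A : Type*} {j : ℕ} {s s' : ℤ → A} (h : Agree j s s') : Agree j s' s :=
  fun i hi hi' => (h i hi hi').symm

lemma Agree.trans {A : Type*} {j : ℕ} {s s' s'' : ℤ → A} (h : Agree j s s') (h' : Agree j s' s'') :
    Agree j s s'' := fun i hi hi' => (h i hi hi').trans (h' i hi hi')

lemma iterate_shift {A : Type*} (n : ℕ) (s : ℤ → A) (i : ℤ) : shift^[n] s i = s (i + n) := by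
  induction n generalizing s with
  | zero => simp
  | succ n ih =>
    rw [Function.iterate_succ_apply, ih, shift]
    congr 1
    push_cast
    ring

lemma mem_dynEntourage_agreeRel {A : Type*} {j m : ℕ} {s s' : ℤ → A} :
    (s, s') ∈ dynEntourage shift (agreeRel A j) m ↔
      ∀ k < m, ∀ i : ℤ, -(j : ℤ) ≤ i → i ≤ j → s (i + k) = s' (i + k) := by
  rw [mem_dynEntourage]
  simp only [agreeRel, Agree, mem_ofPred_eq, iterate_shift]

instance {A : Type*} (j : ℕ) : (agreeRel A j).IsSymm := ⟨fun _ _ h => Agree.symm h⟩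

lemma exists_agreeRel_subset {A : Type*} {V : SetRel (ℤ → A) (ℤ → A)}
    (hV : letI : UniformSpace A := ⊥; V ∈ 𝓤 (ℤ → A)) : ∃ j, agreeRel A j ⊆ V := by
  let : UniformSpace A := ⊥
  rw [Pi.uniformity] at hV
  have h1 : ∀ i : ℤ, comap (fun a : (ℤ → A) × (ℤ → A) => (a.1 i, a.2 i)) (𝓤 A) =
      𝓟 {p | p.1 i = p.2 i} := by
    intro i
    rw [show 𝓤 A = 𝓟 SetRel.id from rfl, comap_principal]
    rfl
  simp only [h1] at hV
  obtain ⟨I, hI, hIV⟩ := (hasBasis_iInf_principal_finite _).mem_iff.1 hV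
  obtain ⟨B, hB⟩ := (hI.image Int.natAbs).bddAbove
  refine ⟨B, fun p hp => hIV ?_⟩
  rw [mem_iInter₂]
  intro i hi
  have : i.natAbs ≤ B := hB ⟨i, hi, rfl⟩
  exact hp i (by omega) (by omega)

lemma agreeRel_mem_uniformity (A : Type*) (j : ℕ) :
    letI : UniformSpace A := ⊥; agreeRel A j ∈ 𝓤 (ℤ → A) := by
  let : UniformSpace A := ⊥
  have : agreeRel A j = ⋂ i ∈ Icc (-(j : ℤ)) j, {p : (ℤ → A) × (ℤ → A) | p.1 i = p.2 i} := by
    ext p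
    simp [agreeRel, Agree]
  rw [this, biInter_mem (finite_Icc _ _)]
  intro i _
  rw [Pi.uniformity]
  refine mem_iInf_of_mem i ⟨SetRel.id, ?_, fun p hp => hp⟩
  rw [show 𝓤 A = 𝓟 SetRel.id from rfl]
  exact mem_principal_self _

/-- The entropy of a subshift is bounded by the growth of its words of any given length. -/
lemma shiftEntropy_le_log_ncard_words_div {A : Type*} [Finite A] {S : Set (ℤ → A)}
    (hS : MapsTo shift S S) {m : ℕ} (hm : m ≠ 0) :
    shiftEntropy S ≤ ENNReal.log (words S m).ncard / m := by
  let : UniformSpace A := ⊥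
  have hone : ∀ n, ((words S n).ncard : ℕ∞) ≤ coverMincard shift S (agreeRel A 0) n := by
    intro n
    have := ncard_image_le_mul_coverMincard shift S (agreeRel A 0) n 1 one_ne_zero S id
      (fun s hs => hs) (fun s (i : Fin n) => s (i : ℤ)) ?_
    · rwa [Nat.cast_one, one_mul] at this
    intro x
    refine ncard_le_one_iff_subsingleton.2 ?_
    rintro _ ⟨s, ⟨-, hs⟩, rfl⟩ _ ⟨s', ⟨-, hs'⟩, rfl⟩
    funext i
    have h1 := mem_dynEntourage_agreeRel.1 hs i i.2 0 (by simp) (by simp)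
    have h2 := mem_dynEntourage_agreeRel.1 hs' i i.2 0 (by simp) (by simp)
    simp only [zero_add, id] at h1 h2
    exact h1.trans h2.symm
  -- Windows of radius `j` along `n` shifts see the positions from `-j` to `n + j - 1`: the word
  -- itself and `j` further symbols on each side. The extra factor does not depend on `n`, so it
  -- disappears from the growth rate.
  have hle : ∀ j n, coverMincard shift S (agreeRel A j) n ≤
      (((words S n).ncard * (Nat.card (Fin j → A) * Nat.card (Fin j → A)) : ℕ) : ℕ∞) := by
    intro j n
    have := coverMincard_le_ncard_of_code shift S (agreeRel A j) n
      (fun s => ((fun i : Fin n => s (i : ℤ)),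
        ((fun i : Fin j => s (-1 - (i : ℤ))), (fun i : Fin j => s (n + (i : ℤ))))))
      (words S n ×ˢ (univ ×ˢ univ)) (toFinite _) (fun s hs => ⟨⟨s, hs, rfl⟩, trivial, trivial⟩) ?_
    · rwa [ncard_prod, ncard_prod, ncard_univ] at this
    intro s _ s' _ h
    simp only [Prod.mk.injEq, funext_iff] at h
    obtain ⟨h0, h1, h2⟩ := h
    rw [mem_dynEntourage_agreeRel]
    intro k hk i hi hi'
    rcases lt_or_ge (i + k) 0 with hneg | hpos
    · have := h1 ⟨(-1 - (i + k)).toNat, by omega⟩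
      rwa [show -1 - (((⟨(-1 - (i + k)).toNat, by omega⟩ : Fin j) : ℕ) : ℤ) = i + k by
        simp only; omega] at this
    rcases lt_or_ge (i + k) n with hn | hn
    · have := h0 ⟨(i + k).toNat, by omega⟩
      rwa [show (((⟨(i + k).toNat, by omega⟩ : Fin n) : ℕ) : ℤ) = i + k by
        simp only; omega] at this
    · have := h2 ⟨(i + k - n).toNat, by omega⟩
      rwa [show (n : ℤ) + (((⟨(i + k - n).toNat, by omega⟩ : Fin j) : ℕ) : ℤ) = i + k by
        simp only; omega] at this
  change coverEntropy shift S ≤ _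
  refine iSup₂_le fun V hV => ?_
  obtain ⟨j, hj⟩ := exists_agreeRel_subset hV
  refine (coverEntropyEntourage_antitone shift S hj).trans ?_
  have h1 : coverEntropyEntourage shift S (agreeRel A j) ≤
      coverEntropyEntourage shift S (agreeRel A 0) := by
    refine expGrowthSup_le_of_eventually_le
      (b := ((Nat.card (Fin j → A) * Nat.card (Fin j → A) : ℕ) : ENNReal))
      (ENNReal.natCast_ne_top _) (Eventually.of_forall fun n => ?_)
    have h2 := ENat.toENNReal_mono (hle j n)
    have h3 := ENat.toENNReal_mono (hone n)
    rw [ENat.toENNReal_coe] at h2 h3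
    refine h2.trans ?_
    rw [Nat.cast_mul, mul_comm]
    gcongr
  -- Agreement at position 0 is transitive, so this entourage absorbs its own composition, and the
  -- submultiplicative bound at the single length `m` applies without loss.
  refine h1.trans ((coverEntropyEntourage_antitone shift S (?_ : SetRel.comp (agreeRel A 0)
    (agreeRel A 0) ⊆ agreeRel A 0)).trans
      ((coverEntropyEntourage_le_log_coverMincard_div hS hm).trans ?_))
  · rintro p ⟨y, h1, h2⟩
    exact Agree.trans h1 h2
  · refine EReal.monotone_div_right_of_nonneg m.cast_nonneg' (ENNReal.log_monotone ?_)
    have h2 := ENat.toENNReal_mono (hle 0 m)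
    simp only [Nat.card_eq_fintype_card, Fintype.card_unique, mul_one] at h2
    rwa [ENat.toENNReal_coe] at h2

/-- The entropy of a factor of a subshift is at most that of the subshift. -/
lemma coverEntropy_image_le_shiftEntropy {A X : Type*} [UniformSpace X] {T : X → X}
    {p : (ℤ → A) → X} (hp : Function.Semiconj p shift T)
    (hc : ∀ V ∈ 𝓤 X, ∃ j, ∀ s s', Agree j s s' → (p s, p s') ∈ V) (S : Set (ℤ → A)) :
    coverEntropy T (p '' S) ≤ shiftEntropy S := by
  let : UniformSpace A := ⊥
  refine coverEntropy_image_le_of_uniformContinuous hp ?_ S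
  intro V hV
  obtain ⟨j, hj⟩ := hc V hV
  exact mem_map.2 <| mem_of_superset (agreeRel_mem_uniformity A j) fun (q : (ℤ → A) × (ℤ → A)) hq =>
    hj q.1 q.2 hq

/-- If every string outside `S` has a cylinder neighbourhood that misses all but finitely many of
the sets `Sn`, then the words of given length of `Sn` are eventually words of `S`. -/
lemma eventually_words_subset {A : Type*} [Finite A] {Sn : ℕ → Set (ℤ → A)} {S : Set (ℤ → A)}
    (h : ∀ s ∉ S, ∃ j, ∀ᶠ n in atTop, ∀ s' ∈ Sn n, ¬ Agree j s s') (m : ℕ) :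
    ∀ᶠ n in atTop, words (Sn n) m ⊆ words S m := by
  let : TopologicalSpace A := ⊥
  have : DiscreteTopology A := ⟨rfl⟩
  have key : ∀ w : Fin m → A, ∀ᶠ n in atTop, w ∈ words (Sn n) m → w ∈ words S m := by
    intro w
    by_cases hw : w ∈ words S m
    · exact Eventually.of_forall fun _ _ => hw
    -- The cylinder of `w` is compact, so finitely many of the neighbourhoods in `h` cover it and
    -- one threshold for `n` serves them all.
    have hcomp : IsCompact {s : ℤ → A | (fun i : Fin m => s (i : ℤ)) = w} := by
      refine IsClosed.isCompact ?_
      exact isClosed_eq (continuous_pi fun i => continuous_apply _) continuous_const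
    have hout : ∀ s ∈ {s : ℤ → A | (fun i : Fin m => s (i : ℤ)) = w}, s ∉ S :=
      fun s hs hsS => hw ⟨s, hsS, hs⟩
    have hev : ∀ᶠ n in atTop, ∀ s ∈ {s : ℤ → A | (fun i : Fin m => s (i : ℤ)) = w}, s ∉ Sn n := by
      refine hcomp.induction_on (p := fun K => ∀ᶠ n in atTop, ∀ s ∈ K, s ∉ Sn n) (by simp)
        (fun s t hst ht => ht.mono fun n hn x hx => hn x (hst hx))
        (fun s t hs ht => (hs.and ht).mono fun n hn x hx => hx.elim (hn.1 x) (hn.2 x)) ?_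
      intro s hs
      obtain ⟨j, hj⟩ := h s (hout s hs)
      refine ⟨{s' | Agree j s s'}, mem_nhdsWithin_of_mem_nhds ?_, hj.mono fun n hn x hx hxs =>
        hn x hxs hx⟩
      have : {s' | Agree j s s'} = ⋂ i ∈ Icc (-(j : ℤ)) j, {s' | s i = s' i} := by
        ext s'
        simp [Agree]
      rw [this, biInter_mem (finite_Icc _ _)]
      intro i _
      have : IsOpen {s' : ℤ → A | s i = s' i} :=
        (isOpen_discrete {a | s i = a}).preimage (continuous_apply (A := fun _ => A) i)
      exact this.mem_nhds rfl
    refine hev.mono fun n hn hwn => ?_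
    obtain ⟨s, hs, hsw⟩ := hwn
    exact absurd hs (hn s hsw)
  filter_upwards [eventually_all.2 key] with n hn w hw
  exact hn w hw

/-- The entropies of subshifts that decrease towards `S` tend to the entropy of any system whose
dynamical covers control the words of `S` and which is a factor of `S`. -/
lemma tendsto_shiftEntropy {A X : Type*} [Finite A] [UniformSpace X] {T : X → X} {F : Set X}
    {Sn : ℕ → Set (ℤ → A)} {S : Set (ℤ → A)} (hinv : ∀ n, MapsTo shift (Sn n) (Sn n))
    (hle : ∀ n, S ⊆ Sn n)
    (hlim : ∀ s ∉ S, ∃ j, ∀ᶠ n in atTop, ∀ s' ∈ Sn n, ¬ Agree j s s')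
    (hfac : coverEntropy T F ≤ shiftEntropy S) {V : SetRel X X} (hV : V ∈ 𝓤 X) (C : ℕ)
    (hC : ∀ m ≠ 0, ((words S m).ncard : ℕ∞) ≤ C * coverMincard T F V m) :
    Tendsto (fun n => shiftEntropy (Sn n)) atTop (𝓝 (coverEntropy T F)) := by
  refine tendsto_of_le_liminf_of_limsup_le ?_ ?_
  · refine le_liminf_of_le (by isBoundedDefault) (Eventually.of_forall fun n => hfac.trans ?_)
    let : UniformSpace A := ⊥
    exact coverEntropy_monotone shift (hle n)
  -- The length `m` is fixed while `n` tends to infinity. Only afterwards does `m` grow, and then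
  -- the factor `C` has no effect on the exponential rate.
  · have h1 : ∀ m ≠ 0, limsup (fun n => shiftEntropy (Sn n)) atTop ≤
        ENNReal.log ((C : ENNReal) * (coverMincard T F V m : ENNReal)) / m := by
      intro m hm
      refine limsup_le_of_le (by isBoundedDefault) ?_
      filter_upwards [eventually_words_subset hlim m] with n hn
      refine (shiftEntropy_le_log_ncard_words_div (hinv n) hm).trans ?_
      refine EReal.monotone_div_right_of_nonneg m.cast_nonneg' (ENNReal.log_monotone ?_)
      have h2 := ENat.toENNReal_mono (hC m hm)
      rw [ENat.toENNReal_coe, ENat.toENNReal_mul, ENat.toENNReal_coe] at h2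
      refine le_trans ?_ h2
      exact_mod_cast ncard_le_ncard hn (toFinite _)
    calc limsup (fun n => shiftEntropy (Sn n)) atTop
        ≤ expGrowthSup (fun m => (C : ENNReal) * (coverMincard T F V m : ENNReal)) := by
          refine le_limsup_of_frequently_le ?_ (by isBoundedDefault)
          refine Eventually.frequently ?_
          filter_upwards [eventually_ne_atTop 0] with m hm
          exact h1 m hm
      _ ≤ coverEntropyEntourage T F V :=
          expGrowthSup_le_of_eventually_le (b := (C : ENNReal)) (ENNReal.natCast_ne_top _)
            (Eventually.of_forall fun n => le_rfl)
      _ ≤ coverEntropy T F := coverEntropyEntourage_le_coverEntropy T F hV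

end Symbolic

/-! ### The lattice in coordinates -/

/-- The real number `α_K`. -/
def ra (D : ℕ) : ℝ := (emb D (alpha D)).2

/-- The real number `-ᾱ_K`. -/
def rb (D : ℕ) : ℝ := -(emb D (alpha D)).1

/-- The unit `ε` as a real number. -/
def ee (D : ℕ) (ε : (OK D)ˣ) : ℝ := (embO D (ε : OK D)).2

/-- The conjugate of the unit `ε`. -/
def el (D : ℕ) (ε : (OK D)ˣ) : ℝ := (embO D (ε : OK D)).1

section Lattice

variable {D : ℕ} (hD : 1 < D) (hsq : Squarefree D)
include hD hsq

lemma emb_sqrtD : emb D (sqrtD D) = (-√(D : ℝ), √(D : ℝ)) := by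
  refine Prod.ext ?_ rfl
  change algebraMap (K D) ℝ (conj D (sqrtD D)) = _
  rw [conj_sqrtD D hD hsq, map_neg]
  rfl

lemma emb_alpha : emb D (alpha D) =
    if D % 4 = 1 then ((1 - √(D : ℝ)) / 2, (1 + √(D : ℝ)) / 2) else (-√(D : ℝ), √(D : ℝ)) := by
  have h := emb_sqrtD hD hsq
  unfold alpha
  split_ifs with h4
  · have h2 : emb D ((1 + sqrtD D) / 2) * 2 = 1 + emb D (sqrtD D) := by
      rw [← map_ofNat (emb D) 2, ← map_mul, div_mul_cancel₀ _ two_ne_zero, map_add, map_one]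
    rw [h] at h2
    have e1 := congrArg Prod.fst h2
    have e2 := congrArg Prod.snd h2
    simp only [Prod.fst_mul, Prod.snd_mul, Prod.fst_add, Prod.snd_add, Prod.fst_one, Prod.snd_one,
      Prod.fst_ofNat, Prod.snd_ofNat] at e1 e2
    exact Prod.ext (by simp only; linarith) (by simp only; linarith)
  · exact h

omit hD hsq in
lemma sqrt_sq_natCast : √(D : ℝ) * √(D : ℝ) = D := Real.mul_self_sqrt (by positivity)

omit hsq in
lemma one_lt_sqrt : 1 < √(D : ℝ) := by
  rw [Real.lt_sqrt (by norm_num)]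
  exact_mod_cast (by simpa using hD)

lemma ra_rb_cases : (D % 4 = 1 ∧ ra D = (1 + √(D : ℝ)) / 2 ∧ rb D = (√(D : ℝ) - 1) / 2) ∨
    (D % 4 ≠ 1 ∧ ra D = √(D : ℝ) ∧ rb D = √(D : ℝ)) := by
  unfold ra rb
  rw [emb_alpha hD hsq]
  split_ifs with h4
  · left
    refine ⟨h4, rfl, ?_⟩
    simp only
    ring
  · right
    exact ⟨h4, rfl, by simp⟩

lemma one_lt_ra : 1 < ra D := by
  have := one_lt_sqrt hD
  rcases ra_rb_cases hD hsq with ⟨-, h, -⟩ | ⟨-, h, -⟩ <;> rw [h] <;> linarith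

lemma rb_pos : 0 < rb D := by
  have := one_lt_sqrt hD
  rcases ra_rb_cases hD hsq with ⟨-, -, h⟩ | ⟨-, -, h⟩ <;> rw [h] <;> linarith

/-- The integers `t` and `-n` are the trace and the norm of α_K. -/
lemma exists_trace_norm : ∃ t n : ℤ, 1 ≤ n ∧ ra D - rb D = t ∧ ra D * rb D = n := by
  have hs := sqrt_sq_natCast (D := D)
  rcases ra_rb_cases hD hsq with ⟨h, h1, h2⟩ | ⟨-, h1, h2⟩
  · refine ⟨1, (D / 4 : ℕ), by omega, by rw [h1, h2]; push_cast; ring, ?_⟩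
    rw [h1, h2]
    have h3 : ((D : ℕ) : ℝ) = ((4 * (D / 4) + 1 : ℕ) : ℝ) := by
      congr 1
      omega
    push_cast at h3
    rw [Int.cast_natCast]
    nlinarith
  · refine ⟨0, D, by omega, by rw [h1, h2]; simp, ?_⟩
    rw [h1, h2, hs]
    simp

omit hD hsq in
lemma isIntegral_alpha : IsIntegral ℤ (alpha D) := by
  have hs : sqrtD D ^ 2 = (D : K D) :=
    Subtype.ext (by simp [sqrtD])
  have hsi : IsIntegral ℤ (sqrtD D) := by
    refine IsIntegral.of_pow two_pos ?_
    rw [hs]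
    have := isIntegral_algebraMap (R := ℤ) (A := K D) (x := (D : ℤ))
    simpa using this
  unfold alpha
  split_ifs with h4
  · refine ⟨Polynomial.X ^ 2 - Polynomial.X - Polynomial.C ((D / 4 : ℕ) : ℤ), ?_, ?_⟩
    · monicity!
    · have h3 : (D : K D) = ((4 * (D / 4) + 1 : ℕ) : K D) := by
        congr 1
        omega
      rw [h3] at hs
      push_cast at hs
      simp only [Polynomial.eval₂_sub, Polynomial.eval₂_pow, Polynomial.eval₂_X, Polynomial.eval₂_C]
      simp only [eq_intCast, Int.cast_natCast]
      linear_combination hs / 4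
  · exact hsi

omit hD hsq in
lemma exists_rat_coords (x : K D) : ∃ r s : ℚ, x = (r : K D) + s * sqrtD D := by
  have hs : sqrtD D ^ 2 = (D : K D) :=
    Subtype.ext (by simp [sqrtD])
  have hint : IsIntegral ℚ √(D : ℝ) := by
    refine ⟨Polynomial.X ^ 2 - Polynomial.C (D : ℚ), Polynomial.monic_X_pow_sub_C _ two_ne_zero, ?_⟩
    simp
  have hx : (x : ℝ) ∈ Algebra.adjoin ℚ {√(D : ℝ)} := by
    rw [← IntermediateField.adjoin_simple_toSubalgebra_of_isAlgebraic hint.isAlgebraic]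
    exact x.2
  have key : ∃ r s : ℚ, (x : ℝ) = r + s * √(D : ℝ) := by
    generalize (x : ℝ) = z at hx
    induction hx using Algebra.adjoin_induction with
    | mem y hy => exact ⟨0, 1, by rw [mem_singleton_iff.1 hy]; simp⟩
    | algebraMap r => exact ⟨r, 0, by simp⟩
    | add y z _ _ hy hz =>
      obtain ⟨r, s, h⟩ := hy
      obtain ⟨r', s', h'⟩ := hz
      exact ⟨r + r', s + s', by rw [h, h']; push_cast; ring⟩
    | mul y z _ _ hy hz =>
      obtain ⟨r, s, h⟩ := hy
      obtain ⟨r', s', h'⟩ := hz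
      refine ⟨r * r' + s * s' * D, r * s' + s * r', ?_⟩
      rw [h, h']
      push_cast
      linear_combination (s * s' : ℝ) * sqrt_sq_natCast (D := D)
  obtain ⟨r, s, h⟩ := key
  exact ⟨r, s, Subtype.ext (by rw [h]; simp [sqrtD])⟩

lemma emb_rat_coords (r s : ℚ) :
    emb D ((r : K D) + s * sqrtD D) = (r - s * √(D : ℝ), r + s * √(D : ℝ)) := by
  refine Prod.ext ?_ ?_
  · change algebraMap (K D) ℝ (conj D _) = _
    rw [map_add, map_mul, conj_sqrtD D hD hsq, map_ratCast, map_ratCast, map_add, map_mul, map_neg,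
      map_ratCast, map_ratCast, mul_neg, ← sub_eq_add_neg]
    rfl
  · change algebraMap (K D) ℝ _ = _
    rw [map_add, map_mul, map_ratCast, map_ratCast]
    rfl

-- The square of the denominator of `t` is prime to the square of the numerator, hence divides `D`,
-- and squarefreeness makes it 1.
omit hD in
lemma isInt_of_mul_sq {t : ℚ} {n : ℤ} (h : D * t ^ 2 = n) : ∃ k : ℤ, t = k := by
  have hden : (t.den : ℤ) ^ 2 ∣ D := by
    have h1 : (D : ℤ) * t.num ^ 2 = n * (t.den : ℤ) ^ 2 := by
      have h2 : (t.den : ℚ) ≠ 0 := by exact_mod_cast t.den_ne_zero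
      have h3 : t * t.den = t.num := Rat.mul_den_eq_num t
      have : (D : ℚ) * (t.num : ℚ) ^ 2 = n * (t.den : ℚ) ^ 2 := by
        rw [← h3, ← h]
        ring
      exact_mod_cast this
    have hcop : IsCoprime ((t.den : ℤ) ^ 2) (t.num ^ 2) := by
      refine IsCoprime.pow ?_
      exact (Int.isCoprime_iff_nat_coprime.2 (by simpa using t.reduced)).symm
    exact hcop.dvd_of_dvd_mul_right ⟨n, by rw [h1]; ring⟩
  have h2 : t.den * t.den ∣ D := by
    rw [← sq]
    exact_mod_cast hden
  have h3 := Nat.isUnit_iff.1 (hsq _ h2)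
  exact ⟨t.num, (Rat.coe_int_num_of_den_eq_one h3).symm⟩

/-- The trace m and the norm n of q = r + s√D are integers, so D(2s)² = m² - 4n is an integer and
therefore k = 2s is one. The congruence m² ≡ Dk² mod 4 then settles the parities: m ≡ k mod 2 if D ≡
1 mod 4, both even otherwise. -/
lemma exists_int_coords (q : OK D) :
    ∃ x y : ℤ, embO D q = ((x : ℝ) - y * rb D, (x : ℝ) + y * ra D) := by
  obtain ⟨r, s, hrs⟩ := exists_rat_coords (q : K D)
  have hemb : embO D q = (r - s * √(D : ℝ), r + s * √(D : ℝ)) := by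
    rw [← emb_rat_coords hD hsq, ← hrs]
    rfl
  have hs : sqrtD D ^ 2 = (D : K D) :=
    Subtype.ext (by simp [sqrtD])
  have hq : IsIntegral ℤ (q : K D) := q.2
  have hq' : IsIntegral ℤ (conj D (q : K D)) := hq.map ((conj D : K D →ₐ[ℚ] K D).restrictScalars ℤ)
  have hc : conj D (q : K D) = (r : K D) - s * sqrtD D := by
    rw [hrs, map_add, map_mul, conj_sqrtD D hD hsq, map_ratCast, map_ratCast]
    ring
  have hrat : ∀ z : ℚ, IsIntegral ℤ (z : K D) → ∃ m : ℤ, z = m := by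
    intro z hz
    have : IsIntegral ℤ z := by
      rw [← isIntegral_algebraMap_iff (B := K D) (algebraMap ℚ (K D)).injective]
      simpa using hz
    obtain ⟨m, hm⟩ := IsIntegrallyClosed.isIntegral_iff.1 this
    exact ⟨m, by simpa using hm.symm⟩
  obtain ⟨m, hm⟩ := hrat (2 * r) (by
    have := hq.add hq'
    rw [hc, hrs] at this
    have e : ((2 * r : ℚ) : K D) = r + s * sqrtD D + (r - s * sqrtD D) := by
      push_cast
      ring
    rw [e]
    exact this)
  obtain ⟨n, hn⟩ := hrat (r ^ 2 - D * s ^ 2) (by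
    have := hq.mul hq'
    rw [hc, hrs] at this
    have e : ((r ^ 2 - D * s ^ 2 : ℚ) : K D) = (r + s * sqrtD D) * (r - s * sqrtD D) := by
      push_cast
      linear_combination ((s : K D) ^ 2) * hs
    rw [e]
    exact this)
  obtain ⟨k, hk⟩ := isInt_of_mul_sq hsq (t := 2 * s) (n := m ^ 2 - 4 * n) (by
    push_cast
    rw [← hm, ← hn]
    ring)
  have hmk : m ^ 2 - D * k ^ 2 = 4 * n := by
    have : (m : ℚ) ^ 2 - D * (k : ℚ) ^ 2 = 4 * n := by
      rw [← hm, ← hn, ← hk]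
      ring
    exact_mod_cast this
  have hrR : (r : ℝ) = m / 2 := by
    have : (2 : ℝ) * r = m := by exact_mod_cast hm
    linarith
  have hsR : (s : ℝ) = k / 2 := by
    have : (2 : ℝ) * s = k := by exact_mod_cast hk
    linarith
  have h4D : ¬ 4 ∣ D := by
    intro h
    have := Nat.isUnit_iff.1 (hsq 2 (by simpa using h))
    omega
  have hD4 : (D : ℤ) = 4 * (D / 4 : ℕ) + (D % 4 : ℕ) := by omega
  have hmod : (m % 4 = 0 ∨ m % 4 = 1 ∨ m % 4 = 2 ∨ m % 4 = 3) := by omega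
  have hmod' : (k % 4 = 0 ∨ k % 4 = 1 ∨ k % 4 = 2 ∨ k % 4 = 3) := by omega
  have hpar : (m ^ 2 - (D % 4 : ℕ) * k ^ 2) % 4 = 0 := by
    have : m ^ 2 - (D % 4 : ℕ) * k ^ 2 = 4 * (n + (D / 4 : ℕ) * k ^ 2) := by
      linear_combination hmk + k ^ 2 * hD4
    omega
  rw [Int.sub_emod, Int.mul_emod, pow_two, pow_two, Int.mul_emod m, Int.mul_emod k] at hpar
  rcases ra_rb_cases hD hsq with ⟨h4, h1, h2⟩ | ⟨h4, h1, h2⟩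
  · rw [h4] at hpar
    have h5 : ∃ x, m - k = 2 * x := by
      refine ⟨(m - k) / 2, ?_⟩
      rcases hmod with h | h | h | h <;> rcases hmod' with h' | h' | h' | h' <;>
        rw [h, h'] at hpar <;> omega
    obtain ⟨x, hx⟩ := h5
    have hxR : (m : ℝ) - k = 2 * x := by exact_mod_cast hx
    refine ⟨x, k, ?_⟩
    rw [hemb, h1, h2, hrR, hsR]
    refine Prod.ext ?_ ?_ <;> simp only <;> linear_combination hxR / 2
  · have h23 : D % 4 = 2 ∨ D % 4 = 3 := by omega
    have h5 : (∃ x, m = 2 * x) ∧ ∃ y, k = 2 * y := by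
      have : m % 2 = 0 ∧ k % 2 = 0 := by
        rcases h23 with h6 | h6 <;> rw [h6] at hpar <;>
        rcases hmod with h | h | h | h <;> rcases hmod' with h' | h' | h' | h' <;>
        rw [h, h'] at hpar <;> omega
      exact ⟨⟨m / 2, by omega⟩, ⟨k / 2, by omega⟩⟩
    obtain ⟨⟨x, rfl⟩, ⟨y, rfl⟩⟩ := h5
    refine ⟨x, y, ?_⟩
    rw [hemb, h1, h2, hrR, hsR]
    push_cast
    refine Prod.ext ?_ ?_ <;> simp only <;> ring

lemma mem_lattice_iff {v : V} :
    v ∈ lattice D ↔ ∃ x y : ℤ, v = ((x : ℝ) - y * rb D, (x : ℝ) + y * ra D) := by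
  constructor
  · rintro ⟨q, rfl⟩
    exact exists_int_coords hD hsq q
  · rintro ⟨x, y, rfl⟩
    let α : OK D := ⟨alpha D, isIntegral_alpha⟩
    refine ⟨(x : OK D) + (y : OK D) * α, ?_⟩
    change embO D _ = _
    rw [map_add, map_mul, map_intCast, map_intCast]
    have : embO D α = (-rb D, ra D) := by
      rw [rb, neg_neg, ra]
      rfl
    rw [this]
    refine Prod.ext ?_ ?_
    · simp [sub_eq_add_neg]
    · simp

lemma mk_mem_lattice (x y : ℤ) : (((x : ℝ) - y * rb D, (x : ℝ) + y * ra D) : V) ∈ lattice D :=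
  (mem_lattice_iff hD hsq).2 ⟨x, y, rfl⟩

lemma one_mem_lattice : ((1, 1) : V) ∈ lattice D := by
  simpa using mk_mem_lattice hD hsq 1 0

lemma alpha_mem_lattice : ((-rb D, ra D) : V) ∈ lattice D := by
  simpa using mk_mem_lattice hD hsq 0 1

omit hD hsq in
lemma eq_zero_of_mem_lattice {q : V} (hq : q ∈ lattice D) (h : q.1 = 0 ∨ q.2 = 0) : q = 0 := by
  obtain ⟨z, rfl⟩ := hq
  have : z = 0 := by
    rcases h with h | h
    · have h1 : algebraMap (K D) ℝ (conj D (z : K D)) = 0 := h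
      rw [map_eq_zero, map_eq_zero] at h1
      exact_mod_cast h1
    · have h1 : algebraMap (K D) ℝ (z : K D) = 0 := h
      rw [map_eq_zero] at h1
      exact_mod_cast h1
  rw [this, map_zero]

omit hD hsq in
lemma embO_injective : Function.Injective (embO D) := by
  intro x y hxy
  have : embO D (x - y) = 0 := by rw [map_sub, hxy, sub_self]
  have h0 : algebraMap (K D) ℝ ((x - y : OK D) : K D) = 0 := congrArg Prod.snd this
  rw [map_eq_zero] at h0
  exact sub_eq_zero.1 (by exact_mod_cast h0)

lemma exists_int_norm {q : V} (hq : q ∈ lattice D) : ∃ n : ℤ, q.1 * q.2 = n := by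
  obtain ⟨x, y, rfl⟩ := (mem_lattice_iff hD hsq).1 hq
  obtain ⟨t, n, -, ht, hn⟩ := exists_trace_norm hD hsq
  refine ⟨x ^ 2 + t * (x * y) - n * y ^ 2, ?_⟩
  push_cast
  rw [← ht, ← hn]
  ring

lemma one_le_abs_norm {q : V} (hq : q ∈ lattice D) (h0 : q ≠ 0) : 1 ≤ |q.1| * |q.2| := by
  obtain ⟨n, hn⟩ := exists_int_norm hD hsq hq
  have h1 : q.1 ≠ 0 := fun h => h0 (eq_zero_of_mem_lattice hq (Or.inl h))
  have h2 : q.2 ≠ 0 := fun h => h0 (eq_zero_of_mem_lattice hq (Or.inr h))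
  rw [← abs_mul, hn]
  have hn0 : n ≠ 0 := by
    rintro rfl
    simp [h1, h2] at hn
  exact_mod_cast Int.one_le_abs hn0

lemma eq_zero_of_norm_lt_one {q : V} (hq : q ∈ lattice D) (h : |q.1| * |q.2| < 1) : q = 0 := by
  by_contra h0
  exact absurd (one_le_abs_norm hD hsq hq h0) (not_le.2 h)

lemma lattice_bounded_finite (R : ℝ) : {q : V | q ∈ lattice D ∧ ‖q‖ ≤ R}.Finite := by
  have ha := one_lt_ra hD hsq
  have hb := rb_pos hD hsq
  -- The coordinates differ by `y * (ra D + rb D)` with `ra D + rb D > 1`, so |y| ≤ 2R, and then |x|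
  -- ≤ R + 2R · `ra D`.
  obtain ⟨N, hN⟩ := exists_nat_ge (R + 2 * R * ra D + 2 * R)
  refine ((finite_Icc (-(N : ℤ)) N).prod (finite_Icc (-(N : ℤ)) N)).image
    (fun p : ℤ × ℤ => (((p.1 : ℝ) - p.2 * rb D, (p.1 : ℝ) + p.2 * ra D) : V)) |>.subset ?_
  rintro q ⟨hq, hqR⟩
  obtain ⟨x, y, rfl⟩ := (mem_lattice_iff hD hsq).1 hq
  rw [Prod.norm_mk, max_le_iff, Real.norm_eq_abs, Real.norm_eq_abs, abs_le, abs_le] at hqR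
  obtain ⟨⟨h1, h2⟩, h3, h4⟩ := hqR
  have hR : 0 ≤ R := by linarith
  have hy1 : (y : ℝ) ≤ 2 * R := by
    by_contra! hcon
    nlinarith
  have hy2 : -(2 * R) ≤ (y : ℝ) := by
    by_contra! hcon
    nlinarith
  have hRa : 0 ≤ 2 * R * ra D := by positivity
  refine ⟨(x, y), ⟨⟨?_, ?_⟩, ⟨?_, ?_⟩⟩, rfl⟩
  · have : -(N : ℝ) ≤ x := by nlinarith
    exact_mod_cast this
  · have : (x : ℝ) ≤ N := by nlinarith
    exact_mod_cast this
  · have : -(N : ℝ) ≤ y := by linarith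
    exact_mod_cast this
  · have : (y : ℝ) ≤ N := by linarith
    exact_mod_cast this

end Lattice

/-! ### The fundamental unit and the hyperbolic flow it generates. -/

section Unit

/-- The flow `(s, u) ↦ (ε̄ⁱ s, εⁱ u)` on the plane. -/
def flow (D : ℕ) (ε : (OK D)ˣ) (i : ℤ) (v : V) : V := (el D ε ^ i * v.1, ee D ε ^ i * v.2)

variable {D : ℕ} {ε : (OK D)ˣ}

lemma ee_pos (he : 1 < ee D ε) : 0 < ee D ε := zero_lt_one.trans he

lemma el_mul_ee (hD : 1 < D) (hsq : Squarefree D) :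
    el D ε * ee D ε = 1 ∨ el D ε * ee D ε = -1 := by
  obtain ⟨m, hm⟩ := exists_int_norm hD hsq (q := embO D (ε : OK D)) ⟨_, rfl⟩
  obtain ⟨n, hn⟩ := exists_int_norm hD hsq (q := embO D ((ε⁻¹ : (OK D)ˣ) : OK D)) ⟨_, rfl⟩
  have h1 : embO D (ε : OK D) * embO D ((ε⁻¹ : (OK D)ˣ) : OK D) = 1 := by
    rw [← map_mul, Units.mul_inv, map_one]
  have e1 := congrArg Prod.fst h1
  have e2 := congrArg Prod.snd h1
  simp only [Prod.fst_mul, Prod.snd_mul, Prod.fst_one, Prod.snd_one] at e1 e2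
  have hmn : m * n = 1 := by
    have : (m : ℝ) * n = 1 := by
      rw [← hm, ← hn]
      linear_combination (embO D (ε : OK D)).2 * (embO D ((ε⁻¹ : (OK D)ˣ) : OK D)).2 * e1 + e2
    exact_mod_cast this
  unfold el ee
  rw [hm]
  rcases Int.isUnit_iff.1 (IsUnit.of_mul_eq_one _ hmn) with rfl | rfl <;> simp

lemma abs_el (hD : 1 < D) (hsq : Squarefree D) (he : 1 < ee D ε) : |el D ε| = (ee D ε)⁻¹ := by
  have h0 := ee_pos he
  refine eq_inv_of_mul_eq_one_left ?_
  nth_rewrite 1 [← abs_of_pos h0]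
  rw [← abs_mul]
  rcases el_mul_ee hD hsq with h | h <;> rw [h] <;> simp

lemma el_ne_zero (hD : 1 < D) (hsq : Squarefree D) (he : 1 < ee D ε) : el D ε ≠ 0 := by
  rw [← abs_pos, abs_el hD hsq he]
  exact inv_pos.2 (ee_pos he)

lemma abs_el_lt_one (hD : 1 < D) (hsq : Squarefree D) (he : 1 < ee D ε) : |el D ε| < 1 := by
  rw [abs_el hD hsq he]
  exact inv_lt_one_of_one_lt₀ he

lemma ra_mul_rb_ge (hD : 1 < D) (hsq : Squarefree D) : 1 ≤ ra D * rb D := by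
  obtain ⟨t, n, hn1, -, hn⟩ := exists_trace_norm hD hsq
  rw [hn]
  exact_mod_cast hn1

/-- The number ε - ε̄ is an integer multiple of α_K - ᾱ_K, and it is positive. -/
lemma ra_add_rb_le (hD : 1 < D) (hsq : Squarefree D) (he : 1 < ee D ε) :
    ra D + rb D ≤ ee D ε - el D ε := by
  have ha := one_lt_ra hD hsq
  have hb := rb_pos hD hsq
  obtain ⟨x, y, hxy⟩ := exists_int_coords hD hsq (ε : OK D)
  have h1 : ee D ε - el D ε = y * (ra D + rb D) := by
    unfold ee el
    rw [hxy]
    ring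
  have h2 : 0 < ee D ε - el D ε := by
    have := (abs_lt.1 (abs_el_lt_one hD hsq he)).2
    linarith
  have hy : (0 : ℝ) < y := by
    rw [h1] at h2
    exact pos_of_mul_pos_left h2 (by linarith)
  have hy1 : (1 : ℝ) ≤ y := by exact_mod_cast hy
  rw [h1]
  nlinarith

/-- When `ε` has norm `-1`, it dominates both `α_K` and `-ᾱ_K`. -/
lemma le_ee_of_norm_neg (hD : 1 < D) (hsq : Squarefree D) (he : 1 < ee D ε)
    (hneg : el D ε * ee D ε = -1) : ra D ≤ ee D ε ∧ rb D ≤ ee D ε := by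
  have ha := one_lt_ra hD hsq
  have hb := rb_pos hD hsq
  have hab := ra_mul_rb_ge hD hsq
  have h := ra_add_rb_le hD hsq he
  have h1 : (ra D + rb D) * ee D ε ≤ ee D ε ^ 2 + 1 := by nlinarith
  -- Since ε̄ = -1/ε, `h` reads α_K - ᾱ_K ≤ ε + 1/ε. With -α_K ᾱ_K ≥ 1 this puts α_K and -ᾱ_K on the
  -- same side of ε, and they cannot both exceed ε because ε + 1/ε < 2ε.
  have h2 : 0 ≤ (ra D - ee D ε) * (rb D - ee D ε) := by nlinarith
  constructor
  · by_contra! hcon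
    have : ee D ε ≤ rb D := by
      by_contra! h3
      nlinarith
    nlinarith
  · by_contra! hcon
    have : ee D ε ≤ ra D := by
      by_contra! h3
      nlinarith
    nlinarith

/-- Here α_K is itself a unit, with inverse α_K - 1, hence a positive power of ε. As α_K ≤ ε by the
trace bound, the exponent plays no role and ε = α_K. -/
lemma golden_of_eq_five (hsq : Squarefree D) (h5 : D = 5) (hε : IsFundamentalUnit D ε)
    (he : 1 < ee D ε) :
    ee D ε = ra D ∧ ra D * rb D = 1 ∧ ra D - rb D = 1 ∧ el D ε = -rb D := by
  have hD : 1 < D := by omega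
  have ha := one_lt_ra hD hsq
  have hb := rb_pos hD hsq
  have hs : √(D : ℝ) * √(D : ℝ) = 5 := by
    rw [sqrt_sq_natCast, h5]
    norm_num
  have hs1 := one_lt_sqrt hD
  rcases ra_rb_cases hD hsq with ⟨-, h1, h2⟩ | ⟨h, -, -⟩
  swap
  · omega
  have hab : ra D * rb D = 1 := by
    rw [h1, h2]
    linear_combination hs / 4
  have hsub : ra D - rb D = 1 := by
    rw [h1, h2]
    ring
  have hle : ra D ≤ ee D ε := by
    rcases el_mul_ee hD hsq with h | h
    · have h3 := ra_add_rb_le hD hsq he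
      have : 0 < el D ε := by
        by_contra! hcon
        nlinarith
      linarith
    · exact (le_ee_of_norm_neg hD hsq he h).1
  let α : OK D := ⟨alpha D, isIntegral_alpha⟩
  have hemb : embO D α = (-rb D, ra D) := by
    rw [rb, neg_neg, ra]
    rfl
  have hα : α * (α - 1) = 1 := by
    apply embO_injective
    rw [map_mul, map_sub, map_one, hemb]
    refine Prod.ext ?_ ?_
    · simp only [Prod.fst_mul, Prod.fst_sub, Prod.fst_one]
      linear_combination hab - rb D * hsub
    · simp only [Prod.snd_mul, Prod.snd_sub, Prod.snd_one]
      linear_combination hab + ra D * hsub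
  let u : (OK D)ˣ := ⟨α, α - 1, hα, by rw [mul_comm, hα]⟩
  have hpow : ∀ n : ℤ, (embO D ((ε ^ n : (OK D)ˣ) : OK D)).2 = ee D ε ^ n := by
    intro n
    have := map_zpow (Units.map (((RingHom.snd ℝ ℝ).comp (embO D) : OK D →+* ℝ) : OK D →* ℝ)) ε n
    have h3 := congrArg Units.val this
    rw [Units.val_zpow_eq_zpow_val] at h3
    exact h3
  have h0 := ee_pos he
  have hea : ee D ε = ra D := by
    obtain ⟨n, hn⟩ := hε.2 u
    have hu : (embO D (u : OK D)).2 = ra D := by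
      change (embO D α).2 = _
      rw [hemb]
    have hn' : ra D = ee D ε ^ n := by
      rcases hn with hn | hn
      · rw [← hu, hn, hpow]
      · exfalso
        rw [hn, Units.val_neg, map_neg, Prod.snd_neg, hpow] at hu
        have := zpow_pos h0 n
        linarith
    have hn1 : 1 ≤ n := by
      by_contra! hcon
      have : ee D ε ^ n ≤ ee D ε ^ (0 : ℤ) := zpow_le_zpow_right₀ he.le (by omega)
      rw [zpow_zero] at this
      linarith
    have hn2 : ee D ε ^ (1 : ℤ) ≤ ee D ε ^ n := zpow_le_zpow_right₀ he.le hn1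
    rw [zpow_one] at hn2
    linarith
  refine ⟨hea, hab, hsub, ?_⟩
  rcases el_mul_ee hD hsq with h | h
  · exfalso
    have h3 := ra_add_rb_le hD hsq he
    rw [hea] at h h3
    have : 0 < el D ε := by
      by_contra! hcon
      nlinarith
    linarith
  · rw [hea] at h
    have : (el D ε + rb D) * ra D = 0 := by linear_combination h + hab
    rcases mul_eq_zero.1 this with h3 | h3 <;> linarith

lemma flow_zero (v : V) : flow D ε 0 v = v := by simp [flow]

lemma flow_sub (i : ℤ) (v w : V) : flow D ε i (v - w) = flow D ε i v - flow D ε i w := by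
  simp [flow, mul_sub]

lemma flow_add (i : ℤ) (v w : V) : flow D ε i (v + w) = flow D ε i v + flow D ε i w := by
  simp [flow, mul_add]

lemma flow_flow (hD : 1 < D) (hsq : Squarefree D) (he : 1 < ee D ε) (i j : ℤ) (v : V) :
    flow D ε i (flow D ε j v) = flow D ε (i + j) v := by
  simp only [flow]
  rw [zpow_add₀ (el_ne_zero hD hsq he), zpow_add₀ (ee_pos he).ne', mul_assoc, mul_assoc]

lemma proj_eq_iff {v w : V} : proj D v = proj D w ↔ v - w ∈ lattice D := by
  change (v : V ⧸ lattice D) = (w : V ⧸ lattice D) ↔ _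
  rw [QuotientAddGroup.eq, ← (lattice D).neg_mem_iff]
  have : -(-v + w) = v - w := by abel
  rw [this]

lemma phi_proj (v : V) : phi D ε (proj D v) = proj D (flow D ε 1 v) := by
  change proj D (phiV D ε v) = _
  congr 1
  rw [flow, zpow_one, zpow_one]
  rfl

lemma phi_zpow_proj (hD : 1 < D) (hsq : Squarefree D) (he : 1 < ee D ε) (i : ℤ) (v : V) :
    (phi D ε ^ i) (proj D v) = proj D (flow D ε i v) := by
  induction i with
  | zero => simp [flow_zero]
  | succ n ih =>
    rw [add_comm, zpow_add, Equiv.Perm.mul_apply, ih, zpow_one, phi_proj, flow_flow hD hsq he]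
  | pred n ih =>
    rw [sub_eq_add_neg, add_comm, zpow_add, Equiv.Perm.mul_apply, ih, zpow_neg_one,
      Equiv.Perm.inv_eq_iff_eq, phi_proj, flow_flow hD hsq he, add_neg_cancel_left]

lemma flow_mem_lattice (hD : 1 < D) (hsq : Squarefree D) (he : 1 < ee D ε) (i : ℤ) {q : V}
    (hq : q ∈ lattice D) : flow D ε i q ∈ lattice D := by
  have h0 : ∀ w : V, proj D w = proj D 0 ↔ w ∈ lattice D := fun w => by
    rw [proj_eq_iff, sub_zero]
  rw [← h0, ← phi_zpow_proj hD hsq he, (h0 q).2 hq, phi_zpow_proj hD hsq he]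
  simp only [flow, Prod.fst_zero, Prod.snd_zero, mul_zero]
  rfl

lemma absNorm_flow (hD : 1 < D) (hsq : Squarefree D) (i : ℤ) (v : V) :
    absNorm (flow D ε i v) = absNorm v := by
  simp only [absNorm, flow]
  rw [mul_mul_mul_comm, ← mul_zpow, abs_mul, abs_zpow]
  have : |el D ε * ee D ε| = 1 := by
    rcases el_mul_ee hD hsq with h | h <;> rw [h] <;> simp
  rw [this, one_zpow, one_mul]

/-- Periodic points of `φ` come from elements of `K`. -/
lemma mem_range_emb_of_periodic (he : 1 < ee D ε) {n : ℕ} (hn : n ≠ 0) {v : V}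
    (h : flow D ε n v - v ∈ lattice D) : ∃ x : K D, emb D x = v := by
  obtain ⟨q, hq⟩ := h
  have hq : embO D q = flow D ε n v - v := hq
  -- Periodicity says that (εⁿ - 1)v is a lattice point, and dividing by `z` stays inside K.
  let z : K D := ((ε : OK D) : K D) ^ n - 1
  have hz : emb D z * v = flow D ε n v - v := by
    have : emb D z = (el D ε ^ n - 1, ee D ε ^ n - 1) := by
      rw [map_sub, map_pow, map_one]
      rfl
    rw [this]
    refine Prod.ext ?_ ?_ <;> simp [flow, sub_mul]
  have hz0 : z ≠ 0 := by
    intro h0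
    have h1 : (emb D z).2 = 0 := by rw [h0, map_zero]; rfl
    have h2 : (emb D z).2 = ee D ε ^ n - 1 := by
      rw [map_sub, map_pow, map_one]
      rfl
    have := one_lt_pow₀ he hn
    linarith
  refine ⟨z⁻¹ * (q : K D), ?_⟩
  rw [map_mul]
  have : emb D (q : K D) = emb D z * v := by rw [hz, ← hq]; rfl
  rw [this, ← mul_assoc, ← map_mul, inv_mul_cancel₀ hz0, map_one, one_mul]

end Unit

/-! ### Tiling of the plane by the footprint -/

lemma int_trichotomy (x : ℤ) : (x : ℝ) ≤ -1 ∨ x = 0 ∨ (1 : ℝ) ≤ x := by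
  rcases lt_trichotomy x 0 with h | h | h
  · left
    exact_mod_cast (by omega : x ≤ -1)
  · exact Or.inr (Or.inl h)
  · right
    right
    exact_mod_cast (by omega : 1 ≤ x)

/-- Products rather than signs are recorded so that the case analyses of the tiling become linear
arithmetic. -/
lemma int_trichotomy_mul (y : ℤ) {a b : ℝ} (ha : 0 < a) (hb : 0 < b) :
    ((y : ℝ) * a ≤ -a ∧ (y : ℝ) * b ≤ -b) ∨ y = 0 ∨ (a ≤ y * a ∧ b ≤ y * b) := by
  rcases int_trichotomy y with h | h | h
  · exact Or.inl ⟨by nlinarith, by nlinarith⟩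
  · exact Or.inr (Or.inl h)
  · exact Or.inr (Or.inr ⟨by nlinarith, by nlinarith⟩)

lemma mem_planeR_zero {D : ℕ} {v : V} :
    v ∈ planeR D 0 ↔ (0 < v.1 ∧ v.1 < rb D) ∧ 0 < v.2 ∧ v.2 < 1 := Iff.rfl

lemma mem_planeR_one {D : ℕ} {v : V} :
    v ∈ planeR D 1 ↔ (-1 < v.1 ∧ v.1 < 0) ∧ 0 < v.2 ∧ v.2 < ra D := Iff.rfl

lemma planeR_subset_footprint (D : ℕ) (i : Fin 2) : planeR D i ⊆ footprint D := by
  fin_cases i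
  · exact subset_union_left
  · exact subset_union_right

lemma mem_footprint_iff {D : ℕ} {v : V} : v ∈ footprint D ↔ ∃ i, v ∈ planeR D i := by
  simp [footprint, Fin.exists_fin_two]

/-- The left ends of the rectangles `planeR D i`. -/
def sLo : Fin 2 → ℝ := ![0, -1]

/-- The right ends of the rectangles `planeR D i`. -/
def sHi (D : ℕ) : Fin 2 → ℝ := ![rb D, 0]

/-- The upper ends of the rectangles `planeR D i`. -/
def uHi (D : ℕ) : Fin 2 → ℝ := ![1, ra D]

lemma planeR_eq (D : ℕ) (i : Fin 2) :
    planeR D i = Ioo (sLo i) (sHi D i) ×ˢ Ioo 0 (uHi D i) := by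
  fin_cases i <;> rfl

section Tiling

variable {D : ℕ} (hD : 1 < D) (hsq : Squarefree D)
include hD hsq

/-- Injectivity of the footprint on the torus. For the lattice vector x + yα_K, each of the nine
sign patterns of (x, y) other than (0, 0) moves some coordinate too far or in the wrong direction;
for (0, 0) the sign of s separates R₀ from R₁. -/
lemma eq_zero_of_planeR_sub {i j : Fin 2} {v w : V} (hv : v ∈ planeR D i) (hw : w ∈ planeR D j)
    (h : v - w ∈ lattice D) : v = w ∧ i = j := by
  have ha := one_lt_ra hD hsq
  have hb := rb_pos hD hsq
  obtain ⟨x, y, hxy⟩ := (mem_lattice_iff hD hsq).1 h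
  have e1 : v.1 - w.1 = x - y * rb D := congrArg Prod.fst hxy
  have e2 : v.2 - w.2 = x + y * ra D := congrArg Prod.snd hxy
  have hxy0 : (x = 0 ∧ y = 0) → v = w := by
    rintro ⟨rfl, rfl⟩
    simp only [Int.cast_zero, zero_mul, sub_zero, add_zero] at e1 e2
    exact Prod.ext (sub_eq_zero.1 e1) (sub_eq_zero.1 e2)
  have hy := int_trichotomy_mul y (zero_lt_one.trans ha) hb
  have hx := int_trichotomy x
  fin_cases i <;> fin_cases j <;> simp only [Fin.zero_eta, Fin.mk_one] at hv hw <;>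
    simp only [mem_planeR_zero, mem_planeR_one] at hv hw <;>
    obtain ⟨⟨h1, h2⟩, h3, h4⟩ := hv <;> obtain ⟨⟨h5, h6⟩, h7, h8⟩ := hw <;>
    rcases hx with hx | rfl | hx <;> rcases hy with ⟨hy1, hy2⟩ | rfl | ⟨hy1, hy2⟩ <;>
    first
    | exact ⟨hxy0 ⟨rfl, rfl⟩, rfl⟩
    | (exfalso; push_cast at e1 e2; linarith)

/-- The unstable segment of length 1 + α_K going up from a lattice point belongs to the boundary of
the tiling. The segments from 0, -1 and -α_K contain the vertical edges of R₀ and R₁, which fixes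
the length. -/
lemma not_mem_planeR_of_vertical {i : Fin 2} {v r : V} (hv : v ∈ planeR D i) (hr : r ∈ lattice D)
    (h1 : v.1 = r.1) (h2 : 0 ≤ v.2 - r.2) (h3 : v.2 - r.2 ≤ 1 + ra D) : False := by
  have ha := one_lt_ra hD hsq
  have hb := rb_pos hD hsq
  obtain ⟨x, y, rfl⟩ := (mem_lattice_iff hD hsq).1 hr
  simp only at h1 h2 h3
  have hy := int_trichotomy_mul y (zero_lt_one.trans ha) hb
  have hx := int_trichotomy x
  fin_cases i <;> simp only [Fin.zero_eta, Fin.mk_one] at hv <;>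
    simp only [mem_planeR_zero, mem_planeR_one] at hv <;>
    obtain ⟨⟨h5, h6⟩, h7, h8⟩ := hv <;>
    rcases hx with hx | rfl | hx <;> rcases hy with ⟨hy1, hy2⟩ | rfl | ⟨hy1, hy2⟩ <;>
    push_cast at h1 h2 h3 <;> linarith

/-- The stable counterpart: through 0, 1 and α_K, the segments with offsets from -1 to -ᾱ_K contain
all horizontal edges of R₀ and R₁. -/
lemma not_mem_planeR_of_horizontal {i : Fin 2} {v r : V} (hv : v ∈ planeR D i)
    (hr : r ∈ lattice D) (h1 : v.2 = r.2) (h2 : -1 ≤ v.1 - r.1) (h3 : v.1 - r.1 ≤ rb D) :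
    False := by
  have ha := one_lt_ra hD hsq
  have hb := rb_pos hD hsq
  obtain ⟨x, y, rfl⟩ := (mem_lattice_iff hD hsq).1 hr
  simp only at h1 h2 h3
  have hy := int_trichotomy_mul y (zero_lt_one.trans ha) hb
  have hx := int_trichotomy x
  fin_cases i <;> simp only [Fin.zero_eta, Fin.mk_one] at hv <;>
    simp only [mem_planeR_zero, mem_planeR_one] at hv <;>
    obtain ⟨⟨h5, h6⟩, h7, h8⟩ := hv <;>
    rcases hx with hx | rfl | hx <;> rcases hy with ⟨hy1, hy2⟩ | rfl | ⟨hy1, hy2⟩ <;>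
    push_cast at h1 h2 h3 <;> linarith

/-- The closed footprint, as an explicit union of closed rectangles. -/
def closedFootprint (D : ℕ) : Set V :=
  Icc 0 (rb D) ×ˢ Icc 0 1 ∪ Icc (-1) 0 ×ˢ Icc 0 (ra D)

/-- An integer translation brings s into [-1, 0). Inside the strip -1 ≤ s ≤ -ᾱ_K one can then always
lower u, subtracting α_K if s ≤ 0 and 1 if s ≥ 0, or raise it by the inverse moves, without leaving
the strip. Each move changes u by at least 1, so the induction on a bound for |u| ends in the
footprint. -/
lemma exists_sub_mem_closedFootprint (v : V) : ∃ q ∈ lattice D, v - q ∈ closedFootprint D := by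
  have ha := one_lt_ra hD hsq
  have hb := rb_pos hD hsq
  have h1 := one_mem_lattice hD hsq
  have hα := alpha_mem_lattice hD hsq
  have shift_by : ∀ (v r : V), r ∈ lattice D → (∃ q ∈ lattice D, v - r - q ∈ closedFootprint D) →
      ∃ q ∈ lattice D, v - q ∈ closedFootprint D := by
    rintro v r hr ⟨q, hq, h⟩
    exact ⟨r + q, (lattice D).add_mem hr hq, by rwa [← sub_sub]⟩
  have base : ∀ v : V, v ∈ closedFootprint D → ∃ q ∈ lattice D, v - q ∈ closedFootprint D :=
    fun v hv => ⟨0, (lattice D).zero_mem, by rwa [sub_zero]⟩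
  have up : ∀ n : ℕ, ∀ v : V, -1 ≤ v.1 → v.1 ≤ rb D → 0 ≤ v.2 → v.2 ≤ n →
      ∃ q ∈ lattice D, v - q ∈ closedFootprint D := by
    intro n
    induction n with
    | zero =>
      intro v hv1 hv2 hv3 hv4
      push_cast at hv4
      apply base
      rcases le_total v.1 0 with h | h
      · exact Or.inr ⟨⟨hv1, h⟩, hv3, by linarith⟩
      · exact Or.inl ⟨⟨h, hv2⟩, hv3, by linarith⟩
    | succ n ih =>
      intro v hv1 hv2 hv3 hv4
      push_cast at hv4
      rcases le_total v.1 0 with h | h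
      · rcases le_total v.2 (ra D) with h' | h'
        · exact base v (Or.inr ⟨⟨hv1, h⟩, hv3, h'⟩)
        · refine shift_by v _ hα (ih _ ?_ ?_ ?_ ?_) <;> simp only [Prod.fst_sub, Prod.snd_sub] <;>
            linarith
      · rcases le_total v.2 1 with h' | h'
        · exact base v (Or.inl ⟨⟨h, hv2⟩, hv3, h'⟩)
        · refine shift_by v _ h1 (ih _ ?_ ?_ ?_ ?_) <;> simp only [Prod.fst_sub, Prod.snd_sub] <;>
            linarith
  have down : ∀ n : ℕ, ∀ v : V, -1 ≤ v.1 → v.1 ≤ rb D → v.2 ≤ 0 → -(n : ℝ) ≤ v.2 →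
      ∃ q ∈ lattice D, v - q ∈ closedFootprint D := by
    intro n
    induction n with
    | zero =>
      intro v hv1 hv2 hv3 hv4
      push_cast at hv4
      exact up 0 v hv1 hv2 (by linarith) (by simpa using hv3)
    | succ n ih =>
      intro v hv1 hv2 hv3 hv4
      push_cast at hv4
      rcases le_total v.1 (rb D - 1) with h | h
      · rcases le_total (v.2 + 1) 0 with h' | h'
        · refine shift_by v _ ((lattice D).neg_mem h1) (ih _ ?_ ?_ ?_ ?_) <;>
            simp only [Prod.fst_sub, Prod.snd_sub, Prod.fst_neg, Prod.snd_neg] <;> linarith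
        · refine shift_by v _ ((lattice D).neg_mem h1) (up 1 _ ?_ ?_ ?_ ?_) <;>
            simp only [Prod.fst_sub, Prod.snd_sub, Prod.fst_neg, Prod.snd_neg, Nat.cast_one] <;>
            linarith
      · obtain ⟨N, hN⟩ := exists_nat_ge (ra D)
        rcases le_total (v.2 + ra D) 0 with h' | h'
        · refine shift_by v _ ((lattice D).neg_mem hα) (ih _ ?_ ?_ ?_ ?_) <;>
            simp only [Prod.fst_sub, Prod.snd_sub, Prod.fst_neg, Prod.snd_neg] <;> linarith
        · refine shift_by v _ ((lattice D).neg_mem hα) (up N _ ?_ ?_ ?_ ?_) <;>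
            simp only [Prod.fst_sub, Prod.snd_sub, Prod.fst_neg, Prod.snd_neg] <;>
            linarith
  have hfl := mk_mem_lattice hD hsq (⌊v.1⌋ + 1) 0
  have hf1 := Int.floor_le v.1
  have hf2 := Int.lt_floor_add_one v.1
  refine shift_by v _ hfl ?_
  obtain ⟨N, hN⟩ := exists_nat_ge |v.2 - (⌊v.1⌋ + 1)|
  obtain ⟨hN1, hN2⟩ := abs_le.1 hN
  rcases le_total 0 (v.2 - (⌊v.1⌋ + 1)) with h | h
  · refine up N _ ?_ ?_ ?_ ?_ <;> simp only [Prod.fst_sub, Prod.snd_sub] <;> push_cast <;> linarith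
  · refine down N _ ?_ ?_ ?_ ?_ <;> simp only [Prod.fst_sub, Prod.snd_sub] <;> push_cast <;>
      linarith

lemma closedFootprint_bounded {v : V} (hv : v ∈ closedFootprint D) : ‖v‖ ≤ 1 + ra D + rb D := by
  have ha := one_lt_ra hD hsq
  have hb := rb_pos hD hsq
  rw [Prod.norm_def, max_le_iff, Real.norm_eq_abs, Real.norm_eq_abs, abs_le, abs_le]
  rcases hv with ⟨⟨h1, h2⟩, h3, h4⟩ | ⟨⟨h1, h2⟩, h3, h4⟩ <;>
    refine ⟨⟨?_, ?_⟩, ?_, ?_⟩ <;> linarith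

omit hD hsq in
lemma footprint_subset_closedFootprint : footprint D ⊆ closedFootprint D := by
  refine union_subset_union ?_ ?_ <;>
    exact prod_mono Ioo_subset_Icc_self Ioo_subset_Icc_self

omit hD hsq in
lemma isCompact_closedFootprint : IsCompact (closedFootprint D) :=
  (isCompact_Icc.prod isCompact_Icc).union (isCompact_Icc.prod isCompact_Icc)

lemma closedFootprint_subset_closure : closedFootprint D ⊆ closure (footprint D) := by
  have ha := one_lt_ra hD hsq
  have hb := rb_pos hD hsq
  rw [footprint, closure_union]
  refine union_subset_union ?_ ?_
  · change _ ⊆ closure (Ioo 0 (rb D) ×ˢ Ioo 0 1)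
    rw [closure_prod_eq, closure_Ioo hb.ne, closure_Ioo zero_ne_one]
  · change _ ⊆ closure (Ioo (-1) 0 ×ˢ Ioo 0 (ra D))
    rw [closure_prod_eq, closure_Ioo (by norm_num), closure_Ioo (by linarith)]

/-- Points with no coordinate in common with a lattice point. -/
def Generic (D : ℕ) (v : V) : Prop := ∀ r ∈ lattice D, v.1 ≠ r.1 ∧ v.2 ≠ r.2

/-- On an edge of the closed footprint translated by `q`, some coordinate agrees with that of q, q ±
1 or q ± α_K. -/
lemma Generic.exists_sub_mem {v : V} (hv : Generic D v) :
    ∃ q ∈ lattice D, v - q ∈ footprint D := by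
  obtain ⟨q, hq, h⟩ := exists_sub_mem_closedFootprint hD hsq v
  have h1 := one_mem_lattice hD hsq
  have hα := alpha_mem_lattice hD hsq
  have n0 := hv q hq
  have n1 := hv _ ((lattice D).add_mem hq h1)
  have n2 := hv _ ((lattice D).sub_mem hq h1)
  have n3 := hv _ ((lattice D).add_mem hq hα)
  have n4 := hv _ ((lattice D).sub_mem hq hα)
  simp only [Prod.fst_add, Prod.snd_add, Prod.fst_sub, Prod.snd_sub, ne_eq] at n0 n1 n2 n3 n4
  refine ⟨q, hq, ?_⟩
  rcases h with ⟨⟨h1, h2⟩, h3, h4⟩ | ⟨⟨h1, h2⟩, h3, h4⟩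
  · refine Or.inl ⟨⟨lt_of_le_of_ne h1 ?_, lt_of_le_of_ne h2 ?_⟩, lt_of_le_of_ne h3 ?_,
      lt_of_le_of_ne h4 ?_⟩ <;> simp only [Prod.fst_sub, Prod.snd_sub]
    · exact fun h => n0.1 (by linarith)
    · intro h
      change _ = rb D at h
      exact n4.1 (by linarith)
    · exact fun h => n0.2 (by linarith)
    · exact fun h => n1.2 (by linarith)
  · refine Or.inr ⟨⟨lt_of_le_of_ne h1 ?_, lt_of_le_of_ne h2 ?_⟩, lt_of_le_of_ne h3 ?_,
      lt_of_le_of_ne h4 ?_⟩ <;> simp only [Prod.fst_sub, Prod.snd_sub]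
    · exact fun h => n2.1 (by linarith)
    · exact fun h => n0.1 (by linarith)
    · exact fun h => n0.2 (by linarith)
    · intro h
      change _ = ra D at h
      exact n3.2 (by linarith)

omit hD hsq in
lemma Generic.sub {v q : V} (hv : Generic D v) (hq : q ∈ lattice D) : Generic D (v - q) := by
  intro r hr
  have := hv _ ((lattice D).add_mem hr hq)
  simp only [Prod.fst_sub, Prod.snd_sub, Prod.fst_add, Prod.snd_add] at this ⊢
  exact ⟨fun h => this.1 (by linarith), fun h => this.2 (by linarith)⟩

lemma Generic.flow {ε : (OK D)ˣ} (he : 1 < ee D ε) {v : V} (hv : Generic D v) (i : ℤ) :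
    Generic D (flow D ε i v) := by
  intro r hr
  have h := hv _ (flow_mem_lattice hD hsq he (-i) hr)
  have h1 : r = RealQuad.flow D ε i (RealQuad.flow D ε (-i) r) := by
    rw [flow_flow hD hsq he, add_neg_cancel, flow_zero]
  rw [h1]
  constructor
  · intro h2
    exact h.1 (mul_left_cancel₀ (zpow_ne_zero i (el_ne_zero hD hsq he)) h2)
  · intro h2
    exact h.2 (mul_left_cancel₀ (zpow_ne_zero i (ee_pos he).ne') h2)

lemma dense_generic : Dense {v : V | Generic D v} := by
  have hc : (lattice D : Set V).Countable := by
    have : (lattice D : Set V) = ⋃ n : ℕ, {q : V | q ∈ lattice D ∧ ‖q‖ ≤ n} := by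
      ext q
      simp only [SetLike.mem_coe, mem_iUnion, mem_ofPred_eq, exists_and_left]
      exact ⟨fun h => ⟨h, exists_nat_ge _⟩, fun h => h.1⟩
    rw [this]
    exact countable_iUnion fun n => (lattice_bounded_finite hD hsq n).countable
  have h := ((hc.image Prod.fst).dense_compl ℝ).prod ((hc.image Prod.snd).dense_compl ℝ)
  refine h.mono ?_
  rintro v ⟨h1, h2⟩ r hr
  exact ⟨fun h => h1 ⟨r, hr, h.symm⟩, fun h => h2 ⟨r, hr, h.symm⟩⟩

end Tiling

/-! ### The Markov property -/

lemma exists_eq_endpoint {f : ℝ → ℝ} (hf : Continuous f) {c d p r x y : ℝ} (hx : x ∈ Ioo c d)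
    (hy : y ∈ Ioo c d) (hfx : f x ∈ Ioo p r) (hfy : f y ∉ Ioo p r) :
    ∃ z ∈ Ioo c d, f z = p ∨ f z = r := by
  have hsub : uIcc x y ⊆ Ioo c d := ordConnected_Ioo.uIcc_subset hx hy
  have hiv := intermediate_value_uIcc (a := x) (b := y) hf.continuousOn
  rcases le_or_gt (f y) p with h | h
  · obtain ⟨z, hz, hzp⟩ := hiv (mem_uIcc.2 (Or.inr ⟨h, hfx.1.le⟩))
    exact ⟨z, hsub hz, Or.inl hzp⟩
  · have h' : r ≤ f y := by
      by_contra! hcon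
      exact hfy ⟨h, hcon⟩
    obtain ⟨z, hz, hzp⟩ := hiv (mem_uIcc.2 (Or.inl ⟨hfx.2.le, h'⟩))
    exact ⟨z, hsub hz, Or.inr hzp⟩

section Markov

variable {D : ℕ} {ε : (OK D)ˣ} (hD : 1 < D) (hsq : Squarefree D) (he : 1 < ee D ε)
include hD hsq

lemma sLo_lt_sHi (i : Fin 2) : sLo i < sHi D i := by
  have hb := rb_pos hD hsq
  fin_cases i
  · exact hb
  · exact neg_one_lt_zero

lemma uHi_pos (i : Fin 2) : 0 < uHi D i := by
  have ha := one_lt_ra hD hsq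
  fin_cases i
  · exact one_pos
  · exact zero_lt_one.trans ha

lemma exists_lattice_vertical_edge (i : Fin 2) {v : V} (hv1 : v.1 = sLo i ∨ v.1 = sHi D i)
    (hv2 : v.2 ∈ Ioo 0 (uHi D i)) :
    ∃ q ∈ lattice D, v.1 = q.1 ∧ 0 ≤ v.2 - q.2 ∧ v.2 - q.2 ≤ 1 + ra D := by
  have ha := one_lt_ra hD hsq
  have h1 := (lattice D).neg_mem (one_mem_lattice hD hsq)
  have hα := (lattice D).neg_mem (alpha_mem_lattice hD hsq)
  have h0 := (lattice D).zero_mem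
  obtain ⟨h2, h3⟩ := hv2
  fin_cases i
  · change v.1 = 0 ∨ v.1 = rb D at hv1
    change v.2 < 1 at h3
    rcases hv1 with h | h
    · exact ⟨_, h0, by simpa using h, by simpa using h2.le, by simp only [Prod.snd_zero]; linarith⟩
    · refine ⟨_, hα, ?_, ?_, ?_⟩ <;> simp only [Prod.fst_neg, Prod.snd_neg] <;> linarith
  · change v.1 = -1 ∨ v.1 = 0 at hv1
    change v.2 < ra D at h3
    rcases hv1 with h | h
    · refine ⟨_, h1, ?_, ?_, ?_⟩ <;> simp only [Prod.fst_neg, Prod.snd_neg] <;> linarith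
    · exact ⟨_, h0, by simpa using h, by simpa using h2.le, by simp only [Prod.snd_zero]; linarith⟩

lemma exists_lattice_horizontal_edge (i : Fin 2) {v : V} (hv1 : v.1 ∈ Ioo (sLo i) (sHi D i))
    (hv2 : v.2 = 0 ∨ v.2 = uHi D i) :
    ∃ q ∈ lattice D, v.2 = q.2 ∧ -1 ≤ v.1 - q.1 ∧ v.1 - q.1 ≤ rb D := by
  have hb := rb_pos hD hsq
  have h1 := one_mem_lattice hD hsq
  have hα := alpha_mem_lattice hD hsq
  have h0 := (lattice D).zero_mem
  obtain ⟨h2, h3⟩ := hv1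
  fin_cases i
  · change 0 < v.1 at h2
    change v.1 < rb D at h3
    change v.2 = 0 ∨ v.2 = 1 at hv2
    rcases hv2 with h | h
    · refine ⟨_, h0, by simpa using h, ?_, ?_⟩ <;> simp only [Prod.fst_zero] <;> linarith
    · exact ⟨_, h1, h, by simp only; linarith, by simp only; linarith⟩
  · change -1 < v.1 at h2
    change v.1 < 0 at h3
    change v.2 = 0 ∨ v.2 = ra D at hv2
    rcases hv2 with h | h
    · refine ⟨_, h0, by simpa using h, ?_, ?_⟩ <;> simp only [Prod.fst_zero] <;> linarith
    · exact ⟨_, hα, h, by simp only; linarith, by simp only; linarith⟩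

include he

/-- This is why φ maps horizontal edges into the boundary. If ε has norm 1, multiplication by ε̄
contracts an interval around 0. If the norm is -1 the interval is also reversed, and the bounds -ᾱ_K
≤ ε and 1/ε ≤ 1/α_K ≤ -ᾱ_K are needed. -/
lemma el_mul_mem {s : ℝ} (h1 : -1 ≤ s) (h2 : s ≤ rb D) :
    -1 ≤ el D ε * s ∧ el D ε * s ≤ rb D := by
  have hb := rb_pos hD hsq
  have h0 := ee_pos he
  rcases el_mul_ee hD hsq (ε := ε) with h | h
  · have h3 : 0 < el D ε := pos_of_mul_pos_left (h ▸ one_pos) h0.le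
    have h4 : el D ε < 1 := (abs_lt.1 (abs_el_lt_one hD hsq he)).2
    constructor <;> nlinarith
  · obtain ⟨hea, heb⟩ := le_ee_of_norm_neg hD hsq he h
    have hab := ra_mul_rb_ge hD hsq
    have h3 : el D ε < 0 := by
      by_contra! hcon
      nlinarith
    have h4 : -1 ≤ el D ε * rb D := by nlinarith
    have h5 : -el D ε ≤ rb D := by
      have : 1 ≤ rb D * ee D ε := by nlinarith
      have h6 : 0 ≤ (rb D + el D ε) * ee D ε := by nlinarith
      have := nonneg_of_mul_nonneg_left h6 h0
      linarith
    constructor <;> nlinarith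

/-- The Markov property of the two rectangles: wherever `φ(R_i)` meets a translate of `R_j`, it
crosses that translate completely. -/
lemma planeR_markov {i j : Fin 2} {q v v' w : V} (hq : q ∈ lattice D) (hv : v ∈ planeR D i)
    (hvq : flow D ε 1 v - q ∈ planeR D j) (hv' : v' ∈ planeR D i) (hw : w ∈ planeR D j) :
    (v'.1, (w.2 + q.2) / ee D ε) ∈ planeR D i ∧ (el D ε * v'.1 - q.1, w.2) ∈ planeR D j := by
  have h0 := ee_pos he
  have ha := one_lt_ra hD hsq
  rw [planeR_eq] at hv hvq hv' hw
  simp only [flow, zpow_one] at hvq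
  constructor
  · rw [planeR_eq]
    refine ⟨hv'.1, ?_⟩
    -- If the crossing failed, a point of R_j at the stable coordinate of the image of `v` would be
    -- the translated image of a point on a horizontal edge of R_i. Such images lie in the boundary,
    -- which misses the open rectangle R_j.
    by_contra hcon
    have hx : (flow D ε 1 v - q).2 ∈ Ioo 0 (uHi D j) := by
      simpa [flow] using hvq.2
    have hfx : ((flow D ε 1 v - q).2 + q.2) / ee D ε = v.2 := by
      simp only [flow, Prod.snd_sub, zpow_one, sub_add_cancel]
      field_simp
    obtain ⟨z, hz, hzp⟩ := exists_eq_endpoint (f := fun u => (u + q.2) / ee D ε)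
      (by fun_prop) hx hw.2 (p := 0) (r := uHi D i) (by simp only [hfx]; exact hv.2) hcon
    obtain ⟨r, hr, hr1, hr2, hr3⟩ := exists_lattice_horizontal_edge hD hsq i
      (v := (v.1, (z + q.2) / ee D ε)) hv.1 hzp
    simp only at hr1 hr2 hr3
    have hmem : (el D ε * v.1 - q.1, z) ∈ planeR D j := by
      rw [planeR_eq]
      exact ⟨hvq.1, hz⟩
    have hr' := (lattice D).sub_mem (flow_mem_lattice hD hsq he 1 hr) hq
    have hb := el_mul_mem hD hsq he hr2 hr3
    refine not_mem_planeR_of_horizontal hD hsq hmem hr' ?_ ?_ ?_ <;>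
      simp only [flow, Prod.fst_sub, Prod.snd_sub, zpow_one]
    · rw [← hr1]
      field_simp
      ring
    · linarith [hb.1]
    · linarith [hb.2]
  · rw [planeR_eq]
    refine ⟨?_, hw.2⟩
    -- The dual argument: a vertical edge of R_j would pull back under φ into the interior of R_i,
    -- although φ⁻¹ shortens the unstable segments above lattice points and so keeps them in the
    -- boundary.
    by_contra hcon
    obtain ⟨z, hz, hzp⟩ := exists_eq_endpoint (f := fun s => el D ε * s - q.1)
      (by fun_prop) hv.1 hv'.1 (p := sLo j) (r := sHi D j) hvq.1 hcon
    obtain ⟨r, hr, hr1, hr2, hr3⟩ := exists_lattice_vertical_edge hD hsq j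
      (v := (el D ε * z - q.1, ee D ε * v.2 - q.2)) hzp hvq.2
    simp only at hr1 hr2 hr3
    have hmem : (z, v.2) ∈ planeR D i := by
      rw [planeR_eq]
      exact ⟨hz, hv.2⟩
    have hr' := flow_mem_lattice hD hsq he (-1) ((lattice D).add_mem hr hq)
    have hl0 := el_ne_zero hD hsq he
    have hinv : (ee D ε)⁻¹ ≤ 1 := (inv_lt_one_of_one_lt₀ he).le
    have hinv0 : 0 < (ee D ε)⁻¹ := inv_pos.2 h0
    have hkey : v.2 - (flow D ε (-1) (r + q)).2 =
        (ee D ε)⁻¹ * (ee D ε * v.2 - q.2 - r.2) := by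
      simp only [flow, Prod.snd_add, zpow_neg_one]
      field_simp
      ring
    refine not_mem_planeR_of_vertical hD hsq hmem hr' ?_ ?_ ?_
    · simp only [flow, Prod.fst_add, zpow_neg_one]
      rw [← hr1]
      field_simp
      ring
    · rw [hkey]
      positivity
    · rw [hkey]
      nlinarith

end Markov

/-! ### The structure of the initial partition -/

section Partition

variable {D : ℕ} {ε : (OK D)ˣ}

/-- `φ` maps some point of the planar set `A` into the translate by `q` of the planar set `B`. -/
def Step (D : ℕ) (ε : (OK D)ˣ) (A B : Set V) (q : V) : Prop :=
  q ∈ lattice D ∧ ∃ v ∈ A, flow D ε 1 v - q ∈ B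

/-- The properties of the partition `P0` on which the coding rests. -/
structure IsMarkov (D : ℕ) (ε : (OK D)ˣ) : Prop where
  finite : (P0 D ε).Finite
  product : ∀ A ∈ P0 D ε, ∀ v ∈ rep D A, ∀ w ∈ rep D A, (v.1, w.2) ∈ rep D A
  lift : ∀ A ∈ P0 D ε, ∀ x ∈ A, ∃ v ∈ rep D A, proj D v = x
  disjoint : ∀ A ∈ P0 D ε, ∀ B ∈ P0 D ε, ∀ x ∈ A, x ∈ B → A = B
  cover : ∀ v, Generic D v → ∃ A ∈ P0 D ε, proj D v ∈ A
  unique : ∀ A ∈ P0 D ε, ∀ B ∈ P0 D ε, ∀ q q', Step D ε (rep D A) (rep D B) q →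
    Step D ε (rep D A) (rep D B) q' → q = q'
  markov : ∀ A ∈ P0 D ε, ∀ B ∈ P0 D ε, ∀ q, Step D ε (rep D A) (rep D B) q →
    ∀ v ∈ rep D A, ∀ w ∈ rep D B, (v.1, (w.2 + q.2) / ee D ε) ∈ rep D A ∧
      (el D ε * v.1 - q.1, w.2) ∈ rep D B

lemma rep_proj_image (hD : 1 < D) (hsq : Squarefree D) {S : Set V} (hS : S ⊆ footprint D) :
    rep D (proj D '' S) = S := by
  ext v
  constructor
  · rintro ⟨hv, w, hw, hvw⟩
    obtain ⟨i, hi⟩ := mem_footprint_iff.1 hv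
    obtain ⟨j, hj⟩ := mem_footprint_iff.1 (hS hw)
    rw [(eq_zero_of_planeR_sub hD hsq hi hj (proj_eq_iff.1 hvw.symm)).1]
    exact hw
  · exact fun hv => ⟨hS hv, v, hv, rfl⟩

lemma torusR_disjoint (hD : 1 < D) (hsq : Squarefree D) {i j : Fin 2} {x : Torus D}
    (hi : x ∈ torusR D i) (hj : x ∈ torusR D j) : i = j := by
  obtain ⟨v, hv, rfl⟩ := hi
  obtain ⟨w, hw, hvw⟩ := hj
  exact (eq_zero_of_planeR_sub hD hsq hv hw (proj_eq_iff.1 hvw.symm)).2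

lemma planeR_product {i : Fin 2} {v w : V} (hv : v ∈ planeR D i) (hw : w ∈ planeR D i) :
    (v.1, w.2) ∈ planeR D i := by
  rw [planeR_eq] at *
  exact ⟨hv.1, hw.2⟩

lemma Generic.exists_mem_torusR (hD : 1 < D) (hsq : Squarefree D) {v : V} (hv : Generic D v) :
    ∃ i, proj D v ∈ torusR D i := by
  obtain ⟨q, hq, h⟩ := hv.exists_sub_mem hD hsq
  obtain ⟨i, hi⟩ := mem_footprint_iff.1 h
  exact ⟨i, v - q, hi, proj_eq_iff.2 (by simpa using hq)⟩

/-- Full crossing confines `q` to a box depending on `i` and `j`. For the golden ratio every such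
box has area below 1, so two choices of `q` differ by a lattice vector of norm below 1, which is
zero. -/
lemma planeR_step_unique_of_eq_five (hsq : Squarefree D) (h5 : D = 5)
    (hε : IsFundamentalUnit D ε) {i j : Fin 2} {q q' : V}
    (h : Step D ε (planeR D i) (planeR D j) q) (h' : Step D ε (planeR D i) (planeR D j) q') :
    q = q' := by
  have hD : 1 < D := by omega
  have he : 1 < ee D ε := hε.1
  have h0 := ee_pos he
  have hb := rb_pos hD hsq
  obtain ⟨hea, hab, hsub, hel⟩ := golden_of_eq_five hsq h5 hε he
  have bounds : ∀ q, Step D ε (planeR D i) (planeR D j) q →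
      (0 ≤ q.2 ∧ q.2 ≤ ra D * uHi D i - uHi D j) ∧
      -(sHi D j + q.1) ≤ rb D * sLo i ∧ rb D * sHi D i ≤ -(sLo j + q.1) := by
    rintro q ⟨hq, v, hv, hvq⟩
    have hu : Ioo 0 (uHi D j) ⊆ Ioo (-q.2) (ra D * uHi D i - q.2) := by
      intro u hu
      have hw : ((flow D ε 1 v - q).1, u) ∈ planeR D j := by
        rw [planeR_eq] at hvq ⊢
        exact ⟨hvq.1, hu⟩
      have := (planeR_markov hD hsq he hq hv hvq hv hw).1
      rw [planeR_eq] at this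
      obtain ⟨h1, h2⟩ := this.2
      simp only at h1 h2
      rw [div_pos_iff_of_pos_right h0] at h1
      rw [div_lt_iff₀ h0, hea] at h2
      exact ⟨by linarith, by linarith⟩
    have hs : Ioo (sLo i) (sHi D i) ⊆
        Ioo (-(sHi D j + q.1) / rb D) (-(sLo j + q.1) / rb D) := by
      intro s hs
      have hv' : (s, v.2) ∈ planeR D i := by
        rw [planeR_eq] at hv ⊢
        exact ⟨hs, hv.2⟩
      have := (planeR_markov hD hsq he hq hv hvq hv' hvq).2
      rw [planeR_eq] at this
      obtain ⟨h1, h2⟩ := this.1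
      simp only [hel] at h1 h2
      rw [mem_Ioo, div_lt_iff₀ hb, lt_div_iff₀ hb]
      exact ⟨by linarith, by linarith⟩
    rw [Ioo_subset_Ioo_iff (uHi_pos hD hsq j)] at hu
    rw [Ioo_subset_Ioo_iff (sLo_lt_sHi hD hsq i), div_le_iff₀ hb, le_div_iff₀ hb] at hs
    exact ⟨⟨by linarith [hu.1], by linarith [hu.2]⟩, by linarith [hs.1], by linarith [hs.2]⟩
  obtain ⟨⟨a1, a2⟩, a3, a4⟩ := bounds q h
  obtain ⟨⟨b1, b2⟩, b3, b4⟩ := bounds q' h'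
  have hd2 : |(q - q').2| ≤ ra D * uHi D i - uHi D j := by
    rw [abs_le, Prod.snd_sub]
    constructor <;> linarith
  have hd1 : |(q - q').1| ≤ sHi D j - sLo j - rb D * (sHi D i - sLo i) := by
    rw [abs_le, Prod.fst_sub]
    constructor <;> linarith
  refine sub_eq_zero.1 (eq_zero_of_norm_lt_one hD hsq ((lattice D).sub_mem h.1 h'.1) ?_)
  refine (mul_le_mul hd1 hd2 (abs_nonneg _) ((abs_nonneg _).trans hd1)).trans_lt ?_
  have hb1 : rb D < 1 := by nlinarith
  have hra : ra D = rb D + 1 := by linarith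
  rw [hra] at hab ⊢
  fin_cases i <;> fin_cases j <;> simp only [sHi, sLo, uHi, Fin.zero_eta, Fin.mk_one,
    Matrix.cons_val_zero, Matrix.cons_val_one] <;> try rw [hra]
  all_goals nlinarith

lemma isMarkov_of_eq_five (hsq : Squarefree D) (h5 : D = 5) (hε : IsFundamentalUnit D ε) :
    IsMarkov D ε := by
  have hD : 1 < D := by omega
  have he : 1 < ee D ε := hε.1
  have hP : P0 D ε = range (torusR D) := by rw [P0, if_pos h5]
  have hrep : ∀ i, rep D (torusR D i) = planeR D i := fun i =>
    rep_proj_image hD hsq (planeR_subset_footprint D i)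
  constructor
  · rw [hP]
    exact finite_range _
  · rw [hP]
    rintro _ ⟨i, rfl⟩ v hv w hw
    rw [hrep] at *
    exact planeR_product hv hw
  · rw [hP]
    rintro _ ⟨i, rfl⟩ x hx
    rw [hrep]
    exact hx
  · rw [hP]
    rintro _ ⟨i, rfl⟩ _ ⟨j, rfl⟩ x hx hx'
    rw [torusR_disjoint hD hsq hx hx']
  · intro v hv
    obtain ⟨i, hi⟩ := hv.exists_mem_torusR hD hsq
    exact ⟨_, hP ▸ ⟨i, rfl⟩, hi⟩
  · rw [hP]
    rintro _ ⟨i, rfl⟩ _ ⟨j, rfl⟩ q q' h h'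
    rw [hrep, hrep] at *
    exact planeR_step_unique_of_eq_five hsq h5 hε h h'
  · rw [hP]
    rintro _ ⟨i, rfl⟩ _ ⟨j, rfl⟩ q h v hv w hw
    rw [hrep, hrep] at *
    obtain ⟨hq, x, hx, hxq⟩ := h
    exact planeR_markov hD hsq he hq hx hxq hv hw

/-- The part of `R_i` that `φ` maps into the translate by `q` of `R_j`. -/
def strip (D : ℕ) (ε : (OK D)ˣ) (i j : Fin 2) (q : V) : Set V :=
  {v | v ∈ planeR D i ∧ flow D ε 1 v - q ∈ planeR D j}

lemma isOpen_planeR (i : Fin 2) : IsOpen (planeR D i) := by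
  rw [planeR_eq]
  exact isOpen_Ioo.prod isOpen_Ioo

lemma continuous_flow (i : ℤ) : Continuous (flow D ε i) := by
  unfold flow
  fun_prop

lemma isOpen_strip (i j : Fin 2) (q : V) : IsOpen (strip D ε i j q) :=
  (isOpen_planeR i).inter
    ((isOpen_planeR j).preimage ((continuous_flow 1).sub continuous_const))

lemma convex_strip (i j : Fin 2) (q : V) : Convex ℝ (strip D ε i j q) := by
  have hc : ∀ i, Convex ℝ (planeR D i) := fun i => by
    rw [planeR_eq]
    exact (convex_Ioo _ _).prod (convex_Ioo _ _)
  rintro v ⟨hv, hvq⟩ w ⟨hw, hwq⟩ a b ha hb hab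
  refine ⟨hc i hv hw ha hb hab, ?_⟩
  have : flow D ε 1 (a • v + b • w) - q =
      a • (flow D ε 1 v - q) + b • (flow D ε 1 w - q) := by
    have hb' : b = 1 - a := by linarith
    refine Prod.ext ?_ ?_ <;> simp [flow, hb'] <;> ring
  rw [this]
  exact hc j hvq hwq ha hb hab

lemma strip_subset_footprint (i j : Fin 2) (q : V) : strip D ε i j q ⊆ footprint D :=
  fun _ hv => planeR_subset_footprint D i hv.1

lemma continuous_proj : Continuous (proj D) := continuous_quotient_mk'

lemma isOpenMap_proj : IsOpenMap (proj D) := QuotientAddGroup.isOpenMap_coe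

lemma mem_torusR_inter_iff {i j : Fin 2} {x : Torus D} :
    x ∈ torusR D i ∩ phi D ε ⁻¹' torusR D j ↔ ∃ q ∈ lattice D, x ∈ proj D '' strip D ε i j q := by
  constructor
  · rintro ⟨⟨v, hv, rfl⟩, w, hw, hvw⟩
    rw [phi_proj] at hvw
    refine ⟨flow D ε 1 v - w, proj_eq_iff.1 hvw.symm, v, ⟨hv, ?_⟩, rfl⟩
    rwa [sub_sub_cancel]
  · rintro ⟨q, hq, v, ⟨hv, hvq⟩, rfl⟩
    refine ⟨⟨v, hv, rfl⟩, _, hvq, ?_⟩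
    rw [phi_proj, proj_eq_iff]
    simpa using hq

lemma strip_unique (hD : 1 < D) (hsq : Squarefree D) {i j i' j' : Fin 2} {q q' : V}
    (hq : q ∈ lattice D) (hq' : q' ∈ lattice D) {x : Torus D}
    (h : x ∈ proj D '' strip D ε i j q) (h' : x ∈ proj D '' strip D ε i' j' q') :
    i = i' ∧ j = j' ∧ q = q' := by
  obtain ⟨v, ⟨hv, hvq⟩, rfl⟩ := h
  obtain ⟨w, ⟨hw, hwq⟩, hvw⟩ := h'
  obtain ⟨rfl, rfl⟩ := eq_zero_of_planeR_sub hD hsq hv hw (proj_eq_iff.1 hvw.symm)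
  obtain ⟨h1, rfl⟩ := eq_zero_of_planeR_sub hD hsq hvq hwq (by
    rw [sub_sub_sub_cancel_left]
    exact (lattice D).sub_mem hq' hq)
  exact ⟨rfl, rfl, sub_right_injective h1⟩

/-- The strips with different `q` have open, pairwise disjoint images on the torus that exhaust the
intersection, and each image is connected because the strip is convex. -/
lemma connectedComponentIn_torusR (hD : 1 < D) (hsq : Squarefree D) {i j : Fin 2} {q : V}
    (hq : q ∈ lattice D) {x : Torus D} (hx : x ∈ proj D '' strip D ε i j q) :
    connectedComponentIn (torusR D i ∩ phi D ε ⁻¹' torusR D j) x =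
      proj D '' strip D ε i j q := by
  set S := torusR D i ∩ phi D ε ⁻¹' torusR D j
  have hxS : x ∈ S := mem_torusR_inter_iff.2 ⟨q, hq, hx⟩
  apply Subset.antisymm
  · let W : Set (Torus D) := ⋃ q' ∈ {q' | q' ∈ lattice D ∧ q' ≠ q}, proj D '' strip D ε i j q'
    refine isPreconnected_connectedComponentIn.subset_left_of_subset_union (v := W)
      (isOpenMap_proj _ (isOpen_strip i j q))
      (isOpen_biUnion fun q' _ => isOpenMap_proj _ (isOpen_strip i j q')) ?_ ?_ ?_
    · rw [Set.disjoint_left]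
      intro y hy hyW
      obtain ⟨q', ⟨hq', hne⟩, hy'⟩ := mem_iUnion₂.1 hyW
      exact hne (strip_unique hD hsq hq hq' hy hy').2.2.symm
    · intro y hy
      obtain ⟨q', hq', hy'⟩ := mem_torusR_inter_iff.1 (connectedComponentIn_subset _ _ hy)
      by_cases h : q' = q
      · exact Or.inl (h ▸ hy')
      · exact Or.inr (mem_iUnion₂.2 ⟨q', ⟨hq', h⟩, hy'⟩)
    · exact ⟨x, mem_connectedComponentIn hxS, hx⟩
  · exact ((convex_strip i j q).isPreconnected.image _ continuous_proj.continuousOn)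
      |>.subset_connectedComponentIn hx fun y hy => mem_torusR_inter_iff.2 ⟨q, hq, hy⟩

lemma mem_P0_iff (hD : 1 < D) (hsq : Squarefree D) (h5 : D ≠ 5) {A : Set (Torus D)} :
    A ∈ P0 D ε ↔ ∃ i j, ∃ q ∈ lattice D, (strip D ε i j q).Nonempty ∧
      A = proj D '' strip D ε i j q := by
  rw [P0, if_neg h5]
  constructor
  · rintro ⟨i, j, x, hx, rfl⟩
    obtain ⟨q, hq, hxq⟩ := mem_torusR_inter_iff.1 hx
    exact ⟨i, j, q, hq, hxq.imp fun v hv => hv.1, connectedComponentIn_torusR hD hsq hq hxq⟩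
  · rintro ⟨i, j, q, hq, ⟨v, hv⟩, rfl⟩
    have hx : proj D v ∈ proj D '' strip D ε i j q := ⟨v, hv, rfl⟩
    exact ⟨i, j, proj D v, mem_torusR_inter_iff.2 ⟨q, hq, hx⟩,
      (connectedComponentIn_torusR hD hsq hq hx).symm⟩

lemma norm_flow_le (hD : 1 < D) (hsq : Squarefree D) (he : 1 < ee D ε) (v : V) :
    ‖flow D ε 1 v‖ ≤ ee D ε * ‖v‖ := by
  have h1 := norm_fst_le v
  have h2 := norm_snd_le v
  have h3 := abs_el_lt_one hD hsq he
  rw [flow, zpow_one, zpow_one, Prod.norm_mk, max_le_iff, norm_mul, norm_mul, Real.norm_eq_abs,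
    Real.norm_eq_abs (ee D ε), abs_of_pos (ee_pos he)]
  constructor
  · exact mul_le_mul (h3.trans he).le h1 (norm_nonneg _) (ee_pos he).le
  · exact mul_le_mul_of_nonneg_left h2 (ee_pos he).le

lemma strip_product {i j : Fin 2} {q v w : V} (hv : v ∈ strip D ε i j q)
    (hw : w ∈ strip D ε i j q) : (v.1, w.2) ∈ strip D ε i j q :=
  ⟨planeR_product hv.1 hw.1, planeR_product hv.2 hw.2⟩

lemma isMarkov_of_ne_five (hD : 1 < D) (hsq : Squarefree D) (h5 : D ≠ 5) (he : 1 < ee D ε) :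
    IsMarkov D ε := by
  have hP : ∀ A, A ∈ P0 D ε → _ := fun A => (mem_P0_iff hD hsq h5).1
  have hrep : ∀ i j q, rep D (proj D '' strip D ε i j q) = strip D ε i j q := fun i j q =>
    rep_proj_image hD hsq (strip_subset_footprint i j q)
  -- A strip records the translation `q` undergone by its image, so the translation between two
  -- strips is determined by the first. This is the purpose of passing from R₀, R₁ to the
  -- components.
  have hstep : ∀ i j q i' j' q' r, q ∈ lattice D →
      Step D ε (strip D ε i j q) (strip D ε i' j' q') r → r = q ∧ i' = j := by
    rintro i j q i' j' q' r hq ⟨hr, v, ⟨-, hv⟩, hv', -⟩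
    obtain ⟨h1, rfl⟩ := eq_zero_of_planeR_sub hD hsq hv' hv (by
      rw [sub_sub_sub_cancel_left]
      exact (lattice D).sub_mem hq hr)
    exact ⟨sub_right_injective h1, rfl⟩
  constructor
  · let R := ee D ε * (1 + ra D + rb D) + (1 + ra D + rb D)
    refine ((finite_univ (α := Fin 2 × Fin 2)).prod (lattice_bounded_finite hD hsq R)).image
      (fun p => proj D '' strip D ε p.1.1 p.1.2 p.2) |>.subset ?_
    intro A hA
    obtain ⟨i, j, q, hq, ⟨v, hv, hvq⟩, rfl⟩ := hP A hA
    refine ⟨((i, j), q), ⟨trivial, hq, ?_⟩, rfl⟩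
    have h1 := closedFootprint_bounded hD hsq
      (footprint_subset_closedFootprint (planeR_subset_footprint D i hv))
    have h2 := closedFootprint_bounded hD hsq
      (footprint_subset_closedFootprint (planeR_subset_footprint D j hvq))
    have h3 : q = flow D ε 1 v - (flow D ε 1 v - q) := by abel
    rw [h3]
    refine (norm_sub_le _ _).trans (add_le_add ((norm_flow_le hD hsq he v).trans ?_) h2)
    exact mul_le_mul_of_nonneg_left h1 (ee_pos he).le
  · intro A hA v hv w hw
    obtain ⟨i, j, q, hq, -, rfl⟩ := hP A hA
    rw [hrep] at *
    exact strip_product hv hw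
  · intro A hA x hx
    obtain ⟨i, j, q, hq, -, rfl⟩ := hP A hA
    rw [hrep]
    exact hx
  · intro A hA B hB x hxA hxB
    obtain ⟨i, j, q, hq, -, rfl⟩ := hP A hA
    obtain ⟨i', j', q', hq', -, rfl⟩ := hP B hB
    obtain ⟨rfl, rfl, rfl⟩ := strip_unique hD hsq hq hq' hxA hxB
    rfl
  · intro v hv
    obtain ⟨i, hi⟩ := hv.exists_mem_torusR hD hsq
    obtain ⟨j, hj⟩ := (hv.flow hD hsq he 1).exists_mem_torusR hD hsq
    rw [← phi_proj] at hj
    obtain ⟨q, hq, hx⟩ := mem_torusR_inter_iff.1 ⟨hi, hj⟩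
    exact ⟨_, (mem_P0_iff hD hsq h5).2 ⟨i, j, q, hq, hx.imp fun v hv => hv.1, rfl⟩, hx⟩
  · intro A hA B hB r r' h h'
    obtain ⟨i, j, q, hq, -, rfl⟩ := hP A hA
    obtain ⟨i', j', q', hq', -, rfl⟩ := hP B hB
    rw [hrep, hrep] at *
    rw [(hstep _ _ _ _ _ _ _ hq h).1, (hstep _ _ _ _ _ _ _ hq h').1]
  · intro A hA B hB r h v hv w hw
    obtain ⟨i, j, q, hq, -, rfl⟩ := hP A hA
    obtain ⟨i', j', q', hq', -, rfl⟩ := hP B hB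
    rw [hrep] at *
    rw [hrep] at *
    obtain ⟨rfl, rfl⟩ := hstep _ _ _ _ _ _ _ hq h
    obtain ⟨h1, h2⟩ := planeR_markov hD hsq he hq hv.1 hv.2 hv.1 hw.1
    refine ⟨⟨h1, ?_⟩, h2, ?_⟩
    · have : flow D ε 1 (v.1, (w.2 + r.2) / ee D ε) - r = (el D ε * v.1 - r.1, w.2) := by
        have := (ee_pos he).ne'
        refine Prod.ext ?_ ?_
        · simp [flow]
        · simp only [flow, zpow_one, Prod.snd_sub]
          field_simp
          ring
      rw [this]
      exact h2
    · have := (planeR_markov hD hsq he hq' hw.1 hw.2 h2 hw.2).2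
      have e : flow D ε 1 (el D ε * v.1 - r.1, w.2) - q' =
          (el D ε * (el D ε * v.1 - r.1, w.2).1 - q'.1, (flow D ε 1 w - q').2) := by
        refine Prod.ext ?_ ?_ <;> simp [flow]
      rw [e]
      exact this

/-- The initial partition is a Markov partition. -/
lemma isMarkov (hD : 1 < D) (hsq : Squarefree D) (hε : IsFundamentalUnit D ε) : IsMarkov D ε := by
  by_cases h5 : D = 5
  · exact isMarkov_of_eq_five hsq h5 hε
  · exact isMarkov_of_ne_five hD hsq h5 hε.1

end Partition

/-! ### The coding map -/

section Coding

open Uniformity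

variable {D : ℕ} {ε : (OK D)ˣ}

open Classical in
/-- The lattice vector `q` such that `φ` maps `A` across the translate by `q` of `B`, if any. -/
def step (A B : P0 D ε) : V :=
  if h : ∃ q, Step D ε (rep D A) (rep D B) q then h.choose else 0

lemma step_mem_lattice (A B : P0 D ε) : step A B ∈ lattice D := by
  unfold step
  split_ifs with h
  · exact h.choose_spec.1
  · exact (lattice D).zero_mem

lemma IsMarkov.step_spec (hM : IsMarkov D ε) {A B : P0 D ε}
    (h : ((A : Set (Torus D)) ∩ phi D ε ⁻¹' (B : Set (Torus D))).Nonempty) :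
    Step D ε (rep D A) (rep D B) (step A B) := by
  obtain ⟨x, hxA, hxB⟩ := h
  obtain ⟨v, hv, rfl⟩ := hM.lift A A.2 x hxA
  obtain ⟨w, hw, hwv⟩ := hM.lift B B.2 _ hxB
  rw [phi_proj] at hwv
  have : ∃ q, Step D ε (rep D A) (rep D B) q :=
    ⟨flow D ε 1 v - w, proj_eq_iff.1 hwv.symm, v, hv, by rwa [sub_sub_cancel]⟩
  unfold step
  rw [dif_pos this]
  exact this.choose_spec

lemma IsMarkov.exists_step_bound (hM : IsMarkov D ε) : ∃ C, ∀ A B : P0 D ε, ‖step A B‖ ≤ C := by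
  have := hM.finite.to_subtype
  obtain ⟨C, hC⟩ := (finite_range fun p : P0 D ε × P0 D ε => ‖step p.1 p.2‖).bddAbove
  exact ⟨C, fun A B => hC ⟨(A, B), rfl⟩⟩

/-- The point of the plane coded by a string. -/
def code (s : ℤ → P0 D ε) : V :=
  (-∑' k : ℕ, (step (s (-k - 1)) (s (-k))).1 * el D ε ^ k,
    ∑' k : ℕ, (step (s k) (s (k + 1))).2 * (ee D ε)⁻¹ ^ (k + 1))

/-- The point coded by the `k`-th shift of a string. -/
def codeAt (s : ℤ → P0 D ε) (k : ℤ) : V := code fun i => s (i + k)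

lemma codeAt_zero (s : ℤ → P0 D ε) : codeAt s 0 = code s := by simp [codeAt]

lemma summable_step_el (hD : 1 < D) (hsq : Squarefree D) (he : 1 < ee D ε) (hM : IsMarkov D ε)
    (a b : ℕ → P0 D ε) : Summable fun k : ℕ => (step (a k) (b k)).1 * el D ε ^ k := by
  obtain ⟨C, hC⟩ := hM.exists_step_bound
  refine Summable.of_norm_bounded (g := fun k => C * |el D ε| ^ k)
    ((summable_geometric_of_lt_one (abs_nonneg _) (abs_el_lt_one hD hsq he)).mul_left C) fun k => ?_
  rw [norm_mul, norm_pow, Real.norm_eq_abs (el D ε)]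
  exact mul_le_mul_of_nonneg_right ((norm_fst_le _).trans (hC _ _)) (by positivity)

lemma inv_ee_nonneg (he : 1 < ee D ε) : 0 ≤ (ee D ε)⁻¹ := (inv_pos.2 (ee_pos he)).le

lemma summable_step_ee (he : 1 < ee D ε) (hM : IsMarkov D ε) (a b : ℕ → P0 D ε) :
    Summable fun k : ℕ => (step (a k) (b k)).2 * (ee D ε)⁻¹ ^ (k + 1) := by
  obtain ⟨C, hC⟩ := hM.exists_step_bound
  have h0 := inv_ee_nonneg he
  refine Summable.of_norm_bounded (g := fun k => C * (ee D ε)⁻¹ ^ (k + 1))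
    (((summable_nat_add_iff 1).2 (summable_geometric_of_lt_one h0
      (inv_lt_one_of_one_lt₀ he))).mul_left C) fun k => ?_
  rw [norm_mul, Real.norm_of_nonneg (pow_nonneg h0 _)]
  exact mul_le_mul_of_nonneg_right ((norm_snd_le _).trans (hC _ _)) (pow_nonneg h0 _)

/-- The two series give the bounded solution of x_{k+1} = φ(x_k) - q_k, summed over the future in
the unstable coordinate and over the past in the stable one. A shift moves one term from one series
to the other. -/
lemma code_shift (hD : 1 < D) (hsq : Squarefree D) (he : 1 < ee D ε) (hM : IsMarkov D ε)
    (s : ℤ → P0 D ε) : code (shift s) = flow D ε 1 (code s) - step (s 0) (s 1) := by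
  refine Prod.ext ?_ ?_
  · simp only [code, flow, Prod.fst_sub, zpow_one, shift]
    rw [(summable_step_el hD hsq he hM (fun k => s (-k - 1 + 1)) fun k => s (-k + 1)).tsum_eq_zero_add,
      mul_neg, ← tsum_mul_left, neg_add, sub_eq_add_neg, add_comm]
    congr 2
    · refine tsum_congr fun k => ?_
      rw [pow_succ, show (-((k + 1 : ℕ) : ℤ) - 1 + 1) = -k - 1 by push_cast; ring,
        show (-((k + 1 : ℕ) : ℤ) + 1) = -k by push_cast; ring]
      ring
    · simp
  · simp only [code, flow, Prod.snd_sub, zpow_one, shift]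
    rw [(summable_step_ee he hM (fun k => s k) fun k => s (k + 1)).tsum_eq_zero_add, mul_add,
      ← tsum_mul_left]
    have h0 := (ee_pos he).ne'
    have h1 : ee D ε * ((step (s ((0 : ℕ) : ℤ)) (s ((0 : ℕ) + 1))).2 * (ee D ε)⁻¹ ^ (0 + 1)) =
        (step (s 0) (s 1)).2 := by
      simp only [Nat.cast_zero, zero_add, pow_one]
      field_simp
    rw [h1, add_sub_cancel_left]
    refine tsum_congr fun k => ?_
    rw [pow_succ _ (k + 1)]
    push_cast
    field_simp

lemma codeAt_succ (hD : 1 < D) (hsq : Squarefree D) (he : 1 < ee D ε) (hM : IsMarkov D ε)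
    (s : ℤ → P0 D ε) (k : ℤ) :
    codeAt s (k + 1) = flow D ε 1 (codeAt s k) - step (s k) (s (k + 1)) := by
  have h := code_shift hD hsq he hM fun i => s (i + k)
  have h1 : (shift fun i => s (i + k)) = fun i => s (i + (k + 1)) := by
    funext i
    simp only [shift]
    congr 1
    ring
  rw [h1] at h
  simp only [zero_add, add_comm 1 k] at h
  exact h

lemma semiconj_code (hD : 1 < D) (hsq : Squarefree D) (he : 1 < ee D ε) (hM : IsMarkov D ε) :
    Function.Semiconj (fun s : ℤ → P0 D ε => proj D (code s)) shift (phi D ε) := by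
  intro s
  simp only
  rw [code_shift hD hsq he hM, phi_proj, proj_eq_iff]
  simpa using step_mem_lattice _ _

lemma proj_codeAt (hD : 1 < D) (hsq : Squarefree D) (he : 1 < ee D ε) (hM : IsMarkov D ε)
    (s : ℤ → P0 D ε) (i : ℤ) : proj D (codeAt s i) = (phi D ε ^ i) (proj D (code s)) := by
  have hs : ∀ k, proj D (codeAt s (k + 1)) = phi D ε (proj D (codeAt s k)) := by
    intro k
    rw [codeAt_succ hD hsq he hM, phi_proj, proj_eq_iff]
    simpa using step_mem_lattice _ _
  induction i with
  | zero => simp [codeAt_zero]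
  | succ n ih => rw [hs, ih, add_comm, zpow_add, Equiv.Perm.mul_apply, zpow_one]
  | pred n ih =>
    have := hs (-n - 1)
    rw [sub_add_cancel, ih] at this
    rw [sub_eq_add_neg, add_comm, zpow_add, Equiv.Perm.mul_apply, zpow_neg_one,
      eq_comm, Equiv.Perm.inv_eq_iff_eq, add_comm, ← sub_eq_add_neg]
    exact this

lemma flow_code_sub_mem (hD : 1 < D) (hsq : Squarefree D) (he : 1 < ee D ε) (hM : IsMarkov D ε)
    (s : ℤ → P0 D ε) (k i : ℤ) : flow D ε i (codeAt s k) - codeAt s (k + i) ∈ lattice D := by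
  rw [← proj_eq_iff, ← phi_zpow_proj hD hsq he, proj_codeAt hD hsq he hM, proj_codeAt hD hsq he hM,
    add_comm, zpow_add, Equiv.Perm.mul_apply]

lemma continuous_prodMk_apply {A : Type*} [TopologicalSpace A] (i j : ℤ) :
    Continuous fun s : ℤ → A => (s i, s j) := by
  fun_prop

lemma continuous_code (hD : 1 < D) (hsq : Squarefree D) (he : 1 < ee D ε) (hM : IsMarkov D ε)
    [TopologicalSpace (P0 D ε)] [DiscreteTopology (P0 D ε)] :
    Continuous (code : (ℤ → P0 D ε) → V) := by
  obtain ⟨C, hC⟩ := hM.exists_step_bound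
  have h0 := inv_ee_nonneg he
  have hstep : ∀ i j : ℤ, Continuous fun s : ℤ → P0 D ε => step (s i) (s j) := fun i j =>
    (continuous_of_discreteTopology (f := fun p : P0 D ε × P0 D ε => step p.1 p.2)).comp
      (continuous_prodMk_apply i j)
  refine Continuous.prodMk (Continuous.neg ?_) ?_
  · refine continuous_tsum (u := fun k => C * |el D ε| ^ k)
      (fun k => (continuous_fst.comp (hstep _ _)).mul continuous_const)
      ((summable_geometric_of_lt_one (abs_nonneg _) (abs_el_lt_one hD hsq he)).mul_left C) ?_
    intro k s
    rw [norm_mul, norm_pow, Real.norm_eq_abs (el D ε)]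
    exact mul_le_mul_of_nonneg_right ((norm_fst_le _).trans (hC _ _)) (by positivity)
  · refine continuous_tsum (u := fun k => C * (ee D ε)⁻¹ ^ (k + 1))
      (fun k => (continuous_snd.comp (hstep _ _)).mul continuous_const)
      (((summable_nat_add_iff 1).2 (summable_geometric_of_lt_one h0
        (inv_lt_one_of_one_lt₀ he))).mul_left C) ?_
    intro k s
    rw [norm_mul, Real.norm_of_nonneg (pow_nonneg h0 _)]
    exact mul_le_mul_of_nonneg_right ((norm_snd_le _).trans (hC _ _)) (pow_nonneg h0 _)

lemma exists_agree_code_close (hD : 1 < D) (hsq : Squarefree D) (he : 1 < ee D ε)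
    (hM : IsMarkov D ε) {δ : ℝ} (hδ : 0 < δ) :
    ∃ j, ∀ s s' : ℤ → P0 D ε, Agree j s s' → ‖code s - code s'‖ < δ := by
  have := hM.finite.to_subtype
  let : UniformSpace (P0 D ε) := ⊥
  have : DiscreteTopology (P0 D ε) := ⟨rfl⟩
  have hu := CompactSpace.uniformContinuous_of_continuous (continuous_code hD hsq he hM)
  obtain ⟨j, hj⟩ := exists_agreeRel_subset (hu (Metric.dist_mem_uniformity hδ))
  refine ⟨j, fun s s' h => ?_⟩
  rw [← dist_eq_norm]
  exact hj (a := (s, s')) h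

lemma exists_code_bound (hD : 1 < D) (hsq : Squarefree D) (he : 1 < ee D ε) (hM : IsMarkov D ε) :
    ∃ C, ∀ s : ℤ → P0 D ε, ‖code s‖ ≤ C := by
  have := hM.finite.to_subtype
  let : TopologicalSpace (P0 D ε) := ⊥
  have : DiscreteTopology (P0 D ε) := ⟨rfl⟩
  obtain ⟨C, hC⟩ := (isCompact_range (continuous_code hD hsq he hM)).isBounded.exists_norm_le
  exact ⟨C, fun s => hC _ ⟨s, rfl⟩⟩

lemma isCompact_code_image_Sig (hD : 1 < D) (hsq : Squarefree D) (he : 1 < ee D ε)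
    (hM : IsMarkov D ε) : IsCompact (code '' Sig D ε) := by
  have := hM.finite.to_subtype
  let : TopologicalSpace (P0 D ε) := ⊥
  have : DiscreteTopology (P0 D ε) := ⟨rfl⟩
  refine IsCompact.image (IsClosed.isCompact ?_) (continuous_code hD hsq he hM)
  rw [Sig, ofPred_forall]
  refine isClosed_iInter fun k => ?_
  exact (isClosed_discrete {p : P0 D ε × P0 D ε |
    ((p.1 : Set (Torus D)) ∩ phi D ε ⁻¹' (p.2 : Set (Torus D))).Nonempty}).preimage
      (continuous_prodMk_apply k (k + 1))

/-- Orbits may be prescribed by their stable coordinate at the start and their unstable coordinate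
at the end. -/
lemma codeAt_add_flow_mem_rep (hD : 1 < D) (hsq : Squarefree D) (he : 1 < ee D ε)
    (hM : IsMarkov D ε) {s : ℤ → P0 D ε} (hs : s ∈ Sig D ε) (m : ℤ) (n : ℕ) {v w : V}
    (hv : v ∈ rep D (s m)) (hw : w ∈ rep D (s (m + n))) (i : ℕ) (hi : i ≤ n) :
    codeAt s (m + i) + flow D ε i (v.1 - (codeAt s m).1,
      (ee D ε ^ n)⁻¹ * (w.2 - (codeAt s (m + n)).2)) ∈ rep D (s (m + i)) := by
  have h0 := (ee_pos he).ne'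
  induction n generalizing w i with
  | zero =>
    obtain rfl : i = 0 := by omega
    have := hM.product _ (s m).2 v hv w (by simpa using hw)
    have e : codeAt s (m + (0 : ℕ)) + flow D ε (0 : ℕ) (v.1 - (codeAt s m).1,
        (ee D ε ^ 0)⁻¹ * (w.2 - (codeAt s (m + (0 : ℕ))).2)) = (v.1, w.2) := by
      refine Prod.ext ?_ ?_ <;> simp [flow]
    rw [e]
    simpa using this
  | succ n ih =>
    have hcast : m + ((n + 1 : ℕ) : ℤ) = m + n + 1 := by push_cast; ring
    rw [hcast] at hw ⊢
    have hstep := hM.step_spec (hs (m + n))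
    have hmk := hM.markov _ (s (m + n)).2 _ (s (m + n + 1)).2 _ hstep
    obtain ⟨u, hu, -⟩ := hstep.2
    -- Full crossing pulls the prescribed final height back by one step, and the induction
    -- hypothesis applies there. The point `u` is auxiliary: only the second coordinate of the
    -- result is used.
    have hw' := (hmk u hu w hw).1
    have hc := codeAt_succ hD hsq he hM s (m + n)
    have hc1 : (codeAt s (m + n + 1)).1 =
        el D ε * (codeAt s (m + n)).1 - (step (s (m + n)) (s (m + n + 1))).1 := by
      rw [hc]
      simp [flow]
    have hc2 : (codeAt s (m + n + 1)).2 =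
        ee D ε * (codeAt s (m + n)).2 - (step (s (m + n)) (s (m + n + 1))).2 := by
      rw [hc]
      simp [flow]
    have hδ : (ee D ε ^ n)⁻¹ * ((w.2 + (step (s (m + n)) (s (m + n + 1))).2) / ee D ε -
        (codeAt s (m + n)).2) = (ee D ε ^ (n + 1))⁻¹ * (w.2 - (codeAt s (m + n + 1)).2) := by
      rw [hc2, pow_succ]
      field_simp
      ring
    have ih' := fun i hi => ih hw' i hi
    simp only [hδ] at ih'
    rcases Nat.lt_or_ge n i with hni | hni
    · obtain rfl : i = n + 1 := by omega
      rw [hcast]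
      have h1 := (hmk _ (ih' n le_rfl) w hw).2
      convert h1 using 1
      refine Prod.ext ?_ ?_
      · simp only [flow, Prod.fst_add, zpow_natCast]
        rw [hc1]
        ring
      · simp only [flow, Prod.snd_add, zpow_natCast]
        field_simp
        ring
    · exact ih' i hni

lemma rep_subset_closedFootprint (A : Set (Torus D)) : rep D A ⊆ closedFootprint D :=
  inter_subset_left.trans footprint_subset_closedFootprint

/-- Points of the plane near `code s` whose orbits follow `s` for a long time. -/
lemma exists_shadow (hD : 1 < D) (hsq : Squarefree D) (he : 1 < ee D ε) (hM : IsMarkov D ε) :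
    ∃ C, ∀ s ∈ Sig D ε, ∀ N : ℕ, ∃ η : V, ‖η‖ ≤ C * (ee D ε)⁻¹ ^ N ∧
      ∀ i : ℤ, -(N : ℤ) ≤ i → i ≤ N → codeAt s i + flow D ε i η ∈ rep D (s i) := by
  obtain ⟨C, hC⟩ := exists_code_bound hD hsq he hM
  have h0 := ee_pos he
  have h0' := inv_ee_nonneg he
  refine ⟨1 + ra D + rb D + C, fun s hs N => ?_⟩
  have hne : ∀ k, ∃ v, v ∈ rep D (s k) := fun k =>
    let ⟨v, hv, _⟩ := (hM.step_spec (hs k)).2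
    ⟨v, hv⟩
  -- The stable coordinate is prescribed at time -N and the unstable one at time N. Both deviations
  -- have shrunk by ε⁻ᴺ at time 0.
  obtain ⟨v, hv⟩ := hne (-N)
  obtain ⟨w, hw⟩ := hne (-N + (2 * N : ℕ))
  have key := codeAt_add_flow_mem_rep hD hsq he hM hs (-N) (2 * N) hv hw
  set δ : V := (v.1 - (codeAt s (-N)).1,
    (ee D ε ^ (2 * N))⁻¹ * (w.2 - (codeAt s (-N + (2 * N : ℕ))).2)) with hδ
  have hbd : ∀ k, ∀ u ∈ rep D (s k), ‖u - codeAt s k‖ ≤ 1 + ra D + rb D + C := fun k u hu =>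
    (norm_sub_le _ _).trans (add_le_add
      (closedFootprint_bounded hD hsq (rep_subset_closedFootprint _ hu)) (hC _))
  refine ⟨flow D ε N δ, ?_, fun i hi hi' => ?_⟩
  · rw [flow, Prod.norm_mk, max_le_iff, norm_mul, norm_mul, zpow_natCast, zpow_natCast, norm_pow,
      norm_pow, Real.norm_eq_abs (el D ε), abs_el hD hsq he, Real.norm_of_nonneg h0.le]
    constructor
    · rw [mul_comm]
      refine mul_le_mul_of_nonneg_right ?_ (by positivity)
      exact (norm_fst_le (v - codeAt s (-N))).trans (hbd _ v hv)
    · have h1 : ee D ε ^ N * ‖δ.2‖ =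
          ‖(w - codeAt s (-N + (2 * N : ℕ))).2‖ * (ee D ε)⁻¹ ^ N := by
        rw [hδ, norm_mul, norm_inv, norm_pow, Real.norm_of_nonneg h0.le, Prod.snd_sub, two_mul,
          pow_add, inv_pow]
        field_simp
      rw [h1]
      refine mul_le_mul_of_nonneg_right ?_ (by positivity)
      exact (norm_snd_le _).trans (hbd _ w hw)
  · have h1 := key (i + N).toNat (by omega)
    have h2 : -(N : ℤ) + ((i + N).toNat : ℤ) = i := by omega
    have h3 : (((i + N).toNat : ℕ) : ℤ) = i + N := by omega
    rw [h2, h3] at h1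
    rwa [flow_flow hD hsq he]

/-- The word `s_{-n} ⋯ s_n`. -/
def centralWord (s : ℤ → P0 D ε) (n : ℕ) : Word D ε n := fun i => s i

lemma mem_rect_iff {n : ℕ} {w : Word D ε n} {x : Torus D} :
    x ∈ rect D ε n w ↔ ∀ i : Icc (-(n : ℤ)) n, (phi D ε ^ (i : ℤ)) x ∈ (w i : Set (Torus D)) := by
  simp only [rect, mem_iInter, mem_preimage]

/-- The shadowing points tend to `code s` and lie in the rectangle once `N ≥ n`. The closure is
needed because `code s` may be a boundary point. -/
lemma code_mem_closure_rep_rect (hD : 1 < D) (hsq : Squarefree D) (he : 1 < ee D ε)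
    (hM : IsMarkov D ε) {s : ℤ → P0 D ε} (hs : s ∈ Sig D ε) (n : ℕ) :
    code s ∈ closure (rep D (rect D ε n (centralWord s n))) := by
  obtain ⟨C, hC⟩ := exists_shadow hD hsq he hM
  choose η hη1 hη2 using hC s hs
  have hlim : Tendsto (fun N => code s + η N) atTop (𝓝 (code s)) := by
    have h1 : Tendsto (fun N : ℕ => C * (ee D ε)⁻¹ ^ N) atTop (𝓝 0) := by
      simpa using (tendsto_pow_atTop_nhds_zero_of_lt_one (inv_ee_nonneg he)
        (inv_lt_one_of_one_lt₀ he)).const_mul C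
    simpa using (squeeze_zero_norm hη1 h1).const_add (code s)
  refine mem_closure_of_tendsto hlim ?_
  filter_upwards [eventually_ge_atTop n] with N hN
  have h0 := hη2 N 0 (by omega) (by omega)
  rw [flow_zero, codeAt_zero] at h0
  refine ⟨h0.1, mem_rect_iff.2 fun i => ?_⟩
  have hi := i.2
  rw [mem_Icc] at hi
  have h1 := (hη2 N i (by omega) (by omega)).2
  rw [phi_zpow_proj hD hsq he, flow_add]
  have h2 : proj D (flow D ε i (code s) + flow D ε i (η N)) =
      proj D (codeAt s i + flow D ε i (η N)) := by
    rw [proj_eq_iff, add_sub_add_right_eq_sub, ← codeAt_zero s]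
    simpa using flow_code_sub_mem hD hsq he hM s 0 i
  rw [h2]
  exact h1

lemma rect_centralWord_mem_P (hD : 1 < D) (hsq : Squarefree D) (he : 1 < ee D ε)
    (hM : IsMarkov D ε) {s : ℤ → P0 D ε} (hs : s ∈ Sig D ε) (n : ℕ) :
    rect D ε n (centralWord s n) ∈ P D ε n := by
  have h := code_mem_closure_rep_rect hD hsq he hM hs n
  obtain ⟨v, hv⟩ := closure_nonempty_iff.1 ⟨_, h⟩
  exact ⟨⟨_, hv.2⟩, _, rfl⟩

lemma eq_of_mem_footprint (hD : 1 < D) (hsq : Squarefree D) {v w : V} (hv : v ∈ footprint D)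
    (hw : w ∈ footprint D) (h : proj D v = proj D w) : v = w := by
  obtain ⟨i, hi⟩ := mem_footprint_iff.1 hv
  obtain ⟨j, hj⟩ := mem_footprint_iff.1 hw
  exact (eq_zero_of_planeR_sub hD hsq hi hj (proj_eq_iff.1 h)).1

/-- By uniqueness of translations the lifted orbit of `x` obeys the same recursion as `codeAt s`.
The difference is thus an orbit of the linear flow that is bounded at times -n and n, hence of size
ε⁻ⁿ at time 0. -/
lemma exists_rep_rect_bound (hD : 1 < D) (hsq : Squarefree D) (he : 1 < ee D ε)
    (hM : IsMarkov D ε) : ∃ C, ∀ s ∈ Sig D ε, ∀ n : ℕ,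
      ∀ x ∈ rep D (rect D ε n (centralWord s n)), ‖x - code s‖ ≤ C * (ee D ε)⁻¹ ^ n := by
  obtain ⟨C, hC⟩ := exists_code_bound hD hsq he hM
  have h0 := ee_pos he
  have h0' := inv_ee_nonneg he
  refine ⟨1 + ra D + rb D + C, fun s hs n x hx => ?_⟩
  have hbd : ∀ k, ∀ u ∈ rep D (s k), ‖u - codeAt s k‖ ≤ 1 + ra D + rb D + C := fun k u hu =>
    (norm_sub_le _ _).trans (add_le_add
      (closedFootprint_bounded hD hsq (rep_subset_closedFootprint _ hu)) (hC _))
  have hlift : ∀ i : ℤ, -(n : ℤ) ≤ i → i ≤ n → ∃ v ∈ rep D (s i), proj D v =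
      (phi D ε ^ i) (proj D x) := fun i hi hi' =>
    hM.lift _ (s i).2 _ (mem_rect_iff.1 hx.2 ⟨i, hi, hi'⟩)
  choose! y hy1 hy2 using hlift
  have hy0 : y 0 = x := eq_of_mem_footprint hD hsq (hy1 0 (by omega) (by omega)).1 hx.1
    (by simpa using hy2 0 (by omega) (by omega))
  have hsucc : ∀ i : ℤ, -(n : ℤ) ≤ i → i < n →
      y (i + 1) - codeAt s (i + 1) = flow D ε 1 (y i - codeAt s i) := by
    intro i hi hi'
    have h1 := hy2 i hi (by omega)
    have h2 := hy2 (i + 1) (by omega) (by omega)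
    have h3 : flow D ε 1 (y i) - y (i + 1) ∈ lattice D := by
      rw [← proj_eq_iff, ← phi_proj, h1, h2, add_comm, zpow_add, Equiv.Perm.mul_apply, zpow_one]
    have h4 : Step D ε (rep D (s i)) (rep D (s (i + 1))) (flow D ε 1 (y i) - y (i + 1)) :=
      ⟨h3, y i, hy1 i hi (by omega), by
        rw [sub_sub_cancel]
        exact hy1 (i + 1) (by omega) (by omega)⟩
    have h5 := hM.unique _ (s i).2 _ (s (i + 1)).2 _ _ h4 (hM.step_spec (hs i))
    rw [codeAt_succ hD hsq he hM, ← h5, flow_sub]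
    abel
  have hiter : ∀ k : ℕ, k ≤ 2 * n →
      y (-n + k) - codeAt s (-n + k) = flow D ε k (y (-n) - codeAt s (-n)) := by
    intro k
    induction k with
    | zero => intro _; simp [flow_zero]
    | succ k ih =>
      intro hk
      have h1 := hsucc (-n + k) (by omega) (by omega)
      rw [ih (by omega), flow_flow hD hsq he] at h1
      push_cast
      rw [← add_assoc, h1, add_comm (1 : ℤ)]
  set d := y (-n) - codeAt s (-n) with hd
  have hd1 : ‖d‖ ≤ 1 + ra D + rb D + C := hbd _ _ (hy1 _ (by omega) (by omega))
  have h1 : x - code s = flow D ε n d := by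
    rw [← hiter n (by omega), neg_add_cancel, hy0, codeAt_zero]
  have h2 : ‖flow D ε (2 * n : ℕ) d‖ ≤ 1 + ra D + rb D + C := by
    rw [← hiter (2 * n) le_rfl]
    exact hbd _ _ (hy1 _ (by omega) (by omega))
  rw [h1, flow, Prod.norm_mk, max_le_iff, norm_mul, norm_mul, zpow_natCast, zpow_natCast, norm_pow,
    norm_pow, Real.norm_eq_abs (el D ε), abs_el hD hsq he, Real.norm_of_nonneg h0.le]
  constructor
  · rw [mul_comm]
    exact mul_le_mul_of_nonneg_right ((norm_fst_le d).trans hd1) (by positivity)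
  · have h3 : ee D ε ^ n * ‖d.2‖ = ‖(flow D ε (2 * n : ℕ) d).2‖ * (ee D ε)⁻¹ ^ n := by
      rw [flow, norm_mul, zpow_natCast, norm_pow, Real.norm_of_nonneg h0.le, two_mul, pow_add,
        inv_pow]
      field_simp
    rw [h3]
    exact mul_le_mul_of_nonneg_right ((norm_snd_le _).trans h2) (by positivity)

/-- The orbit of a generic point never meets the boundary, so it has an itinerary, and the
rectangles of that itinerary shrink to the coded point. -/
lemma Generic.exists_code_eq (hD : 1 < D) (hsq : Squarefree D) (he : 1 < ee D ε)
    (hM : IsMarkov D ε) {x : V} (hx : Generic D x) (hxF : x ∈ footprint D) :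
    ∃ s ∈ Sig D ε, code s = x := by
  have h1 : ∀ k : ℤ, ∃ A : P0 D ε, (phi D ε ^ k) (proj D x) ∈ (A : Set (Torus D)) := by
    intro k
    obtain ⟨A, hA, h⟩ := hM.cover _ (hx.flow hD hsq he k)
    exact ⟨⟨A, hA⟩, by rwa [phi_zpow_proj hD hsq he]⟩
  choose s hs using h1
  have hsig : s ∈ Sig D ε := by
    intro k
    refine ⟨_, hs k, ?_⟩
    have := hs (k + 1)
    rwa [add_comm k, zpow_add, Equiv.Perm.mul_apply, zpow_one, add_comm] at this
  refine ⟨s, hsig, ?_⟩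
  obtain ⟨C, hC⟩ := exists_rep_rect_bound hD hsq he hM
  have h2 : ∀ n : ℕ, ‖x - code s‖ ≤ C * (ee D ε)⁻¹ ^ n := fun n =>
    hC s hsig n x ⟨hxF, mem_rect_iff.2 fun i => hs i⟩
  have h3 : Tendsto (fun N : ℕ => C * (ee D ε)⁻¹ ^ N) atTop (𝓝 0) := by
    simpa using (tendsto_pow_atTop_nhds_zero_of_lt_one (inv_ee_nonneg he)
      (inv_lt_one_of_one_lt₀ he)).const_mul C
  have h4 : ‖x - code s‖ ≤ 0 := ge_of_tendsto' h3 h2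
  exact (sub_eq_zero.1 (norm_le_zero_iff.1 h4)).symm

/-- The coding map is onto. -/
lemma exists_proj_code_eq (hD : 1 < D) (hsq : Squarefree D) (he : 1 < ee D ε)
    (hM : IsMarkov D ε) (x : Torus D) : ∃ s ∈ Sig D ε, proj D (code s) = x := by
  obtain ⟨v, rfl⟩ : ∃ v, proj D v = x := Quotient.exists_rep x
  obtain ⟨q, hq, hvq⟩ := exists_sub_mem_closedFootprint hD hsq v
  have hopen : IsOpen (footprint D) := (isOpen_planeR 0).union (isOpen_planeR 1)
  have h1 : footprint D ⊆ closure (footprint D ∩ {v | Generic D v}) :=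
    (dense_generic hD hsq).open_subset_closure_inter hopen
  have h2 : footprint D ∩ {v | Generic D v} ⊆ code '' Sig D ε := fun x hx =>
    hx.2.exists_code_eq hD hsq he hM hx.1
  -- The coded points form a compact set containing the generic points of the footprint, which are
  -- dense there; so it contains the closed footprint.
  have h3 := (isCompact_code_image_Sig hD hsq he hM).isClosed.closure_subset_iff.2
    (h1.trans ((isCompact_code_image_Sig hD hsq he hM).isClosed.closure_subset_iff.2 h2))
  obtain ⟨s, hs, hsv⟩ := h3 (closedFootprint_subset_closure hD hsq hvq)
  refine ⟨s, hs, ?_⟩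
  rw [hsv, proj_eq_iff, sub_sub_cancel_left]
  exact (lattice D).neg_mem hq

end Coding

/-! ### Counting the words that code a dynamical ball -/

section Counting

open Dynamics Uniformity

variable {D : ℕ} {ε : (OK D)ˣ}

/-- A coded orbit segment is determined by its end symbols and its total translation vector. -/
lemma eq_of_same_translation (hD : 1 < D) (hsq : Squarefree D) (he : 1 < ee D ε)
    (hM : IsMarkov D ε) {s s' : ℤ → P0 D ε} (hs : s ∈ Sig D ε) (hs' : s' ∈ Sig D ε) {n : ℕ}
    (h0 : s 0 = s' 0) (hn : s n = s' n)
    (h : flow D ε n (code s) - codeAt s n = flow D ε n (code s') - codeAt s' n) :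
    ∀ i : ℕ, i ≤ n → s i = s' i := by
  obtain ⟨v, hv, -⟩ := (hM.step_spec (hs 0)).2
  obtain ⟨w, hw, -⟩ := (hM.step_spec (hs n)).2
  have he0 := (ee_pos he).ne'
  -- The orbit starting at the stable coordinate of `v` and ending at the unstable coordinate of `w`
  -- visits every s_i. Its starting point depends on `s` only through the total translation, so the
  -- two strings share this orbit, and disjointness of the partition identifies their symbols.
  have key : ∀ s ∈ Sig D ε, v ∈ rep D (s 0) → w ∈ rep D (s n) → ∀ i : ℕ, i ≤ n →
      proj D (flow D ε i (v.1, (ee D ε ^ n)⁻¹ * (w.2 +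
        (flow D ε n (code s) - codeAt s n).2))) ∈ (s i : Set (Torus D)) := by
    intro s hs hv hw i hi
    have h1 := (codeAt_add_flow_mem_rep hD hsq he hM hs 0 n hv (by simpa using hw) i hi).2
    simp only [zero_add] at h1
    have h2 : ((v.1, (ee D ε ^ n)⁻¹ * (w.2 + (flow D ε n (code s) - codeAt s n).2)) : V) =
        codeAt s 0 + (v.1 - (codeAt s 0).1, (ee D ε ^ n)⁻¹ * (w.2 - (codeAt s n).2)) := by
      rw [codeAt_zero]
      refine Prod.ext ?_ ?_
      · simp
      · simp only [flow, Prod.snd_add, Prod.snd_sub, zpow_natCast]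
        field_simp
        ring
    rw [h2, flow_add]
    have h3 : ∀ d : V, proj D (flow D ε i (codeAt s 0) + d) = proj D (codeAt s i + d) := by
      intro d
      rw [proj_eq_iff, add_sub_add_right_eq_sub]
      simpa using flow_code_sub_mem hD hsq he hM s 0 i
    rw [h3]
    exact h1
  intro i hi
  have h1 := key s hs hv hw i hi
  have h2 := key s' hs' (h0 ▸ hv) (hn ▸ hw) i hi
  rw [← h] at h2
  exact Subtype.ext (hM.disjoint _ (s i).2 _ (s' i).2 _ h1 h2)

lemma phi_iterate_proj (hD : 1 < D) (hsq : Squarefree D) (he : 1 < ee D ε) (k : ℕ) (v : V) :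
    (phi D ε)^[k] (proj D v) = proj D (flow D ε k v) := by
  rw [← phi_zpow_proj hD hsq he, zpow_natCast, Equiv.Perm.iterate_eq_pow]

/-- Points whose orbits stay close on the torus have lifts whose orbits stay close. -/
lemma exists_close_lift (hD : 1 < D) (hsq : Squarefree D) (he : 1 < ee D ε) {v x : V} {n : ℕ}
    (h : (proj D v, proj D x) ∈ dynEntourage (phi D ε)
      {p : Torus D × Torus D | dist p.1 p.2 < (ee D ε + 1)⁻¹} (n + 1)) :
    ∃ w : V, ‖w‖ < (ee D ε + 1)⁻¹ ∧ ‖flow D ε n w‖ < (ee D ε + 1)⁻¹ ∧ v - x - w ∈ lattice D := by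
  have h0 := ee_pos he
  have h1 : ∀ k : ℕ, k ≤ n → ∃ w : V, ‖w‖ < (ee D ε + 1)⁻¹ ∧
      flow D ε k (v - x) - w ∈ lattice D := by
    intro k hk
    have h2 := mem_dynEntourage.1 h k (by omega)
    rw [phi_iterate_proj hD hsq he, phi_iterate_proj hD hsq he] at h2
    have h3 : ‖proj D (flow D ε k (v - x))‖ < (ee D ε + 1)⁻¹ := by
      rw [flow_sub]
      have h4 : dist (proj D (flow D ε k v)) (proj D (flow D ε k x)) < (ee D ε + 1)⁻¹ := h2
      rw [dist_eq_norm] at h4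
      exact h4
    obtain ⟨w, hw, hwn⟩ := QuotientAddGroup.norm_lt_iff.1 h3
    exact ⟨w, hwn, proj_eq_iff.1 hw.symm⟩
  choose! w hw1 hw2 using h1
  have hind : ∀ k : ℕ, k ≤ n → w k = flow D ε k (w 0) := by
    intro k
    induction k with
    | zero => simp [flow_zero]
    | succ k ih =>
      intro hk
      have h2 : w (k + 1) - flow D ε 1 (w k) ∈ lattice D := by
        have h3 := (lattice D).sub_mem (flow_mem_lattice hD hsq he 1 (hw2 k (by omega)))
          (hw2 (k + 1) hk)
        rw [flow_sub, flow_flow hD hsq he, Nat.cast_succ, add_comm (1 : ℤ)] at h3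
        have h4 : w (k + 1) - flow D ε 1 (w k) =
          flow D ε (k + 1) (v - x) - flow D ε 1 (w k) - (flow D ε (k + 1) (v - x) - w (k + 1)) := by
          abel
        rwa [h4]
      -- The radius δ = 1/(ε + 1) is chosen so that δ + εδ = 1. A lattice vector with both
      -- coordinates below 1 has norm below 1 and vanishes, so the short lifts form one orbit of the
      -- flow.
      have h3 : ‖w (k + 1) - flow D ε 1 (w k)‖ < 1 := by
        calc ‖w (k + 1) - flow D ε 1 (w k)‖ ≤ ‖w (k + 1)‖ + ‖flow D ε 1 (w k)‖ := norm_sub_le _ _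
          _ < (ee D ε + 1)⁻¹ + ee D ε * (ee D ε + 1)⁻¹ := by
            refine add_lt_add_of_lt_of_le (hw1 _ hk) ((norm_flow_le hD hsq he _).trans ?_)
            exact mul_le_mul_of_nonneg_left (hw1 _ (by omega)).le h0.le
          _ = 1 := by field_simp; ring
      have h4 : w (k + 1) - flow D ε 1 (w k) = 0 := by
        refine eq_zero_of_norm_lt_one hD hsq h2 ?_
        have h5 := (norm_fst_le _).trans_lt h3
        have h6 := (norm_snd_le _).trans_lt h3
        rw [Real.norm_eq_abs] at h5 h6
        exact mul_lt_one_of_nonneg_of_lt_one_left (abs_nonneg _) h5 h6.le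
      rw [sub_eq_zero.1 h4, ih (by omega), flow_flow hD hsq he, Nat.cast_succ, add_comm (1 : ℤ)]
  refine ⟨w 0, hw1 0 (by omega), ?_, ?_⟩
  · rw [← hind n le_rfl]
    exact hw1 n le_rfl
  · simpa [flow_zero] using hw2 0 (by omega)

/-- The number of words of given length coding the points of a small dynamical ball is bounded. -/
lemma exists_ncard_words_bound (hD : 1 < D) (hsq : Squarefree D) (he : 1 < ee D ε)
    (hM : IsMarkov D ε) : ∃ C ≠ 0, ∃ W ∈ 𝓤 (Torus D), ∀ S ⊆ Sig D ε, ∀ m ≠ 0, ∀ x,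
      ((fun s (i : Fin m) => s (i : ℤ)) ''
        {s ∈ S | (proj D (code s), x) ∈ dynEntourage (phi D ε) W m}).ncard ≤ C := by
  have := hM.finite.to_subtype
  have h0 := ee_pos he
  obtain ⟨C, hC⟩ := exists_code_bound hD hsq he hM
  set R := 1 + C + (1 + ra D + rb D) with hR
  set L := {q : V | q ∈ lattice D ∧ ‖q‖ ≤ R} with hL
  have hLfin : L.Finite := lattice_bounded_finite hD hsq R
  have hδ1 : (ee D ε + 1)⁻¹ ≤ 1 := inv_le_one_of_one_le₀ (by linarith)
  -- A word is encoded by its two end symbols and by the lattice vectors that compare the coded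
  -- orbit at times 0 and n with fixed lifts in the closed footprint. These vectors have norm at
  -- most `R`, whatever the length of the word.
  set data : Set ((P0 D ε × P0 D ε) × V × V) := univ ×ˢ (L ×ˢ L) with hdata
  have hdfin : data.Finite := finite_univ.prod (hLfin.prod hLfin)
  refine ⟨data.ncard + 1, by omega, {p | dist p.1 p.2 < (ee D ε + 1)⁻¹},
    Metric.dist_mem_uniformity (by positivity), fun S hS m hm x => ?_⟩
  have : Nonempty (P0 D ε) ∨ IsEmpty (P0 D ε) := (isEmpty_or_nonempty _).symm
  obtain hne | hemp := this
  swap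
  · have : IsEmpty (ℤ → P0 D ε) := ⟨fun s => hemp.elim (s 0)⟩
    rw [eq_empty_of_isEmpty {s ∈ S | _}, image_empty, ncard_empty]
    exact Nat.zero_le _
  obtain ⟨n, rfl⟩ := Nat.exists_eq_succ_of_ne_zero hm
  have hlift : ∀ x : Torus D, ∃ v ∈ closedFootprint D, proj D v = x := by
    intro x
    obtain ⟨v, rfl⟩ : ∃ v, proj D v = x := Quotient.exists_rep x
    obtain ⟨q, hq, h⟩ := exists_sub_mem_closedFootprint hD hsq v
    exact ⟨_, h, proj_eq_iff.2 (by simpa using hq)⟩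
  obtain ⟨y, hyF, rfl⟩ := hlift x
  obtain ⟨z, hzF, hzy⟩ := hlift (proj D (flow D ε n y))
  have hrel : ∀ s ∈ {s ∈ S | (proj D (code s), proj D y) ∈ dynEntourage (phi D ε)
      {p | dist p.1 p.2 < (ee D ε + 1)⁻¹} (n + 1)}, ∃ d ∈ data, s 0 = d.1.1 ∧ s n = d.1.2 ∧
      flow D ε n (code s) - codeAt s n = flow D ε n y - z + flow D ε n d.2.1 - d.2.2 := by
    rintro s ⟨-, hs⟩
    obtain ⟨w, hw1, hw2, hw3⟩ := exists_close_lift hD hsq he hs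
    refine ⟨((s 0, s n), (code s - y - w, codeAt s n - z - flow D ε n w)),
      ⟨trivial, ⟨hw3, ?_⟩, ?_, ?_⟩, rfl, rfl, ?_⟩
    · have h1 := norm_sub_le (code s - y) w
      have h2 := norm_sub_le (code s) y
      have h3 := closedFootprint_bounded hD hsq hyF
      have h4 := hC s
      simp only
      linarith
    · have h1 := flow_mem_lattice hD hsq he n hw3
      have h2 := proj_eq_iff.1 hzy
      have h3 := flow_code_sub_mem hD hsq he hM s 0 n
      rw [zero_add, codeAt_zero] at h3
      rw [flow_sub, flow_sub] at h1
      have h4 := (lattice D).sub_mem ((lattice D).sub_mem h1 h2) h3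
      convert h4 using 1
      simp only
      abel
    · have h1 := norm_sub_le (codeAt s n - z) (flow D ε n w)
      have h2 := norm_sub_le (codeAt s n) z
      have h3 := closedFootprint_bounded hD hsq hzF
      have h4 := hC fun i => s (i + n)
      have h5 : ‖codeAt s n‖ ≤ C := h4
      simp only
      linarith
    · simp only
      rw [flow_sub, flow_sub]
      abel
  choose! d hd1 hd2 hd3 hd4 using hrel
  refine le_trans ?_ (Nat.le_succ _)
  set Y := {s ∈ S | (proj D (code s), proj D y) ∈ dynEntourage (phi D ε)
      {p | dist p.1 p.2 < (ee D ε + 1)⁻¹} (n + 1)} with hY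
  set f : (ℤ → P0 D ε) → (Fin (n + 1) → P0 D ε) := fun s i => s (i : ℤ) with hf
  have hsame : ∀ s ∈ Y, ∀ s' ∈ Y, d s = d s' → f s = f s' := by
    intro s hs s' hs' hdd
    have := eq_of_same_translation hD hsq he hM (hS hs.1) (hS hs'.1) (n := n)
      ((hd2 s hs).trans (hdd ▸ (hd2 s' hs').symm)) ((hd3 s hs).trans (hdd ▸ (hd3 s' hs').symm))
      ((hd4 s hs).trans (hdd ▸ (hd4 s' hs').symm))
    funext i
    exact this i (by omega)
  have hchoose : ∀ ω ∈ f '' Y, ∃ s ∈ Y, f s = ω := fun ω hω => hω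
  choose! g hg1 hg2 using hchoose
  refine ncard_le_ncard_of_injOn (fun ω => d (g ω)) (fun ω hω => hd1 _ (hg1 ω hω)) ?_ hdfin
  intro ω hω ω' hω' h
  rw [← hg2 ω hω, ← hg2 ω' hω']
  exact hsame _ (hg1 ω hω) _ (hg1 ω' hω') h

end Counting

/-! ### The Euclidean minimum -/

section Euclidean

variable {D : ℕ} {ε : (OK D)ˣ}

lemma absNorm_nonneg (v : V) : 0 ≤ absNorm v := abs_nonneg _

lemma bddBelow_absNorm (v : V) : BddBelow (range fun q : lattice D => absNorm (v - q)) :=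
  ⟨0, by rintro _ ⟨q, rfl⟩; exact absNorm_nonneg _⟩

lemma MV_nonneg (v : V) : 0 ≤ MV D v := le_ciInf fun _ => absNorm_nonneg _

lemma MV_lt_iff {v : V} {t : ℝ} : MV D v < t ↔ ∃ q ∈ lattice D, absNorm (v - q) < t := by
  rw [MV, ciInf_lt_iff (bddBelow_absNorm v), Subtype.exists]
  simp

lemma MV_le_of_closedFootprint (hD : 1 < D) (hsq : Squarefree D) (v : V) :
    MV D v ≤ (1 + ra D + rb D) ^ 2 := by
  obtain ⟨q, hq, h⟩ := exists_sub_mem_closedFootprint hD hsq v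
  have h1 := closedFootprint_bounded hD hsq h
  refine (ciInf_le (bddBelow_absNorm v) (⟨q, hq⟩ : lattice D)).trans ?_
  rw [absNorm, abs_mul, sq]
  exact mul_le_mul ((norm_fst_le _).trans h1) ((norm_snd_le _).trans h1) (abs_nonneg _)
    ((norm_nonneg _).trans h1)

lemma MV_emb_le_M1 (hD : 1 < D) (hsq : Squarefree D) (x : K D) : MV D (emb D x) ≤ M1 D := by
  refine le_ciSup (f := fun a : K D => M D (proj D (emb D a))) ⟨(1 + ra D + rb D) ^ 2, ?_⟩ x
  rintro _ ⟨a, rfl⟩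
  exact MV_le_of_closedFootprint hD hsq _

lemma M1_nonneg (hD : 1 < D) (hsq : Squarefree D) : 0 ≤ M1 D :=
  (MV_nonneg _).trans (MV_emb_le_M1 hD hsq 0)

/-- A point of small norm is moved by some power of the flow into a bounded box. -/
lemma exists_flow_mem_box (hD : 1 < D) (hsq : Squarefree D) (he : 1 < ee D ε) {c : ℝ} (hc : 0 < c)
    {w : V} (hw : absNorm w < c) :
    ∃ k : ℤ, |(flow D ε k w).1| < √(ee D ε * c) ∧ |(flow D ε k w).2| < √(ee D ε * c) := by
  have h0 := ee_pos he
  have hB : 0 < √(ee D ε * c) := Real.sqrt_pos.2 (by positivity)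
  have hB2 : √(ee D ε * c) * √(ee D ε * c) = ee D ε * c := Real.mul_self_sqrt (by positivity)
  set B := √(ee D ε * c)
  rcases eq_or_ne w.2 0 with h | h
  · obtain ⟨n, hn⟩ := exists_pow_lt_of_lt_one (show 0 < B / (|w.1| + 1) by positivity)
      (inv_lt_one_of_one_lt₀ he)
    refine ⟨n, ?_, by simpa [flow, h] using hB⟩
    rw [flow, zpow_natCast, abs_mul, abs_pow, abs_el hD hsq he]
    rw [lt_div_iff₀ (by positivity)] at hn
    have : 0 ≤ (ee D ε)⁻¹ ^ n := pow_nonneg (inv_ee_nonneg he) n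
    nlinarith [abs_nonneg w.1]
  · have hw2 : 0 < |w.2| := abs_pos.2 h
    obtain ⟨k, hk1, hk2⟩ := exists_mem_Ico_zpow (show 0 < B / |w.2| by positivity) he
    rw [le_div_iff₀ hw2] at hk1
    rw [div_lt_iff₀ hw2] at hk2
    -- With B/ε ≤ |εᵏu| < B, the norm bound gives |s| < cε/B = B for the other coordinate. The
    -- interval provided by `exists_mem_Ico_zpow` is open at the opposite end, so equality is
    -- repaired by lowering `k`.
    obtain ⟨k, hk1, hk2⟩ : ∃ k : ℤ, ee D ε ^ k * |w.2| < B ∧ B ≤ ee D ε * (ee D ε ^ k * |w.2|) := by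
      rcases hk1.lt_or_eq with hlt | heq
      · refine ⟨k, hlt, ?_⟩
        rw [zpow_add_one₀ h0.ne'] at hk2
        nlinarith
      · refine ⟨k - 1, ?_, ?_⟩
        · rw [zpow_sub_one₀ h0.ne', ← heq]
          have := inv_lt_one_of_one_lt₀ he
          have h3 : 0 < ee D ε ^ k * |w.2| := by positivity
          nlinarith
        · rw [zpow_sub_one₀ h0.ne', ← heq]
          field_simp
          exact le_rfl
    have hs : |(flow D ε k w).2| = ee D ε ^ k * |w.2| := by
      rw [flow, abs_mul, abs_zpow, abs_of_pos h0]
    refine ⟨k, ?_, by rwa [hs]⟩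
    have hn : |(flow D ε k w).1| * |(flow D ε k w).2| < c := by
      rw [← abs_mul]
      exact (absNorm_flow hD hsq k w).trans_lt hw
    rw [hs] at hn
    by_contra! hcon
    have h3 : 0 < ee D ε ^ k * |w.2| := by positivity
    have h4 : B * B ≤ |(flow D ε k w).1| * (ee D ε * (ee D ε ^ k * |w.2|)) :=
      mul_le_mul hcon hk2 hB.le (abs_nonneg _)
    rw [hB2] at h4
    nlinarith

lemma absNorm_sub_le {v y : V} {B η : ℝ} (hv1 : |v.1| ≤ B) (hv2 : |v.2| ≤ B) (hy : ‖y‖ ≤ η) :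
    absNorm (v - y) ≤ absNorm v + η * (2 * B + η) := by
  have h1 : |y.1| ≤ η := (norm_fst_le y).trans hy
  have h2 : |y.2| ≤ η := (norm_snd_le y).trans hy
  have hη : 0 ≤ η := (norm_nonneg _).trans hy
  have hB : 0 ≤ B := (abs_nonneg _).trans hv1
  have h3 : (v - y).1 * (v - y).2 = v.1 * v.2 - (v.1 * y.2 + y.1 * v.2 - y.1 * y.2) := by
    simp only [Prod.fst_sub, Prod.snd_sub]
    ring
  have a1 : |v.1 * y.2| ≤ B * η := by
    rw [abs_mul]
    exact mul_le_mul hv1 h2 (abs_nonneg _) hB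
  have a2 : |y.1 * v.2| ≤ η * B := by
    rw [abs_mul]
    exact mul_le_mul h1 hv2 (abs_nonneg _) hη
  have a3 : |y.1 * y.2| ≤ η * η := by
    rw [abs_mul]
    exact mul_le_mul h1 h2 (abs_nonneg _) hη
  rw [absNorm, absNorm, h3]
  have b1 := abs_sub (v.1 * v.2) (v.1 * y.2 + y.1 * v.2 - y.1 * y.2)
  have b2 := abs_sub (v.1 * y.2 + y.1 * v.2) (y.1 * y.2)
  have b3 := abs_add_le (v.1 * y.2) (y.1 * v.2)
  linarith

/-- A version of the closing lemma: an almost periodic point is close to a periodic one, along the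
whole orbit segment. -/
lemma exists_periodic_close (hD : 1 < D) (hsq : Squarefree D) (he : 1 < ee D ε) {n : ℕ} (hn : n ≠ 0)
    (w : V) : ∃ y : V, flow D ε n y - y = -w ∧
      ∀ k : ℕ, k ≤ n → ‖flow D ε k y‖ ≤ ‖w‖ / (1 - (ee D ε)⁻¹) := by
  have h0 := ee_pos he
  have hinv := inv_lt_one_of_one_lt₀ he
  have hinv0 := inv_ee_nonneg he
  have hκ : 0 < 1 - (ee D ε)⁻¹ := by linarith
  have habs : ∀ k : ℕ, |el D ε ^ k| = (ee D ε)⁻¹ ^ k := fun k => by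
    rw [abs_pow, abs_el hD hsq he]
  have hpow : (ee D ε)⁻¹ ^ n ≤ (ee D ε)⁻¹ := pow_le_of_le_one hinv0 hinv.le hn
  have hl : 1 - (ee D ε)⁻¹ ≤ |el D ε ^ n - 1| := by
    have h1 := abs_sub_abs_le_abs_sub 1 (el D ε ^ n)
    rw [habs, abs_one, abs_sub_comm] at h1
    linarith
  have hl0 : el D ε ^ n - 1 ≠ 0 := abs_pos.1 (hκ.trans_le hl)
  have hen : 1 < ee D ε ^ n := one_lt_pow₀ he hn
  have hu0 : ee D ε ^ n - 1 ≠ 0 := by linarith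
  refine ⟨(-w.1 / (el D ε ^ n - 1), -w.2 / (ee D ε ^ n - 1)), ?_, fun k hk => ?_⟩
  · refine Prod.ext ?_ ?_
    · simp only [flow, zpow_natCast, Prod.fst_sub, Prod.fst_neg]
      field_simp
      ring
    · simp only [flow, zpow_natCast, Prod.snd_sub, Prod.snd_neg]
      field_simp
      ring
  · rw [flow, Prod.norm_mk, max_le_iff, zpow_natCast, zpow_natCast]
    constructor
    · rw [norm_mul, norm_div, norm_neg, Real.norm_eq_abs (_ ^ _), habs]
      have h1 : (ee D ε)⁻¹ ^ k ≤ 1 := pow_le_one₀ hinv0 hinv.le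
      have h2 : ‖w.1‖ / ‖el D ε ^ n - 1‖ ≤ ‖w‖ / (1 - (ee D ε)⁻¹) :=
        div_le_div₀ (norm_nonneg _) (norm_fst_le w) hκ hl
      exact (mul_le_of_le_one_left (by positivity) h1).trans h2
    · rw [norm_mul, norm_div, norm_neg, norm_pow, Real.norm_of_nonneg h0.le,
        Real.norm_of_nonneg (by linarith : 0 ≤ ee D ε ^ n - 1), ← mul_div_assoc]
      rw [div_le_div_iff₀ (by linarith) hκ]
      have h1 : ee D ε ^ k ≤ ee D ε ^ n := pow_le_pow_right₀ he.le hk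
      have h2 : ee D ε ^ n * (1 - (ee D ε)⁻¹) ≤ ee D ε ^ n - 1 := by
        have h3 : 1 ≤ ee D ε ^ n * (ee D ε)⁻¹ := by
          rw [← div_eq_mul_inv, one_le_div h0]
          exact le_self_pow₀ he.le hn
        linarith
      have h4 : ‖w.2‖ ≤ ‖w‖ := norm_snd_le w
      calc ee D ε ^ k * ‖w.2‖ * (1 - (ee D ε)⁻¹)
          ≤ ee D ε ^ n * ‖w‖ * (1 - (ee D ε)⁻¹) := by gcongr
        _ = ‖w‖ * (ee D ε ^ n * (1 - (ee D ε)⁻¹)) := by ring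
        _ ≤ ‖w‖ * (ee D ε ^ n - 1) := by gcongr

/-- Reduced to the compact footprint, the forward orbit has a convergent subsequence, and two
consecutive terms far along it give the return. -/
lemma exists_almost_return (hD : 1 < D) (hsq : Squarefree D) (he : 1 < ee D ε) (v : V) {η : ℝ}
    (hη : 0 < η) : ∃ i n : ℕ, n ≠ 0 ∧ ∃ x w : V, flow D ε i v - x ∈ lattice D ∧ ‖w‖ < η ∧
      flow D ε n x - x - w ∈ lattice D := by
  have h1 : ∀ k : ℕ, ∃ x ∈ closedFootprint D, flow D ε k v - x ∈ lattice D := by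
    intro k
    obtain ⟨q, hq, h⟩ := exists_sub_mem_closedFootprint hD hsq (flow D ε k v)
    exact ⟨_, h, by rwa [sub_sub_cancel]⟩
  choose x hxF hx using h1
  obtain ⟨a, -, ψ, hψ, ha⟩ := isCompact_closedFootprint.tendsto_subseq hxF
  have h2 : Tendsto (fun k => ‖x (ψ (k + 1)) - x (ψ k)‖) atTop (𝓝 0) := by
    have h3 : Tendsto (fun k => x (ψ (k + 1))) atTop (𝓝 a) := ha.comp (tendsto_add_atTop_nat 1)
    simpa using (h3.sub ha).norm
  obtain ⟨k, hk⟩ := (h2.eventually (gt_mem_nhds hη)).exists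
  have hlt : ψ k < ψ (k + 1) := hψ (Nat.lt_succ_self k)
  refine ⟨ψ k, ψ (k + 1) - ψ k, by omega, x (ψ k), x (ψ (k + 1)) - x (ψ k), hx _, hk, ?_⟩
  have h3 := flow_mem_lattice hD hsq he ((ψ (k + 1) - ψ k : ℕ) : ℤ) (hx (ψ k))
  rw [flow_sub, flow_flow hD hsq he] at h3
  have h4 : ((ψ (k + 1) - ψ k : ℕ) : ℤ) + (ψ k : ℤ) = ψ (k + 1) := by omega
  rw [h4] at h3
  have h5 := (lattice D).sub_mem (hx (ψ (k + 1))) h3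
  convert h5 using 1
  abel

/-- The inhomogeneous minimum of the norm form does not exceed the Euclidean minimum by one. -/
lemma MV_lt_M1_add_one (hD : 1 < D) (hsq : Squarefree D) (he : 1 < ee D ε) (v : V) :
    MV D v < M1 D + 1 := by
  have hM1 := M1_nonneg hD hsq
  have hc : 0 < M1 D + 1 := by linarith
  have hB0 := Real.sqrt_nonneg (ee D ε * (M1 D + 1))
  have hκ : 0 < 1 - (ee D ε)⁻¹ := by
    have := inv_lt_one_of_one_lt₀ he
    linarith
  set B := √(ee D ε * (M1 D + 1)) with hB
  -- Moving a vector of the box |s|, |u| ≤ B by at most `η` changes its norm by at most η(2B + η) ≤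
  -- 1/2, which is the room left between M₁(K) + 1/2 and M₁(K) + 1.
  set η : ℝ := 1 / (2 * (2 * B + 1)) with hη
  have hη0 : 0 < η := by positivity
  have hη1 : η ≤ 1 := by
    rw [hη, div_le_one (by positivity)]
    linarith
  have hη2 : η * (2 * B + η) ≤ 1 / 2 := by
    have h1 : η * (2 * B + 1) = 1 / 2 := by
      rw [hη]
      field_simp
    nlinarith
  obtain ⟨i, n, hn, x, w, hx, hw, hxw⟩ := exists_almost_return hD hsq he v
    (show 0 < η * (1 - (ee D ε)⁻¹) by positivity)
  obtain ⟨y, hy, hyk⟩ := exists_periodic_close hD hsq he hn w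
  have hyη : ∀ k : ℕ, k ≤ n → ‖flow D ε k y‖ ≤ η := fun k hk =>
    (hyk k hk).trans (by rw [div_le_iff₀ hκ]; exact hw.le)
  have hper : flow D ε n (x + y) - (x + y) ∈ lattice D := by
    have : flow D ε n (x + y) - (x + y) = flow D ε n x - x - w + (flow D ε n y - y + w) := by
      rw [flow_add]
      abel
    rwa [this, hy, neg_add_cancel, add_zero]
  obtain ⟨a, ha⟩ := mem_range_emb_of_periodic he hn hper
  have h1 : MV D (x + y) < M1 D + 1 / 2 := by
    rw [← ha]
    have := MV_emb_le_M1 hD hsq a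
    linarith
  obtain ⟨q, hq, hqn⟩ := MV_lt_iff.1 h1
  obtain ⟨k, hk1, hk2⟩ := exists_flow_mem_box hD hsq he hc (hqn.trans (by linarith))
  -- The correction `y` is controlled only at times 0, …, n. Since x + y has period n on the torus,
  -- `k` may be replaced by its residue `r` at the cost of a lattice vector.
  obtain ⟨r, hr⟩ := Int.eq_ofNat_of_zero_le (Int.emod_nonneg k (by exact_mod_cast hn : (n : ℤ) ≠ 0))
  have hrn : r ≤ n := by
    have := Int.emod_lt_of_pos k (by omega : (0 : ℤ) < n)
    omega
  have hmod : flow D ε k (x + y) - flow D ε r (x + y) ∈ lattice D := by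
    rw [← proj_eq_iff, ← phi_zpow_proj hD hsq he, ← phi_zpow_proj hD hsq he]
    have h2 : (phi D ε ^ (n : ℤ)) (proj D (x + y)) = proj D (x + y) := by
      rw [phi_zpow_proj hD hsq he, proj_eq_iff]
      exact hper
    have h3 : k = r + n * (k / n) := by
      rw [← hr]
      exact (Int.emod_add_mul_ediv k n).symm
    conv_lhs => rw [h3, zpow_add, zpow_mul, Equiv.Perm.mul_apply,
      Equiv.Perm.zpow_apply_eq_self_of_apply_eq_self h2]
  have h2 := absNorm_sub_le hk1.le hk2.le (hyη r hrn)
  rw [absNorm_flow hD hsq] at h2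
  have h3 : absNorm (flow D ε k (x + y - q) - flow D ε r y) < M1 D + 1 := by linarith
  have h4 : ∃ p ∈ lattice D, flow D ε k (x + y - q) - flow D ε r y = flow D ε (r + i) v - p := by
    refine ⟨flow D ε (r + i) v - (flow D ε k (x + y - q) - flow D ε r y), ?_, by abel⟩
    have h5 := flow_mem_lattice hD hsq he r hx
    rw [flow_sub, flow_flow hD hsq he] at h5
    have h6 := (lattice D).add_mem ((lattice D).sub_mem h5 hmod) (flow_mem_lattice hD hsq he k hq)
    convert h6 using 1
    rw [flow_sub, flow_add _ x y, flow_add _ x y]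
    abel
  obtain ⟨p, hp, hpe⟩ := h4
  rw [hpe] at h3
  refine MV_lt_iff.2 ⟨flow D ε (-(r + i)) p, flow_mem_lattice hD hsq he _ hp, ?_⟩
  rw [← absNorm_flow hD hsq (r + i), flow_sub, flow_flow hD hsq he, add_neg_cancel, flow_zero]
  exact h3

end Euclidean

/-! ### Entropy of `X_t` through trapping rectangles -/

section Main

open Dynamics Uniformity

variable {D : ℕ} {ε : (OK D)ˣ}

/-- The strings that code points of `X_t`. -/
def codesX (D : ℕ) (ε : (OK D)ˣ) (t : ℝ) : Set (ℤ → P0 D ε) :=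
  {s ∈ Sig D ε | t ≤ MV D (code s)}

lemma IK_finite (hD : 1 < D) (hsq : Squarefree D) : (IK D ε).Finite := by
  set B := √((embO D (ε : OK D)).2 * (M1 D + 1))
  refine ((lattice_bounded_finite hD hsq (1 + ra D + rb D + B)).preimage
    (embO_injective (D := D)).injOn).subset ?_
  rintro q ⟨R, -, v, hv, h1, h2⟩
  refine ⟨⟨q, rfl⟩, ?_⟩
  have h3 := closedFootprint_bounded hD hsq (rep_subset_closedFootprint _ hv)
  have h4 : ‖v - embO D q‖ ≤ B := by
    rw [Prod.norm_def, max_le_iff]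
    exact ⟨h1.le, h2.le⟩
  have h5 : embO D q = v - (v - embO D q) := by abel
  rw [h5]
  exact (norm_sub_le _ _).trans (add_le_add h3 h4)

lemma mapsTo_shift_SigAvoid (n : ℕ) (C : Set (Set (Torus D))) :
    MapsTo shift (SigAvoid D ε n C) (SigAvoid D ε n C) := by
  rintro s ⟨hs, h⟩
  refine ⟨fun k => hs (k + 1), fun w hw => ?_⟩
  rintro ⟨k, hk⟩
  refine h w hw ⟨k + 1, fun i => ?_⟩
  rw [← hk i, shift]
  congr 1
  ring

lemma Sig_translate {s : ℤ → P0 D ε} (hs : s ∈ Sig D ε) (k : ℤ) :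
    (fun i => s (i + k)) ∈ Sig D ε := by
  intro i
  have := hs (i + k)
  rwa [add_right_comm] at this

lemma MV_codeAt (hD : 1 < D) (hsq : Squarefree D) (he : 1 < ee D ε) (hM : IsMarkov D ε)
    (s : ℤ → P0 D ε) (k : ℤ) {q : V} (hq : q ∈ lattice D) :
    MV D (code s) ≤ absNorm (codeAt s k - q) := by
  by_contra! hcon
  have h1 : absNorm (codeAt s k - q) < MV D (code s) := hcon
  have h2 := flow_code_sub_mem hD hsq he hM s 0 k
  rw [zero_add, codeAt_zero] at h2
  have h3 := flow_mem_lattice hD hsq he (-k) ((lattice D).add_mem h2 hq)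
  refine lt_irrefl _ (MV_lt_iff.2 ⟨_, h3, lt_of_eq_of_lt ?_ h1⟩)
  rw [← absNorm_flow hD hsq k, flow_sub, flow_flow hD hsq he, add_neg_cancel, flow_zero]
  congr 1
  abel

lemma isOpen_U (t : ℝ) (I : Set (OK D)) : IsOpen (U D t I) := by
  refine isOpen_biUnion fun q _ => ?_
  have : Continuous fun v : V => absNorm (v - embO D q) := by
    unfold absNorm
    fun_prop
  exact isOpen_lt this continuous_const

lemma isOpen_Rbig : IsOpen (Rbig D ε) := by
  have h1 : Continuous fun v : V => |v.1| := by fun_prop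
  have h2 : Continuous fun v : V => |v.2| := by fun_prop
  exact (isOpen_lt h1 continuous_const).inter (isOpen_lt h2 continuous_const)

/-- A trapping word at position `k` would place `codeAt s k` in U(t, I), forcing M < t at the coded
point. -/
lemma codesX_subset_SigAvoid (hD : 1 < D) (hsq : Squarefree D) (he : 1 < ee D ε)
    (hM : IsMarkov D ε) (t : ℝ) (I : Set (OK D)) (n : ℕ) :
    codesX D ε t ⊆ SigAvoid D ε n (T D ε n t I) := by
  rintro s ⟨hs, hst⟩
  refine ⟨hs, fun w hw => ?_⟩
  rintro ⟨k, hk⟩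
  have h1 : centralWord (fun i => s (i + k)) n = w := by
    funext i
    rw [← hk i, centralWord, add_comm]
  have h2 := code_mem_closure_rep_rect hD hsq he hM (Sig_translate hs k) n
  rw [h1] at h2
  obtain ⟨q, -, hq⟩ := mem_iUnion₂.1 (hw.2 h2)
  have h3 := MV_codeAt hD hsq he hM s k (q := embO D q) ⟨q, rfl⟩
  exact absurd (hst.trans h3) (not_le.2 hq)

/-- A string that does not code a point of `X_t` has a shift whose coded point is trapped. -/
lemma exists_codeAt_mem_U (hD : 1 < D) (hsq : Squarefree D) (he : 1 < ee D ε)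
    (hM : IsMarkov D ε) {t : ℝ} {I : Set (OK D)} (hI : IK D ε ⊆ I) {s : ℤ → P0 D ε}
    (hs : s ∈ Sig D ε) (hst : MV D (code s) < t) : ∃ k, codeAt s k ∈ U D t I := by
  have hc : 0 < M1 D + 1 := by
    have := M1_nonneg hD hsq
    linarith
  -- The bound by M₁(K) + 1 will put the translating lattice point into I_K, and the bound by `t`
  -- will make it trap.
  obtain ⟨q, hq, hqn⟩ := MV_lt_iff.1 (lt_min hst (MV_lt_M1_add_one hD hsq he (code s)))
  obtain ⟨k, hk⟩ := exists_flow_mem_box hD hsq he hc (hqn.trans_le (min_le_right _ _))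
  have h2 := flow_code_sub_mem hD hsq he hM s 0 k
  rw [zero_add, codeAt_zero] at h2
  have h3 := (lattice D).sub_mem (flow_mem_lattice hD hsq he k hq) h2
  have h4 : codeAt s k - (flow D ε k q - (flow D ε k (code s) - codeAt s k)) =
      flow D ε k (code s - q) := by
    rw [flow_sub]
    abel
  obtain ⟨r, hr⟩ := h3
  have hr : embO D r = flow D ε k q - (flow D ε k (code s) - codeAt s k) := hr
  rw [← hr] at h4
  have hbox : codeAt s k - embO D r ∈ Rbig D ε := by
    rw [h4]
    exact hk
  have hcl : codeAt s k ∈ closure (rep D (s k)) := by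
    refine closure_mono ?_ (code_mem_closure_rep_rect hD hsq he hM (Sig_translate hs k) 0)
    rintro x ⟨hx, hx'⟩
    have := mem_rect_iff.1 hx' ⟨0, by simp⟩
    exact ⟨hx, by simpa [centralWord] using this⟩
  have hopen : IsOpen {v : V | v - embO D r ∈ Rbig D ε} :=
    isOpen_Rbig.preimage (continuous_id.sub continuous_const)
  -- The coded point is only in the closure of the rectangle, but the box is open, so the rectangle
  -- itself meets it, as membership in I_K demands.
  obtain ⟨v, hv, hvr⟩ := mem_closure_iff.1 hcl _ hopen hbox
  have hrI : r ∈ I := hI ⟨_, (s k).2, v, hvr, hv⟩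
  refine ⟨k, mem_iUnion₂.2 ⟨r, hrI, ?_⟩⟩
  change absNorm _ < t
  rw [h4, absNorm_flow hD hsq]
  exact hqn.trans_le (min_le_left _ _)

/-- Strings agreeing with `s` on a long window code, after the same shift, points near a fixed point
of the open set U(t, I). For large `n` their rectangles lie in a ball inside U(t, I), so their
central words are forbidden. A string outside Σ already fails at one transition, visible in a finite
window. -/
lemma eventually_not_agree (hD : 1 < D) (hsq : Squarefree D) (he : 1 < ee D ε)
    (hM : IsMarkov D ε) {t : ℝ} {I : Set (OK D)} (hI : IK D ε ⊆ I) {s : ℤ → P0 D ε}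
    (hs : s ∉ codesX D ε t) :
    ∃ j, ∀ᶠ n in atTop, ∀ s' ∈ SigAvoid D ε n (T D ε n t I), ¬ Agree j s s' := by
  by_cases hsig : s ∈ Sig D ε
  swap
  · have : ∃ k : ℤ, ¬ ((s k : Set (Torus D)) ∩ phi D ε ⁻¹' (s (k + 1) : Set (Torus D))).Nonempty := by
      by_contra! hcon
      exact hsig hcon
    obtain ⟨k, hk⟩ := this
    refine ⟨k.natAbs + 1, Eventually.of_forall fun n s' hs' hag => hk ?_⟩
    rw [hag k (by omega) (by omega),
      hag (k + 1) (by omega) (by omega)]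
    exact hs'.1 k
  have hlt : MV D (code s) < t := by
    by_contra! hcon
    exact hs ⟨hsig, hcon⟩
  obtain ⟨k, hk⟩ := exists_codeAt_mem_U hD hsq he hM hI hsig hlt
  obtain ⟨ρ, hρ, hball⟩ := Metric.isOpen_iff.1 (isOpen_U t I) _ hk
  obtain ⟨j, hj⟩ := exists_agree_code_close hD hsq he hM (half_pos hρ)
  obtain ⟨C, hC⟩ := exists_rep_rect_bound hD hsq he hM
  have h3 : Tendsto (fun N : ℕ => C * (ee D ε)⁻¹ ^ N) atTop (𝓝 0) := by
    simpa using (tendsto_pow_atTop_nhds_zero_of_lt_one (inv_ee_nonneg he)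
      (inv_lt_one_of_one_lt₀ he)).const_mul C
  refine ⟨j + k.natAbs, ?_⟩
  filter_upwards [h3.eventually (gt_mem_nhds (half_pos hρ))] with n hn s' hs' hag
  have hag' : Agree j (fun i => s (i + k)) (fun i => s' (i + k)) := fun i hi hi' =>
    hag (i + k) (by omega) (by omega)
  have hs'k := Sig_translate hs'.1 k
  have hclose := hj _ _ hag'
  have hsub : closure (rep D (rect D ε n (centralWord (fun i => s' (i + k)) n))) ⊆ U D t I := by
    refine (closure_minimal (t := Metric.closedBall (code fun i => s' (i + k))
      (C * (ee D ε)⁻¹ ^ n)) ?_ Metric.isClosed_closedBall).trans (Subset.trans ?_ hball)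
    · intro x hx
      rw [Metric.mem_closedBall, dist_eq_norm]
      exact hC _ hs'k n x hx
    · refine Metric.closedBall_subset_ball' ?_
      rw [dist_eq_norm, norm_sub_rev]
      have : ‖codeAt s k - code fun i => s' (i + k)‖ < ρ / 2 := hclose
      linarith
  refine hs'.2 (centralWord (fun i => s' (i + k)) n)
    ⟨rect_centralWord_mem_P hD hsq he hM hs'k n, hsub⟩ ⟨k, fun i => ?_⟩
  rw [centralWord, add_comm]

lemma proj_code_image_codesX (hD : 1 < D) (hsq : Squarefree D) (he : 1 < ee D ε)
    (hM : IsMarkov D ε) (t : ℝ) : (fun s => proj D (code s)) '' codesX D ε t = X D t := by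
  ext x
  constructor
  · rintro ⟨s, ⟨-, hs⟩, rfl⟩
    exact hs
  · intro hx
    obtain ⟨s, hs, rfl⟩ := exists_proj_code_eq hD hsq he hM x
    exact ⟨s, ⟨hs, hx⟩, rfl⟩

lemma coverEntropy_X_le (hD : 1 < D) (hsq : Squarefree D) (he : 1 < ee D ε)
    (hM : IsMarkov D ε) (t : ℝ) :
    coverEntropy (phi D ε) (X D t) ≤ shiftEntropy (codesX D ε t) := by
  rw [← proj_code_image_codesX hD hsq he hM]
  refine coverEntropy_image_le_shiftEntropy (semiconj_code hD hsq he hM) (fun W hW => ?_) _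
  obtain ⟨δ, hδ, hW⟩ := Metric.mem_uniformity_dist.1 hW
  obtain ⟨j, hj⟩ := exists_agree_code_close hD hsq he hM hδ
  refine ⟨j, fun s s' h => hW ?_⟩
  rw [dist_eq_norm]
  exact (QuotientAddGroup.norm_mk_le_norm (S := lattice D) (m := code s - code s')).trans_lt
    (hj s s' h)

end Main

end RealQuad

end

theorem corollary1 (D : ℕ) (hD : 1 < D) (hsq : Squarefree D)
    (ε : (RealQuad.OK D)ˣ) (hε : RealQuad.IsFundamentalUnit D ε) :
    (RealQuad.IK D ε).Finite ∧
    ∀ t : ℝ, 0 < t → ∀ I : Set (RealQuad.OK D), I.Finite → RealQuad.IK D ε ⊆ I →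
      Filter.Tendsto
        (fun n : ℕ => RealQuad.shiftEntropy
          (RealQuad.SigAvoid D ε n (RealQuad.T D ε n t I)))
        Filter.atTop
        (nhds (Dynamics.coverEntropy (RealQuad.phi D ε) (RealQuad.X D t))) := by
  have he : 1 < RealQuad.ee D ε := hε.1
  have hM := RealQuad.isMarkov hD hsq hε
  have := hM.finite.to_subtype
  refine ⟨RealQuad.IK_finite hD hsq, fun t _ I _ hI => ?_⟩
  obtain ⟨C, hC0, W, hW, hC⟩ := RealQuad.exists_ncard_words_bound hD hsq he hM
  refine RealQuad.tendsto_shiftEntropy (S := RealQuad.codesX D ε t)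
    (fun n => RealQuad.mapsTo_shift_SigAvoid n _)
    (fun n => RealQuad.codesX_subset_SigAvoid hD hsq he hM t I n)
    (fun s hs => RealQuad.eventually_not_agree hD hsq he hM hI hs)
    (RealQuad.coverEntropy_X_le hD hsq he hM t) hW C fun m hm => ?_
  exact RealQuad.ncard_image_le_mul_coverMincard (RealQuad.phi D ε) (RealQuad.X D t) W m C hC0
    (RealQuad.codesX D ε t) (fun s => RealQuad.proj D (RealQuad.code s)) (fun s hs => hs.2) _
    (hC _ (fun s hs => hs.1) m hm)
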